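/- **Setting.** Let $1\le q_1\le q_2\le\cdots$ be a given infinite sequence of real numbers with counting function $\mathcal A(x)=\#\{n: q_n\le x\}$, and suppose that for some constants $\alpha,\beta>0$, $A\ge 0$ and $B>\max\{A,1\}$, writing $\beta'=(2+\beta)^2$, $$\mathcal A(x)=\alpha\int_{\beta'}^x(\log (t/\beta))^{A-1}\,dt+O\left(\alpha\int_{\beta'}^x\frac{(\log (t/\beta))^{A-1}}{(\log t)^{B}}\,dt\right)\qquad (x\ge 2\beta').$$ Let $H(x)=\sum_{q_n\le x}1/q_n$, and let $C_{\mathcal A}$ be the limit, as $y\to\infty$, of $H(y)-\frac{\alpha}{A}(\log (y/\beta))^A$ if $A>0$, and of $H(y)-\alpha\log\log (y/\beta)$ if $A=0$. For real random variables $\mathbb X(n)$ let $H_{\mathbb X}(Q)=\sum_{q_n\le Q}\mathbb X(n)/q_n$ and $\Phi_Q(\mathbb X,V)=\mathbb P(H_{\mathbb X}(Q)>V)$. For $V>0$ let $Z=Z(V)$ be the smallest $z$ with $H(z)\ge V$, and let $$\mathcal E(Z)=\frac{\log\log Z}{\log Z}+\frac1{(\log Z)^{B-1}}.$$ **AIH$(L,Q)$.**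 The random variables $\{\mathbb X(n)\}_{q_n\le Q}$ satisfy AIH$(L,Q)$, approximated by the independent random variables $\{\mathbb Y(n)\}_{q_n\le Q}$, if, for all integers $0\le \ell\le L$ and all $n_1,\dots,n_\ell\le\mathcal A(Q)$, the following expectations exist and $$\mathbb E(\mathbb X(n_1)\cdots\mathbb X(n_\ell))=\mathbb E(\mathbb Y(n_1)\cdots\mathbb Y(n_\ell))+O(e^{-L}).$$ **CRVH$(\mathbb Y)$.** The independent random variables $\{\mathbb Y(n)\}_{n\ge1}$ satisfy CRVH$(\mathbb Y)$ if: (i) each $\mathbb Y(n)$ is supported on $[-1,1]$ and $\mathbb E(\mathbb Y(n))=0$; (ii) there are constants $c_0,\kappa>0$ such that $\mathbb P(\mathbb Y(n)>1-1/t)\ge\kappa\exp(-c_0e^{\sqrt t})$ for all $n$ and all $t\ge1$; (iii) there are independent random variables $\mathbb Y_n$ ($n\ge1$), defined on the same probability space as the $\mathbb Y(n)$ and each distributed as $\mathbb Y$, with $\mathbb Y(n)=\mathbb Y_n+O(1/(\log n)^2)$ for $n\ge2$. Put $f_{\mathbb Y}(t)=\log\mathbb E(e^{t\mathbb Y})$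 for $0\le t<1$, $f_{\mathbb Y}(t)=\log\mathbb E(e^{t\mathbb Y})-t$ for $t\ge1$, and $\eta_{\mathbb Y}=\int_0^\infty f_{\mathbb Y}(u)u^{-2}\,du$. **Theorem.** There are constants $c>1$, $\Theta>0$, $K>0$ and $Q_0$, depending only on the sequence $(q_n)$, on $\alpha,\beta,A,B$, on the implied constant in AIH, and on the constants $c_0$, $\kappa$ and the implied constant in CRVH, such that the following holds. Let $Q\ge Q_0$ and $(\log Q)^{2A^2}\le L\le\mathcal A(Q)$. Suppose that $\{\mathbb X(n)\}_{q_n\le Q}$ satisfy AIH$(L,Q)$, approximated by the independent random variables $\{\mathbb Y(n)\}_{q_n\le Q}$, where $\{\mathbb Y(n)\}_{n\ge1}$ satisfy CRVH$(\mathbb Y)$. If $$c\le V\le R(L,Q):=\begin{cases}\frac{\alpha}{A}(\log L)^A+C_{\mathcal A}-(\alpha A\log\log Q+\Theta)(\log L)^{A-1}&\text{if }A>0,\\ \alpha\log\log L+C_{\mathcal A}-(\alpha\log\log\log Q+\Theta)/\log L&\text{if }A=0,\end{cases}$$ then, with $Z=Z(V)$, $$\Phi_Q(\mathbb X,V)=\exp\left(-\alpha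 e^{-\eta_{\mathbb Y}-1}Z(\log Z)^{A-1}(1+\theta)\right)\quad\text{for some real }\theta\text{ with }|\theta|\le K\sqrt{\mathcal E(Z)}.$$ -/

import Mathlib

open MeasureTheory ProbabilityTheory Filter Topology

noncomputable section

namespace LargeDev

/-!  Sequences are indexed from `0`: for a sequence `u` in the mathematical text, indexed by the
positive integers, the Lean term `u n` is the entry with index `n + 1`. -/

/-- The counting function `𝒜(x) = #{n : q_n ≤ x}`. -/
def count (q : ℕ → ℝ) (x : ℝ) : ℕ := Set.ncard {n : ℕ | q n ≤ x}

/-- The standing hypotheses on the weights `1 ≤ q_1 ≤ q_2 ≤ …`: with `β' = (2 + β)²`,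
`𝒜(x) = α ∫_{β'}^x (log (t/β))^{A-1} (1 + O((log t)^{-B})) dt` for all `x ≥ 2β'`, where the
error term is the integrated one (the counting function is a step function, so the `O`-term
cannot be a fixed function of `t` alone). -/
structure IsRegularSequence (q : ℕ → ℝ) (α β A B : ℝ) : Prop where
  one_le : 1 ≤ q 0
  monotone : Monotone q
  alpha_pos : 0 < α
  beta_pos : 0 < β
  A_nonneg : 0 ≤ A
  lt_B : max A 1 < B
  count_asymp : ∃ C : ℝ, ∀ x : ℝ, 2 * (2 + β) ^ 2 ≤ x →
    |(count q x : ℝ) - α * ∫ t in ((2 + β) ^ 2)..x, Real.log (t / β) ^ (A - 1)| ≤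
      C * (α * ∫ t in ((2 + β) ^ 2)..x, Real.log (t / β) ^ (A - 1) / Real.log t ^ B)

/-- The harmonic sum `H(x) = ∑_{q_n ≤ x} 1 / q_n`. -/
def harmonicSum (q : ℕ → ℝ) (x : ℝ) : ℝ := ∑ᶠ (n : ℕ) (_ : q n ≤ x), 1 / q n

/-- The constant `C_𝒜`, the limit as `y → ∞` of `H(y) - (α/A) (log (y/β))^A` if `A > 0`, and of
`H(y) - α log log (y/β)` if `A = 0`. -/
def harmonicConst (q : ℕ → ℝ) (α β A : ℝ) : ℝ :=
  limUnder atTop fun y : ℝ => harmonicSum q y -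
    if A = 0 then α * Real.log (Real.log (y / β)) else α / A * Real.log (y / β) ^ A

/-- `H_X(Q) = ∑_{q_n ≤ Q} X(n) / q_n`. -/
def weightedSum {Ω : Type*} (q : ℕ → ℝ) (X : ℕ → Ω → ℝ) (Q : ℝ) (ω : Ω) : ℝ :=
  ∑ᶠ (n : ℕ) (_ : q n ≤ Q), X n ω / q n

/-- `Φ_Q(X, V)`, the probability that `H_X(Q) > V`. -/
def tailProb {Ω : Type*} [MeasurableSpace Ω] (P : Measure Ω) (q : ℕ → ℝ) (X : ℕ → Ω → ℝ)
    (Q V : ℝ) : ℝ :=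
  P.real {ω | V < weightedSum q X Q ω}

/-- The hypothesis AIH(L, Q) for `{X(n)}_{q_n ≤ Q}`, with approximating independent random
variables `{Y(n)}_{q_n ≤ Q}` (possibly on another probability space) and implied constant `C`.
The expectations that occur are required to exist. -/
structure AIH {Ω Ω' : Type*} [MeasurableSpace Ω] [MeasurableSpace Ω']
    (P : Measure Ω) (P' : Measure Ω') (q : ℕ → ℝ) (C L Q : ℝ)
    (X : ℕ → Ω → ℝ) (Y : ℕ → Ω' → ℝ) : Prop where
  measurable_X : ∀ n, q n ≤ Q → Measurable (X n)
  measurable_Y : ∀ n, q n ≤ Q → Measurable (Y n)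
  indep : iIndepFun (fun n : {n : ℕ // q n ≤ Q} => Y n) P'
  integrable_X : ∀ (l : ℕ), (l : ℝ) ≤ L → ∀ n : Fin l → ℕ, (∀ i, q (n i) ≤ Q) →
    Integrable (fun ω => ∏ i, X (n i) ω) P
  integrable_Y : ∀ (l : ℕ), (l : ℝ) ≤ L → ∀ n : Fin l → ℕ, (∀ i, q (n i) ≤ Q) →
    Integrable (fun ω => ∏ i, Y (n i) ω) P'
  moment : ∀ (l : ℕ), (l : ℝ) ≤ L → ∀ n : Fin l → ℕ, (∀ i, q (n i) ≤ Q) →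
    |(∫ ω, ∏ i, X (n i) ω ∂P) - ∫ ω, ∏ i, Y (n i) ω ∂P'| ≤ C * Real.exp (-L)

/-- The hypothesis CRVH(𝕐) for the independent random variables `{Y(n)}_{n ≥ 1}`, where `ν` is the
law of `𝕐`. The constants are: `c` and `κ` in `P(Y(n) > 1 - 1/t) ≥ κ exp (-c e^{√t})`, and the
implied constant `C` in `Y(n) = 𝕐_n + O(1/(log n)²)`, which is no condition for the index
`1`, as `log 1 = 0`. -/
structure CRVH {Ω : Type*} [MeasurableSpace Ω] (P : Measure Ω) (κ c C : ℝ)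
    (Y : ℕ → Ω → ℝ) (ν : Measure ℝ) : Prop where
  measurable : ∀ n, Measurable (Y n)
  indep : iIndepFun Y P
  support : ∀ n, ∀ᵐ ω ∂P, Y n ω ∈ Set.Icc (-1 : ℝ) 1
  mean_zero : ∀ n, ∫ ω, Y n ω ∂P = 0
  lower_bound : ∀ n, ∀ t : ℝ, 1 ≤ t →
    κ * Real.exp (-(c * Real.exp (Real.sqrt t))) ≤ P.real {ω | 1 - 1 / t < Y n ω}
  limit : ∃ Z : ℕ → Ω → ℝ, (∀ n, Measurable (Z n)) ∧ iIndepFun Z P ∧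
    (∀ n, P.map (Z n) = ν) ∧
    ∀ n, 1 ≤ n → ∀ᵐ ω ∂P, |Y n ω - Z n ω| ≤ C / Real.log ((n : ℝ) + 1) ^ 2

/-- `f_𝕐(t)`: `log E(e^{t𝕐})` for `t < 1`, and `log E(e^{t𝕐}) - t` for `t ≥ 1`, where `ν` is the
law of `𝕐`. -/
def fLaw (ν : Measure ℝ) (t : ℝ) : ℝ :=
  if t < 1 then Real.log (∫ y, Real.exp (t * y) ∂ν)
  else Real.log (∫ y, Real.exp (t * y) ∂ν) - t

/-- `η_𝕐 = ∫_0^∞ f_𝕐(u) / u² du`. -/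
def eta (ν : Measure ℝ) : ℝ := ∫ u in Set.Ioi (0 : ℝ), fLaw ν u / u ^ 2

/-- `Z(V)`, the smallest `z` with `H(z) ≥ V` (for `V > 0`). -/
def zOf (q : ℕ → ℝ) (V : ℝ) : ℝ := sInf {z : ℝ | V ≤ harmonicSum q z}

/-- `ℰ(Z) = log log Z / log Z + 1 / (log Z)^{B-1}`. -/
def errTerm (B Z : ℝ) : ℝ := Real.log (Real.log Z) / Real.log Z + 1 / Real.log Z ^ (B - 1)

/-- The upper end `R(L, Q)` of the range of `V`, depending on the parameter `Θ`. -/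
def rangeBound (q : ℕ → ℝ) (α β A Θ L Q : ℝ) : ℝ :=
  if A = 0 then
    α * Real.log (Real.log L) + harmonicConst q α β A
      - (α * Real.log (Real.log (Real.log Q)) + Θ) / Real.log L
  else
    α / A * Real.log L ^ A + harmonicConst q α β A
      - (α * A * Real.log (Real.log Q) + Θ) * Real.log L ^ (A - 1)

end LargeDev

end

noncomputable section

namespace LargeDev

/-! ### Elementary facts about powers and logarithms -/

lemma rpow_le_of_comparable {a b x y γ : ℝ} (ha : 0 < a) (hx : 0 < x) (h1 : a * x ≤ y)
    (h2 : y ≤ b * x) : y ^ γ ≤ (a ^ γ + b ^ γ) * x ^ γ := by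
  have hy : 0 < y := lt_of_lt_of_le (by positivity) h1
  have hb : 0 < b := by
    by_contra hb
    nlinarith
  rcases le_total 0 γ with h | h
  · have := Real.rpow_le_rpow hy.le h2 h
    rw [Real.mul_rpow hb.le hx.le] at this
    have : 0 ≤ a ^ γ * x ^ γ := by positivity
    linarith
  · have := Real.rpow_le_rpow_of_nonpos (by positivity) h1 h
    rw [Real.mul_rpow ha.le hx.le] at this
    have : 0 ≤ b ^ γ * x ^ γ := by positivity
    linarith

lemma le_rpow_of_comparable {a b x y γ : ℝ} (ha : 0 < a) (hx : 0 < x) (h1 : a * x ≤ y)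
    (h2 : y ≤ b * x) : (a ^ (-γ) + b ^ (-γ))⁻¹ * x ^ γ ≤ y ^ γ := by
  have hy : 0 < y := lt_of_lt_of_le (by positivity) h1
  have hb : 0 < b := by
    by_contra hb
    nlinarith
  have := rpow_le_of_comparable (γ := -γ) ha hx h1 h2
  rw [Real.rpow_neg hy.le γ, Real.rpow_neg hx.le γ] at this
  have h3 : 0 < a ^ (-γ) + b ^ (-γ) := by positivity
  have hyγ : 0 < y ^ γ := by positivity
  have hxγ : 0 < x ^ γ := by positivity
  rw [inv_mul_le_iff₀ h3]
  rw [inv_le_iff_one_le_mul₀ hyγ] at this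
  field_simp at this
  linarith

lemma two_add_sq_gt_four {β : ℝ} (hβ : 0 < β) : 4 < (2 + β) ^ 2 := by nlinarith

lemma log_div_bounds {β : ℝ} (hβ : 0 < β) :
    ∃ b : ℝ, 1 ≤ b ∧ ∀ t : ℝ, (2 + β) ^ 2 ≤ t →
      1 < Real.log t ∧ 1 / 2 * Real.log t ≤ Real.log (t / β) ∧
        Real.log (t / β) ≤ b * Real.log t := by
  refine ⟨1 + |Real.log β|, by linarith [abs_nonneg (Real.log β)], fun t ht => ?_⟩
  have h4 := two_add_sq_gt_four hβ
  have ht0 : 0 < t := by linarith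
  have h1 : 1 < Real.log t := by
    rw [Real.lt_log_iff_exp_lt ht0]
    linarith [Real.exp_one_lt_d9]
  refine ⟨h1, ?_, ?_⟩
  · rw [Real.log_div ht0.ne' hβ.ne']
    have : Real.log β ≤ 1 / 2 * Real.log t := by
      have h5 : Real.log (β ^ 2) ≤ Real.log t := Real.log_le_log (by positivity) (by nlinarith)
      rw [Real.log_pow] at h5
      push_cast at h5
      linarith
    linarith
  · rw [Real.log_div ht0.ne' hβ.ne']
    nlinarith [neg_abs_le (Real.log β), abs_nonneg (Real.log β)]

lemma tendsto_mul_log_rpow (γ : ℝ) :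
    Tendsto (fun x : ℝ => x ^ (1 / 2 : ℝ) * Real.log x ^ γ) atTop atTop := by
  have h1 := (isLittleO_log_rpow_rpow_atTop (-γ) (show (0 : ℝ) < 1 / 4 by norm_num)).bound
    (show (0 : ℝ) < 1 by norm_num)
  refine tendsto_atTop_mono' _ ?_ (tendsto_rpow_atTop (show (0 : ℝ) < 1 / 4 by norm_num))
  filter_upwards [h1, eventually_gt_atTop (1 : ℝ)] with x hx hx1
  have hl : 0 < Real.log x := Real.log_pos hx1
  have hx0 : 0 < x := by linarith
  rw [Real.norm_of_nonneg (by positivity), Real.norm_of_nonneg (by positivity), one_mul,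
    Real.rpow_neg hl.le, inv_le_iff_one_le_mul₀ (by positivity)] at hx
  calc x ^ (1 / 4 : ℝ) = x ^ (1 / 4 : ℝ) * 1 := by ring
    _ ≤ x ^ (1 / 4 : ℝ) * (x ^ (1 / 4 : ℝ) * Real.log x ^ γ) := by gcongr
    _ = x ^ (1 / 2 : ℝ) * Real.log x ^ γ := by
      rw [← mul_assoc, ← Real.rpow_add hx0]; norm_num

lemma continuousOn_log_rpow (γ : ℝ) : ContinuousOn (fun t : ℝ => Real.log t ^ γ) (Set.Ioi 1) := by
  intro t ht
  have ht' : (1 : ℝ) < t := ht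
  exact ((Real.continuousAt_log (by linarith)).rpow_const
    (Or.inl (Real.log_pos ht').ne')).continuousWithinAt

lemma continuousOn_log_div_rpow {β : ℝ} (hβ : 0 < β) (γ : ℝ) :
    ContinuousOn (fun t : ℝ => Real.log (t / β) ^ γ) (Set.Ici ((2 + β) ^ 2)) := by
  obtain ⟨b, hb, hlog⟩ := log_div_bounds hβ
  intro t ht
  obtain ⟨h1, h2, h3⟩ := hlog t ht
  have ht0 : 0 < t := by have := two_add_sq_gt_four hβ; have : (2 + β) ^ 2 ≤ t := ht; linarith
  have : ContinuousAt (fun t : ℝ => Real.log (t / β)) t :=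
    ContinuousAt.log (by fun_prop) (by positivity)
  exact (this.rpow_const (Or.inl (by linarith))).continuousWithinAt

lemma intervalIntegrable_log_rpow (γ : ℝ) {a b : ℝ} (ha : 1 < a) (hb : 1 < b) :
    IntervalIntegrable (fun t : ℝ => Real.log t ^ γ) volume a b := by
  apply ContinuousOn.intervalIntegrable
  apply (continuousOn_log_rpow γ).mono
  intro t ht
  exact lt_of_lt_of_le (lt_min ha hb) ht.1

lemma intervalIntegrable_log_div_rpow {β : ℝ} (hβ : 0 < β) (γ : ℝ) {a b : ℝ}
    (ha : (2 + β) ^ 2 ≤ a) (hb : (2 + β) ^ 2 ≤ b) :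
    IntervalIntegrable (fun t : ℝ => Real.log (t / β) ^ γ) volume a b := by
  apply ContinuousOn.intervalIntegrable
  apply (continuousOn_log_div_rpow hβ γ).mono
  intro t ht
  exact le_trans (le_min ha hb) ht.1

lemma integral_log_rpow_le (γ : ℝ) {a : ℝ} (ha : 1 < a) :
    ∀ᶠ x in atTop, ∫ t in a..x, Real.log t ^ γ ≤ 3 * (x * Real.log x ^ γ) := by
  set t₀ := max a (Real.exp (2 * |γ|)) with ht₀
  have ht1 : 1 < t₀ := lt_of_lt_of_le ha (le_max_left _ _)
  have hev : ∀ᶠ x : ℝ in atTop, ∫ t in a..t₀, Real.log t ^ γ ≤ x * Real.log x ^ γ := by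
    filter_upwards [(tendsto_mul_log_rpow γ).eventually_ge_atTop (∫ t in a..t₀, Real.log t ^ γ),
      eventually_gt_atTop (1 : ℝ)] with x hx hx1
    refine hx.trans ?_
    have hl : 0 < Real.log x := Real.log_pos hx1
    gcongr
    calc x ^ (1 / 2 : ℝ) ≤ x ^ (1 : ℝ) := Real.rpow_le_rpow_of_exponent_le hx1.le (by norm_num)
      _ = x := Real.rpow_one x
  filter_upwards [hev, eventually_ge_atTop t₀] with x hx hxt
  have hx1 : 1 < x := by linarith
  rw [← intervalIntegral.integral_add_adjacent_intervals
    (intervalIntegrable_log_rpow γ ha ht1) (intervalIntegrable_log_rpow γ ht1 hx1)]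
  have hder : ∀ t ∈ Set.uIcc t₀ x, HasDerivAt (fun t : ℝ => 2 * (t * Real.log t ^ γ))
      (2 * (1 * Real.log t ^ γ + t * (t⁻¹ * γ * Real.log t ^ (γ - 1)))) t := by
    intro t ht
    rw [Set.uIcc_of_le hxt] at ht
    have h1t : 1 < t := lt_of_lt_of_le ht1 ht.1
    exact (((hasDerivAt_id t).mul ((Real.hasDerivAt_log (by linarith)).rpow_const
      (Or.inl (Real.log_pos h1t).ne'))).const_mul 2)
  have hcont : ContinuousOn
      (fun t : ℝ => 2 * (1 * Real.log t ^ γ + t * (t⁻¹ * γ * Real.log t ^ (γ - 1))))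
      (Set.uIcc t₀ x) := by
    rw [Set.uIcc_of_le hxt]
    have hs : Set.Icc t₀ x ⊆ Set.Ioi 1 := fun t ht => lt_of_lt_of_le ht1 ht.1
    have c1 := (continuousOn_log_rpow γ).mono hs
    have c2 := (continuousOn_log_rpow (γ - 1)).mono hs
    have c3 : ContinuousOn (fun t : ℝ => t⁻¹) (Set.Icc t₀ x) :=
      continuousOn_inv₀.mono fun t ht => by
        have : 1 < t := hs ht
        simp only [Set.mem_compl_iff, Set.mem_singleton_iff]; linarith
    exact continuousOn_const.mul ((continuousOn_const.mul c1).add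
      (continuousOn_id.mul ((c3.mul continuousOn_const).mul c2)))
  have hI := intervalIntegral.integral_eq_sub_of_hasDerivAt hder hcont.intervalIntegrable
  have hle : ∫ t in t₀..x, Real.log t ^ γ ≤
      ∫ t in t₀..x, 2 * (1 * Real.log t ^ γ + t * (t⁻¹ * γ * Real.log t ^ (γ - 1))) := by
    apply intervalIntegral.integral_mono_on hxt (intervalIntegrable_log_rpow γ ht1 hx1)
      hcont.intervalIntegrable
    intro t ht
    have h1t : 1 < t := lt_of_lt_of_le ht1 ht.1
    have hl : 0 < Real.log t := Real.log_pos h1t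
    have h2 : 2 * |γ| ≤ Real.log t := by
      rw [Real.le_log_iff_exp_le (by linarith)]
      exact (le_max_right _ _).trans ht.1
    have h3 : Real.log t ^ γ = Real.log t * Real.log t ^ (γ - 1) := by
      rw [Real.rpow_sub_one hl.ne']; field_simp
    have h4 : t * (t⁻¹ * γ * Real.log t ^ (γ - 1)) = γ * Real.log t ^ (γ - 1) := by
      field_simp
    rw [h4, h3]
    have h5 : 0 < Real.log t ^ (γ - 1) := by positivity
    nlinarith [neg_abs_le γ]
  rw [hI] at hle
  have : 0 ≤ t₀ * Real.log t₀ ^ γ := by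
    have := Real.log_pos ht1
    positivity
  linarith

/-! ### The counting function -/

lemma integral_log_div_rpow_le {β : ℝ} (hβ : 0 < β) (γ : ℝ) :
    ∃ K : ℝ, 0 ≤ K ∧ ∀ᶠ x in atTop,
      ∫ t in ((2 + β) ^ 2)..x, Real.log (t / β) ^ γ ≤ K * (x * Real.log x ^ γ) := by
  obtain ⟨b, hb, hlog⟩ := log_div_bounds hβ
  have h4 := two_add_sq_gt_four hβ
  refine ⟨((1 / 2) ^ γ + b ^ γ) * 3, by positivity, ?_⟩
  filter_upwards [integral_log_rpow_le γ (show 1 < (2 + β) ^ 2 by linarith),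
    eventually_ge_atTop ((2 + β) ^ 2)] with x hx hxb
  calc ∫ t in ((2 + β) ^ 2)..x, Real.log (t / β) ^ γ
      ≤ ∫ t in ((2 + β) ^ 2)..x, ((1 / 2) ^ γ + b ^ γ) * Real.log t ^ γ := by
        apply intervalIntegral.integral_mono_on hxb
          (intervalIntegrable_log_div_rpow hβ γ le_rfl hxb)
          ((intervalIntegrable_log_rpow γ (by linarith) (by linarith)).const_mul _)
        intro t ht
        obtain ⟨h1, h2, h3⟩ := hlog t ht.1
        exact rpow_le_of_comparable (by norm_num) (by linarith) h2 h3
    _ ≤ ((1 / 2) ^ γ + b ^ γ) * (3 * (x * Real.log x ^ γ)) := by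
        rw [intervalIntegral.integral_const_mul]
        gcongr
    _ = _ := by ring

lemma le_integral_log_div_rpow {β : ℝ} (hβ : 0 < β) (γ : ℝ) :
    ∃ c : ℝ, 0 < c ∧ ∀ᶠ x in atTop,
      c * (x * Real.log x ^ γ) ≤ ∫ t in ((2 + β) ^ 2)..x, Real.log (t / β) ^ γ := by
  obtain ⟨b, hb, hlog⟩ := log_div_bounds hβ
  have h4 := two_add_sq_gt_four hβ
  set c := ((1 / 4 : ℝ) ^ (-γ) + b ^ (-γ))⁻¹ with hc
  have hc0 : 0 < c := by positivity
  refine ⟨c / 2, by positivity, ?_⟩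
  filter_upwards [eventually_ge_atTop (2 * (2 + β) ^ 2)] with x hx
  have hxb : (2 + β) ^ 2 ≤ x / 2 := by linarith
  have hxb' : (2 + β) ^ 2 ≤ x := by linarith
  rw [← intervalIntegral.integral_add_adjacent_intervals
    (intervalIntegrable_log_div_rpow hβ γ le_rfl hxb)
    (intervalIntegrable_log_div_rpow hβ γ hxb hxb')]
  have i1 : 0 ≤ ∫ t in ((2 + β) ^ 2)..(x / 2), Real.log (t / β) ^ γ := by
    apply intervalIntegral.integral_nonneg hxb
    intro t ht
    obtain ⟨h1, h2, h3⟩ := hlog t ht.1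
    exact Real.rpow_nonneg (by linarith) _
  have i2 : ∫ t in (x / 2)..x, c * Real.log x ^ γ ≤ ∫ t in (x / 2)..x, Real.log (t / β) ^ γ := by
    apply intervalIntegral.integral_mono_on (by linarith) intervalIntegrable_const
      (intervalIntegrable_log_div_rpow hβ γ hxb hxb')
    intro t ht
    obtain ⟨h1, h2, h3⟩ := hlog t (hxb.trans ht.1)
    have ht0 : 0 < t := by linarith [ht.1]
    have hlx : Real.log t ≤ Real.log x := Real.log_le_log ht0 ht.2
    have hlt : 1 / 2 * Real.log x ≤ Real.log t := by
      have h5 : Real.log x ≤ Real.log (t ^ 2) := by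
        apply Real.log_le_log (by linarith)
        nlinarith [ht.1]
      rw [Real.log_pow] at h5
      push_cast at h5
      linarith
    exact le_rpow_of_comparable (by norm_num) (by linarith) (by linarith)
      (h3.trans (by gcongr))
  rw [intervalIntegral.integral_const, smul_eq_mul] at i2
  calc c / 2 * (x * Real.log x ^ γ) = (x - x / 2) * (c * Real.log x ^ γ) := by ring
    _ ≤ _ := by linarith

namespace IsRegularSequence

variable {q : ℕ → ℝ} {α β A B : ℝ}

lemma one_le_all (hq : IsRegularSequence q α β A B) (n : ℕ) : 1 ≤ q n :=
  hq.one_le.trans (hq.monotone (Nat.zero_le n))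

lemma pos (hq : IsRegularSequence q α β A B) (n : ℕ) : 0 < q n := by
  linarith [hq.one_le_all n]

lemma one_lt_B (hq : IsRegularSequence q α β A B) : 1 < B :=
  lt_of_le_of_lt (le_max_right _ _) hq.lt_B

lemma A_lt_B (hq : IsRegularSequence q α β A B) : A < B :=
  lt_of_le_of_lt (le_max_left _ _) hq.lt_B

lemma abs_count_sub_le (hq : IsRegularSequence q α β A B) :
    ∃ K : ℝ, 0 ≤ K ∧ ∀ᶠ x in atTop,
      |(count q x : ℝ) - α * ∫ t in ((2 + β) ^ 2)..x, Real.log (t / β) ^ (A - 1)| ≤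
        K * (x * Real.log x ^ (A - 1 - B)) := by
  obtain ⟨C, hC⟩ := hq.count_asymp
  obtain ⟨b, hb, hlog⟩ := log_div_bounds hq.beta_pos
  have h4 := two_add_sq_gt_four hq.beta_pos
  have hα := hq.alpha_pos
  set M := (1 / 2 : ℝ) ^ (A - 1) + b ^ (A - 1) with hM
  have hM0 : 0 < M := by positivity
  refine ⟨|C| * (α * (M * 3)), by positivity, ?_⟩
  filter_upwards [integral_log_rpow_le (A - 1 - B) (show 1 < (2 + β) ^ 2 by linarith),
    eventually_ge_atTop (2 * (2 + β) ^ 2)] with x hx hxb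
  have hxb' : (2 + β) ^ 2 ≤ x := by linarith
  refine (hC x hxb).trans ?_
  have key : ∀ t ∈ Set.Icc ((2 + β) ^ 2) x,
      0 ≤ Real.log (t / β) ^ (A - 1) / Real.log t ^ B ∧
      Real.log (t / β) ^ (A - 1) / Real.log t ^ B ≤ M * Real.log t ^ (A - 1 - B) := by
    intro t ht
    obtain ⟨h1, h2, h3⟩ := hlog t ht.1
    have hl : 0 < Real.log t := by linarith
    have hl2 : 0 < Real.log (t / β) := by linarith
    refine ⟨by positivity, ?_⟩
    rw [Real.rpow_sub hl, ← mul_div_assoc]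
    gcongr
    exact rpow_le_of_comparable (by norm_num) hl h2 h3
  have hint : IntervalIntegrable (fun t => Real.log (t / β) ^ (A - 1) / Real.log t ^ B) volume
      ((2 + β) ^ 2) x := by
    apply ContinuousOn.intervalIntegrable
    rw [Set.uIcc_of_le hxb']
    apply ContinuousOn.div ((continuousOn_log_div_rpow hq.beta_pos (A - 1)).mono fun t ht => ht.1)
      ((continuousOn_log_rpow B).mono fun t ht => lt_of_lt_of_le (by linarith) ht.1)
    intro t ht
    obtain ⟨h1, h2, h3⟩ := hlog t ht.1
    have hl : 0 < Real.log t := by linarith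
    positivity
  have hle : ∫ t in ((2 + β) ^ 2)..x, Real.log (t / β) ^ (A - 1) / Real.log t ^ B ≤
      M * (3 * (x * Real.log x ^ (A - 1 - B))) := by
    refine (intervalIntegral.integral_mono_on hxb' hint
      ((intervalIntegrable_log_rpow (A - 1 - B) (by linarith) (by linarith)).const_mul M)
      fun t ht => (key t ht).2).trans ?_
    rw [intervalIntegral.integral_const_mul]
    gcongr
  have hnn : 0 ≤ ∫ t in ((2 + β) ^ 2)..x, Real.log (t / β) ^ (A - 1) / Real.log t ^ B :=
    intervalIntegral.integral_nonneg hxb' fun t ht => (key t ht).1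
  calc C * (α * ∫ t in ((2 + β) ^ 2)..x, Real.log (t / β) ^ (A - 1) / Real.log t ^ B)
      ≤ |C| * (α * ∫ t in ((2 + β) ^ 2)..x, Real.log (t / β) ^ (A - 1) / Real.log t ^ B) := by
        gcongr
        exact le_abs_self C
    _ ≤ |C| * (α * (M * (3 * (x * Real.log x ^ (A - 1 - B))))) := by gcongr
    _ = _ := by ring

lemma le_count (hq : IsRegularSequence q α β A B) :
    ∃ c : ℝ, 0 < c ∧ ∀ᶠ x in atTop, c * (x * Real.log x ^ (A - 1)) ≤ count q x := by
  obtain ⟨K, hK, hE⟩ := hq.abs_count_sub_le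
  obtain ⟨c, hc, hI⟩ := le_integral_log_div_rpow hq.beta_pos (A - 1)
  have hα := hq.alpha_pos
  have hB := hq.one_lt_B
  have ht : Tendsto (fun x : ℝ => Real.log x ^ (-B)) atTop (𝓝 0) :=
    (tendsto_rpow_neg_atTop (by linarith)).comp Real.tendsto_log_atTop
  have hsmall : ∀ᶠ x : ℝ in atTop, K * Real.log x ^ (-B) < α * c / 2 := by
    have := ht.const_mul K
    rw [mul_zero] at this
    exact this.eventually_lt_const (by positivity)
  refine ⟨α * c / 2, by positivity, ?_⟩
  filter_upwards [hE, hI, hsmall, eventually_gt_atTop (1 : ℝ)] with x h1 h2 h3 h4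
  have hl : 0 < Real.log x := Real.log_pos h4
  have h5 : Real.log x ^ (A - 1 - B) = Real.log x ^ (A - 1) * Real.log x ^ (-B) := by
    rw [← Real.rpow_add hl]; ring_nf
  have h6 := (abs_le.1 h1).1
  have h7 : K * (x * Real.log x ^ (A - 1 - B)) ≤ α * c / 2 * (x * Real.log x ^ (A - 1)) := by
    rw [h5]
    calc K * (x * (Real.log x ^ (A - 1) * Real.log x ^ (-B))) =
        (K * Real.log x ^ (-B)) * (x * Real.log x ^ (A - 1)) := by ring
      _ ≤ _ := by gcongr
  have h8 := mul_le_mul_of_nonneg_left h2 hα.le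
  nlinarith

lemma count_le (hq : IsRegularSequence q α β A B) :
    ∃ K : ℝ, 0 < K ∧ ∀ᶠ x in atTop, (count q x : ℝ) ≤ K * (x * Real.log x ^ (A - 1)) := by
  obtain ⟨K, hK, hE⟩ := hq.abs_count_sub_le
  obtain ⟨K', hK', hI⟩ := integral_log_div_rpow_le hq.beta_pos (A - 1)
  have hα := hq.alpha_pos
  have hB := hq.one_lt_B
  refine ⟨K + α * K' + 1, by positivity, ?_⟩
  filter_upwards [hE, hI, eventually_gt_atTop (Real.exp 1)] with x h1 h2 h4
  have hx : 0 < x := (Real.exp_pos 1).trans h4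
  have hl : 1 < Real.log x := by rwa [Real.lt_log_iff_exp_lt hx]
  have h5 : Real.log x ^ (A - 1 - B) ≤ Real.log x ^ (A - 1) :=
    Real.rpow_le_rpow_of_exponent_le hl.le (by linarith)
  have h6 := (abs_le.1 h1).2
  have h7 : K * (x * Real.log x ^ (A - 1 - B)) ≤ K * (x * Real.log x ^ (A - 1)) := by gcongr
  have h8 := mul_le_mul_of_nonneg_left h2 hα.le
  have : 0 < x * Real.log x ^ (A - 1) := by positivity
  nlinarith

lemma sqrt_le_count (hq : IsRegularSequence q α β A B) :
    ∀ᶠ x in atTop, Real.sqrt x ≤ count q x := by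
  obtain ⟨c, hc, h⟩ := hq.le_count
  filter_upwards [h, ((tendsto_mul_log_rpow (A - 1)).eventually_ge_atTop (1 / c)),
    eventually_gt_atTop (0 : ℝ)] with x h1 h2 hx
  refine le_trans ?_ h1
  rw [div_le_iff₀ hc] at h2
  rw [Real.sqrt_eq_rpow]
  have h3 : x = x ^ (1 / 2 : ℝ) * x ^ (1 / 2 : ℝ) := by
    rw [← Real.rpow_add hx]; norm_num
  have h4 : 0 < x ^ (1 / 2 : ℝ) := by positivity
  calc x ^ (1 / 2 : ℝ) = x ^ (1 / 2 : ℝ) * 1 := by ring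
    _ ≤ x ^ (1 / 2 : ℝ) * (x ^ (1 / 2 : ℝ) * Real.log x ^ (A - 1) * c) := by gcongr
    _ = c * ((x ^ (1 / 2 : ℝ) * x ^ (1 / 2 : ℝ)) * Real.log x ^ (A - 1)) := by ring
    _ = _ := by rw [← h3]

lemma finite_le (hq : IsRegularSequence q α β A B) (x : ℝ) : {n : ℕ | q n ≤ x}.Finite := by
  by_contra hinf
  obtain ⟨y, h1, h2, h3⟩ := (hq.sqrt_le_count.and
    ((eventually_ge_atTop x).and (eventually_gt_atTop (0 : ℝ)))).exists
  have : {n : ℕ | q n ≤ y}.Infinite :=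
    Set.Infinite.mono (fun n (hn : q n ≤ x) => hn.trans h2) hinf
  rw [count, this.ncard, Nat.cast_zero] at h1
  have := Real.sqrt_pos.2 h3
  linarith

/-- The finite set of indices `n` with `q n ≤ x`. -/
def idx (hq : IsRegularSequence q α β A B) (x : ℝ) : Finset ℕ := (hq.finite_le x).toFinset

@[simp] lemma mem_idx (hq : IsRegularSequence q α β A B) {x : ℝ} {n : ℕ} :
    n ∈ hq.idx x ↔ q n ≤ x := by
  simp [idx]

lemma finsum_eq_sum (hq : IsRegularSequence q α β A B) (x : ℝ) (f : ℕ → ℝ) :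
    ∑ᶠ (n : ℕ) (_ : q n ≤ x), f n = ∑ n ∈ hq.idx x, f n := by
  rw [← finsum_mem_finset_eq_sum]
  simp

lemma harmonicSum_eq (hq : IsRegularSequence q α β A B) (x : ℝ) :
    harmonicSum q x = ∑ n ∈ hq.idx x, 1 / q n :=
  hq.finsum_eq_sum x _

lemma count_eq (hq : IsRegularSequence q α β A B) (x : ℝ) : count q x = (hq.idx x).card := by
  rw [count, idx, Set.ncard_eq_toFinset_card _ (hq.finite_le x)]

lemma idx_filter (hq : IsRegularSequence q α β A B) {x y : ℝ} (h : x ≤ y) :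
    (hq.idx y).filter (fun n => q n ≤ x) = hq.idx x := by
  ext n
  simp only [Finset.mem_filter, mem_idx]
  exact ⟨fun h => h.2, fun h' => ⟨h'.trans h, h'⟩⟩

lemma idx_mono (hq : IsRegularSequence q α β A B) {x y : ℝ} (h : x ≤ y) :
    hq.idx x ⊆ hq.idx y := by
  intro n
  simp only [mem_idx]
  exact fun h' => h'.trans h

lemma harmonicSum_mono (hq : IsRegularSequence q α β A B) : Monotone (harmonicSum q) := by
  intro x y h
  rw [hq.harmonicSum_eq, hq.harmonicSum_eq]
  apply Finset.sum_le_sum_of_subset_of_nonneg (hq.idx_mono h)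
  intro n _ _
  have := hq.pos n
  positivity

lemma harmonicSum_nonneg (hq : IsRegularSequence q α β A B) (x : ℝ) : 0 ≤ harmonicSum q x := by
  rw [hq.harmonicSum_eq]
  apply Finset.sum_nonneg
  intro n _
  have := hq.pos n
  positivity

lemma count_mono (hq : IsRegularSequence q α β A B) :
    Monotone (fun x => (count q x : ℝ)) := by
  intro x y h
  simp only [hq.count_eq]
  exact_mod_cast Finset.card_le_card (hq.idx_mono h)

end IsRegularSequence

/-! ### Asymptotics of the harmonic sum -/

lemma integral_one_div_sq {x y : ℝ} (hx : 0 < x) (hxy : x ≤ y) :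
    ∫ t in x..y, 1 / t ^ 2 = 1 / x - 1 / y := by
  have hder : ∀ t ∈ Set.uIcc x y, HasDerivAt (fun t : ℝ => -t⁻¹) (1 / t ^ 2) t := by
    intro t ht
    rw [Set.uIcc_of_le hxy] at ht
    have : t ≠ 0 := by linarith [ht.1]
    refine (hasDerivAt_inv this).neg.congr_deriv ?_
    rw [neg_neg, one_div]
  have hcont : ContinuousOn (fun t : ℝ => 1 / t ^ 2) (Set.uIcc x y) := by
    rw [Set.uIcc_of_le hxy]
    apply ContinuousOn.div continuousOn_const (by fun_prop)
    intro t ht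
    have : t ≠ 0 := by linarith [ht.1]
    positivity
  rw [intervalIntegral.integral_eq_sub_of_hasDerivAt hder hcont.intervalIntegrable]
  ring

lemma intervalIntegrable_one_div_sq {x y : ℝ} (hx : 0 < x) (hy : 0 < y) :
    IntervalIntegrable (fun t : ℝ => 1 / t ^ 2) volume x y := by
  apply ContinuousOn.intervalIntegrable
  apply ContinuousOn.div continuousOn_const (by fun_prop)
  intro t ht
  have : 0 < t := lt_of_lt_of_le (lt_min hx hy) ht.1
  positivity

lemma intervalIntegrable_step_div_sq (p : ℝ) {x y : ℝ} (hx : 0 < x) (hxy : x ≤ y) :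
    IntervalIntegrable (fun t : ℝ => (if p ≤ t then 1 else 0) / t ^ 2) volume x y := by
  have h := intervalIntegrable_one_div_sq hx (hx.trans_le hxy)
  refine IntervalIntegrable.mono_fun h ?_ ?_
  · exact ((Measurable.ite measurableSet_Ici measurable_const measurable_const).div
      (by fun_prop)).aestronglyMeasurable
  · refine Filter.Eventually.of_forall fun t => ?_
    simp only [norm_div]
    gcongr
    split_ifs <;> simp

lemma step_abel {p x y : ℝ} (hx : 0 < x) (hxy : x ≤ y) :
    (if p ≤ y then 1 / p else 0) - (if p ≤ x then 1 / p else 0) =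
      (if p ≤ y then 1 else 0) / y - (if p ≤ x then 1 else 0) / x +
        ∫ t in x..y, (if p ≤ t then 1 else 0) / t ^ 2 := by
  by_cases h1 : p ≤ x
  · have h2 : p ≤ y := h1.trans hxy
    have : ∫ t in x..y, (if p ≤ t then 1 else 0) / t ^ 2 = ∫ t in x..y, 1 / t ^ 2 := by
      apply intervalIntegral.integral_congr
      intro t ht
      rw [Set.uIcc_of_le hxy] at ht
      simp [h1.trans ht.1]
    rw [this, integral_one_div_sq hx hxy]
    simp only [h1, h2, if_true]
    ring
  · by_cases h2 : p ≤ y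
    · push Not at h1
      have hp : 0 < p := hx.trans h1
      have i1 := intervalIntegrable_step_div_sq p hx h1.le
      have i2 := intervalIntegrable_step_div_sq p hp h2
      rw [← intervalIntegral.integral_add_adjacent_intervals i1 i2]
      have e1 : ∫ t in x..p, (if p ≤ t then (1 : ℝ) else 0) / t ^ 2 = 0 := by
        rw [intervalIntegral.integral_of_le h1.le, integral_Ioc_eq_integral_Ioo,
          setIntegral_congr_fun (g := fun _ => (0 : ℝ)) measurableSet_Ioo]
        · simp
        · intro t ht
          simp [not_le.2 ht.2]
      have e2 : ∫ t in p..y, (if p ≤ t then (1 : ℝ) else 0) / t ^ 2 = ∫ t in p..y, 1 / t ^ 2 := by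
        apply intervalIntegral.integral_congr
        intro t ht
        rw [Set.uIcc_of_le h2] at ht
        simp [ht.1]
      rw [e1, e2, integral_one_div_sq hp h2]
      simp [h2, not_le.2 h1]
    · have : ∫ t in x..y, (if p ≤ t then (1 : ℝ) else 0) / t ^ 2 = ∫ t in x..y, (0 : ℝ) := by
        apply intervalIntegral.integral_congr
        intro t ht
        rw [Set.uIcc_of_le hxy] at ht
        have : ¬ p ≤ t := fun h => h2 (h.trans ht.2)
        simp [this]
      rw [this]
      simp [h1, h2]

/-- The main term `α/A · t^A` (or `α log t`) of the harmonic sum at logarithmic scale. -/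
def mainTerm (α A t : ℝ) : ℝ := if A = 0 then α * Real.log t else α / A * t ^ A

lemma hasDerivAt_mainTerm (α A : ℝ) {t : ℝ} (ht : 0 < t) :
    HasDerivAt (mainTerm α A) (α * t ^ (A - 1)) t := by
  by_cases hA : A = 0
  · have : mainTerm α A = fun t => α * Real.log t := by
      ext t; simp [mainTerm, hA]
    rw [this, hA, zero_sub, Real.rpow_neg_one]
    exact (Real.hasDerivAt_log ht.ne').const_mul α
  · have : mainTerm α A = fun t => α / A * t ^ A := by
      ext t; simp [mainTerm, hA]
    rw [this]
    refine ((Real.hasDerivAt_rpow_const (p := A) (Or.inl ht.ne')).const_mul (α / A)).congr_deriv ?_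
    field_simp

namespace IsRegularSequence

variable {q : ℕ → ℝ} {α β A B : ℝ}

lemma intervalIntegrable_count_div_sq (hq : IsRegularSequence q α β A B) {x y : ℝ} (hx : 0 < x)
    (hxy : x ≤ y) : IntervalIntegrable (fun t => (count q t : ℝ) / t ^ 2) volume x y := by
  have h1 : IntervalIntegrable (fun t => (count q t : ℝ)) volume x y :=
    (hq.count_mono.monotoneOn _).intervalIntegrable
  have h2 : ContinuousOn (fun t : ℝ => 1 / t ^ 2) (Set.uIcc x y) := by
    apply ContinuousOn.div continuousOn_const (by fun_prop)
    intro t ht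
    rw [Set.uIcc_of_le hxy] at ht
    have : 0 < t := by linarith [ht.1]
    positivity
  have := h1.mul_continuousOn h2
  simpa only [mul_one_div] using this

lemma harmonicSum_sub (hq : IsRegularSequence q α β A B) {x y : ℝ} (hx : 0 < x) (hxy : x ≤ y) :
    harmonicSum q y - harmonicSum q x =
      (count q y : ℝ) / y - (count q x : ℝ) / x + ∫ t in x..y, (count q t : ℝ) / t ^ 2 := by
  have hH : ∀ t ≤ y, harmonicSum q t = ∑ n ∈ hq.idx y, if q n ≤ t then 1 / q n else 0 := by
    intro t ht
    rw [hq.harmonicSum_eq, ← hq.idx_filter ht, Finset.sum_filter]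
  have hA : ∀ t ≤ y, (count q t : ℝ) = ∑ n ∈ hq.idx y, if q n ≤ t then (1 : ℝ) else 0 := by
    intro t ht
    rw [hq.count_eq, ← hq.idx_filter ht, Finset.card_filter]
    push_cast
    rfl
  have hI : ∫ t in x..y, (count q t : ℝ) / t ^ 2 =
      ∑ n ∈ hq.idx y, ∫ t in x..y, (if q n ≤ t then (1 : ℝ) else 0) / t ^ 2 := by
    rw [← intervalIntegral.integral_finsetSum fun n _ => intervalIntegrable_step_div_sq (q n) hx hxy]
    apply intervalIntegral.integral_congr
    intro t ht
    rw [Set.uIcc_of_le hxy] at ht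
    simp only
    rw [hA t ht.2, Finset.sum_div]
  rw [hI, hH y le_rfl, hH x hxy, hA y le_rfl, hA x hxy, Finset.sum_div, Finset.sum_div,
    ← Finset.sum_sub_distrib, ← Finset.sum_sub_distrib, ← Finset.sum_add_distrib]
  exact Finset.sum_congr rfl fun n _ => step_abel hx hxy

lemma main_abel (hq : IsRegularSequence q α β A B) {x y : ℝ} (hx : (2 + β) ^ 2 < x)
    (hxy : x ≤ y) :
    mainTerm α A (Real.log (y / β)) - mainTerm α A (Real.log (x / β)) =
      (α * ∫ t in ((2 + β) ^ 2)..y, Real.log (t / β) ^ (A - 1)) / y -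
      (α * ∫ t in ((2 + β) ^ 2)..x, Real.log (t / β) ^ (A - 1)) / x +
        ∫ u in x..y, (α * ∫ t in ((2 + β) ^ 2)..u, Real.log (t / β) ^ (A - 1)) / u ^ 2 := by
  have hβ := hq.beta_pos
  have h4 := two_add_sq_gt_four hβ
  obtain ⟨b, hb, hlog⟩ := log_div_bounds hβ
  set F : ℝ → ℝ := fun u => ∫ t in ((2 + β) ^ 2)..u, Real.log (t / β) ^ (A - 1) with hF
  have hFd : ∀ u, (2 + β) ^ 2 < u → HasDerivAt F (Real.log (u / β) ^ (A - 1)) u := by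
    intro u hu
    apply intervalIntegral.integral_hasDerivAt_right
      (intervalIntegrable_log_div_rpow hβ _ le_rfl hu.le)
    · apply ContinuousOn.stronglyMeasurableAtFilter isOpen_Ioi (s := Set.Ioi ((2 + β) ^ 2))
        ((continuousOn_log_div_rpow hβ (A - 1)).mono Set.Ioi_subset_Ici_self) u hu
    · exact (continuousOn_log_div_rpow hβ (A - 1)).continuousAt (Ici_mem_nhds hu)
  have hcF : ContinuousOn F (Set.uIcc x y) := fun u hu => by
    rw [Set.uIcc_of_le hxy] at hu
    exact (hFd u (hx.trans_le hu.1)).continuousAt.continuousWithinAt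
  have hcI : ContinuousOn (fun u => (α * F u) / u ^ 2) (Set.uIcc x y) := by
    apply ContinuousOn.div (continuousOn_const.mul hcF) (by fun_prop)
    intro u hu
    rw [Set.uIcc_of_le hxy] at hu
    have : 0 < u := by linarith [hu.1]
    positivity
  have hcL : ContinuousOn (fun u => α * Real.log (u / β) ^ (A - 1) / u) (Set.uIcc x y) := by
    rw [Set.uIcc_of_le hxy]
    apply ContinuousOn.div (continuousOn_const.mul ((continuousOn_log_div_rpow hβ (A - 1)).mono
      fun u hu => hx.le.trans hu.1)) continuousOn_id
    intro u hu
    have : 0 < u := by linarith [hu.1]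
    exact this.ne'
  have d1 : ∀ u ∈ Set.uIcc x y, HasDerivAt (fun u => mainTerm α A (Real.log (u / β)) - α * F u / u)
      (α * F u / u ^ 2) u := by
    intro u hu
    rw [Set.uIcc_of_le hxy] at hu
    have hu1 : (2 + β) ^ 2 < u := hx.trans_le hu.1
    have hu0 : 0 < u := by linarith
    obtain ⟨e1, e2, e3⟩ := hlog u hu1.le
    have dl : HasDerivAt (fun u => Real.log (u / β)) (1 / u) u := by
      refine (((hasDerivAt_id u).div_const β).log
        (by simp only [id]; positivity)).congr_deriv ?_
      simp only [id]
      field_simp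
    have dm := (hasDerivAt_mainTerm α A (show 0 < Real.log (u / β) by linarith)).comp u dl
    have dF := ((hFd u hu1).const_mul α).div (hasDerivAt_id u) hu0.ne'
    refine (dm.sub dF).congr_deriv ?_
    simp only [id]
    field_simp
    ring
  have := intervalIntegral.integral_eq_sub_of_hasDerivAt d1 hcI.intervalIntegrable
  rw [this]
  ring

lemma abs_harmonicSum_sub_sub_le (hq : IsRegularSequence q α β A B) :
    ∃ K x₀ : ℝ, 0 ≤ K ∧ ∀ x y : ℝ, x₀ ≤ x → x ≤ y →
      |(harmonicSum q y - mainTerm α A (Real.log (y / β))) -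
        (harmonicSum q x - mainTerm α A (Real.log (x / β)))| ≤ K * Real.log x ^ (A - B) := by
  obtain ⟨K, hK, hE⟩ := hq.abs_count_sub_le
  obtain ⟨x₁, hx₁⟩ := eventually_atTop.1 hE
  have hAB := hq.A_lt_B
  have hβ := hq.beta_pos
  have h4 := two_add_sq_gt_four hβ
  obtain ⟨b, hb, hlog⟩ := log_div_bounds hβ
  refine ⟨2 * K + K / (B - A), max x₁ ((2 + β) ^ 2 + 1), ?_, fun x y hx hxy => ?_⟩
  · have : 0 < B - A := by linarith
    positivity
  have hxx : x₁ ≤ x := (le_max_left _ _).trans hx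
  have hxb : (2 + β) ^ 2 < x := by linarith [le_max_right x₁ ((2 + β) ^ 2 + 1)]
  have hx0 : 0 < x := by linarith
  set I : ℝ → ℝ := fun u => α * ∫ t in ((2 + β) ^ 2)..u, Real.log (t / β) ^ (A - 1) with hI
  have e1 := hq.harmonicSum_sub hx0 hxy
  have e2 := hq.main_abel hxb hxy
  have hint1 := hq.intervalIntegrable_count_div_sq hx0 hxy
  have hint2 : IntervalIntegrable (fun u => I u / u ^ 2) volume x y := by
    apply ContinuousOn.intervalIntegrable
    rw [Set.uIcc_of_le hxy]
    apply ContinuousOn.div _ (by fun_prop)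
    · intro u hu
      have : 0 < u := by linarith [hu.1]
      positivity
    · apply continuousOn_const.mul
      have := intervalIntegral.continuousOn_primitive_interval'
        (intervalIntegrable_log_div_rpow hβ (A - 1) le_rfl (hxb.le.trans hxy)) Set.left_mem_uIcc
      apply this.mono
      rw [Set.uIcc_of_le (hxb.le.trans hxy)]
      exact Set.Icc_subset_Icc hxb.le le_rfl
  have hpt : ∀ u ∈ Set.Icc x y, |(count q u : ℝ) - I u| ≤ K * (u * Real.log u ^ (A - 1 - B)) :=
    fun u hu => hx₁ u (hxx.trans hu.1)
  have hmono : ∀ u ∈ Set.Icc x y, Real.log u ^ (A - 1 - B) ≤ Real.log x ^ (A - B) := by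
    intro u hu
    obtain ⟨f1, f2, f3⟩ := hlog x hxb.le
    have : Real.log x ≤ Real.log u := Real.log_le_log hx0 hu.1
    calc Real.log u ^ (A - 1 - B) ≤ Real.log x ^ (A - 1 - B) :=
          Real.rpow_le_rpow_of_nonpos (by linarith) this (by linarith)
      _ ≤ Real.log x ^ (A - B) := Real.rpow_le_rpow_of_exponent_le f1.le (by linarith)
  have hb1 : ∀ u ∈ Set.Icc x y, |(count q u : ℝ) / u - I u / u| ≤ K * Real.log x ^ (A - B) := by
    intro u hu
    have hu0 : 0 < u := by linarith [hu.1]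
    rw [← sub_div, abs_div, abs_of_pos hu0, div_le_iff₀ hu0]
    refine (hpt u hu).trans ?_
    have := hmono u hu
    calc K * (u * Real.log u ^ (A - 1 - B)) ≤ K * (u * Real.log x ^ (A - B)) := by gcongr
      _ = _ := by ring
  have hder : ∀ u ∈ Set.uIcc x y, HasDerivAt (fun u => -(K / (B - A)) * Real.log u ^ (A - B))
      (K * (Real.log u ^ (A - 1 - B) / u)) u := by
    intro u hu
    rw [Set.uIcc_of_le hxy] at hu
    obtain ⟨f1, f2, f3⟩ := hlog u (hxb.le.trans hu.1)
    have hu0 : 0 < u := by linarith [hu.1]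
    refine (((Real.hasDerivAt_log hu0.ne').rpow_const (p := A - B)
      (Or.inl (by linarith))).const_mul (-(K / (B - A)))).congr_deriv ?_
    have h1 : B - A ≠ 0 := by linarith
    have h2 : A - B - 1 = A - 1 - B := by ring
    rw [h2]
    field_simp
    ring
  have hcd : ContinuousOn (fun u => K * (Real.log u ^ (A - 1 - B) / u)) (Set.uIcc x y) := by
    rw [Set.uIcc_of_le hxy]
    apply continuousOn_const.mul
    apply ContinuousOn.div ((continuousOn_log_rpow _).mono fun u hu => ?_) continuousOn_id
    · intro u hu
      have hu0 : 0 < u := by linarith [hu.1]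
      exact hu0.ne'
    · exact lt_of_lt_of_le (by linarith) hu.1
  have hint : |∫ u in x..y, ((count q u : ℝ) / u ^ 2 - I u / u ^ 2)| ≤
      K / (B - A) * Real.log x ^ (A - B) := by
    rw [← Real.norm_eq_abs]
    refine (intervalIntegral.norm_integral_le_of_norm_le hxy (Filter.Eventually.of_forall ?_)
      hcd.intervalIntegrable).trans ?_
    · intro u hu
      have hu0 : 0 < u := by linarith [hu.1]
      have := hpt u ⟨hu.1.le, hu.2⟩
      rw [← sub_div, Real.norm_eq_abs, abs_div, abs_of_pos (show 0 < u ^ 2 by positivity)]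
      rw [div_le_iff₀ (by positivity)]
      refine this.trans (le_of_eq ?_)
      field_simp
    · rw [intervalIntegral.integral_eq_sub_of_hasDerivAt hder hcd.intervalIntegrable]
      have : 0 ≤ K / (B - A) * Real.log y ^ (A - B) := by
        obtain ⟨f1, f2, f3⟩ := hlog y (hxb.le.trans hxy)
        have h1 : 0 < B - A := by linarith
        have : 0 ≤ Real.log y := by linarith
        positivity
      linarith
  rw [intervalIntegral.integral_sub hint1 hint2] at hint
  have b1 := hb1 x ⟨le_rfl, hxy⟩
  have b2 := hb1 y ⟨hxy, le_rfl⟩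
  have : (harmonicSum q y - mainTerm α A (Real.log (y / β))) -
        (harmonicSum q x - mainTerm α A (Real.log (x / β))) =
      ((count q y : ℝ) / y - I y / y) - ((count q x : ℝ) / x - I x / x) +
      ((∫ t in x..y, (count q t : ℝ) / t ^ 2) - ∫ u in x..y, I u / u ^ 2) := by
    simp only [hI]
    linarith
  rw [this]
  rw [abs_le] at *
  constructor <;> linarith

lemma tendsto_harmonicConst (hq : IsRegularSequence q α β A B) :
    Tendsto (fun y => harmonicSum q y - mainTerm α A (Real.log (y / β))) atTop
      (𝓝 (harmonicConst q α β A)) := by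
  obtain ⟨K, x₀, hK, h⟩ := hq.abs_harmonicSum_sub_sub_le
  have hAB := hq.A_lt_B
  have hlim : ∃ l, Tendsto (fun y => harmonicSum q y - mainTerm α A (Real.log (y / β))) atTop
      (𝓝 l) := by
    apply cauchy_map_iff_exists_tendsto.1
    rw [Metric.cauchy_iff]
    refine ⟨map_neBot, fun ε hε => ?_⟩
    have ht : Tendsto (fun x : ℝ => K * Real.log x ^ (-(B - A))) atTop (𝓝 (K * 0)) :=
      ((tendsto_rpow_neg_atTop (by linarith)).comp Real.tendsto_log_atTop).const_mul K
    rw [mul_zero] at ht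
    obtain ⟨x, hx, hx0⟩ := ((ht.eventually_lt_const (half_pos hε)).and
      (eventually_ge_atTop x₀)).exists
    rw [show -(B - A) = A - B by ring] at hx
    refine ⟨_, image_mem_map (Ici_mem_atTop x), ?_⟩
    rintro _ ⟨y, hy, rfl⟩ _ ⟨z, hz, rfl⟩
    have h1 := h x y hx0 hy
    have h2 := h x z hx0 hz
    rw [Real.dist_eq]
    rw [abs_le] at h1 h2
    rw [abs_lt]
    constructor <;> linarith
  have hl := tendsto_nhds_limUnder hlim
  have : harmonicConst q α β A =
      limUnder atTop fun y => harmonicSum q y - mainTerm α A (Real.log (y / β)) := rfl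
  rwa [this]

theorem harmonicSum_asymp (hq : IsRegularSequence q α β A B) :
    ∃ K σ₀ : ℝ, 0 ≤ K ∧ ∀ σ : ℝ, σ₀ ≤ σ →
      |harmonicSum q (Real.exp σ) - mainTerm α A (σ - Real.log β) - harmonicConst q α β A| ≤
        K * σ ^ (A - B) := by
  obtain ⟨K, x₀, hK, h⟩ := hq.abs_harmonicSum_sub_sub_le
  refine ⟨K, Real.log (max x₀ 1), hK, fun σ hσ => ?_⟩
  have hx : x₀ ≤ Real.exp σ := by
    rw [Real.log_le_iff_le_exp (by positivity)] at hσ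
    exact (le_max_left _ _).trans hσ
  have ht := hq.tendsto_harmonicConst
  have h1 : Tendsto (fun y => |(harmonicSum q y - mainTerm α A (Real.log (y / β))) -
        (harmonicSum q (Real.exp σ) - mainTerm α A (Real.log (Real.exp σ / β)))|) atTop
      (𝓝 |harmonicConst q α β A -
        (harmonicSum q (Real.exp σ) - mainTerm α A (Real.log (Real.exp σ / β)))|) :=
    (ht.sub_const _).abs
  have h2 := le_of_tendsto h1 ((eventually_ge_atTop (Real.exp σ)).mono fun y hy =>
    h (Real.exp σ) y hx hy)
  rw [Real.log_exp, Real.log_div (Real.exp_pos σ).ne' hq.beta_pos.ne', Real.log_exp] at h2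
  rw [abs_sub_comm]
  convert h2 using 2

end IsRegularSequence

/-! ### Local and global behaviour of the harmonic sum at logarithmic scale -/

lemma abs_rpow_add_sub_le (γ : ℝ) :
    ∃ K : ℝ, 0 ≤ K ∧ ∀ σ w : ℝ, 0 < σ → |w| ≤ 3 / 4 * σ →
      |(σ + w) ^ γ - σ ^ γ| ≤ K * (|w| * σ ^ (γ - 1)) := by
  refine ⟨|γ| * ((1 / 4) ^ (γ - 1) + (7 / 4) ^ (γ - 1)), by positivity, fun σ w hσ hw => ?_⟩
  rw [abs_le] at hw
  have hd : ∀ x ∈ Set.Icc (1 / 4 * σ) (7 / 4 * σ),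
      HasDerivWithinAt (fun x : ℝ => x ^ γ) (γ * x ^ (γ - 1)) (Set.Icc (1 / 4 * σ) (7 / 4 * σ)) x := by
    intro x hx
    have : 0 < x := lt_of_lt_of_le (by positivity) hx.1
    exact (Real.hasDerivAt_rpow_const (Or.inl this.ne')).hasDerivWithinAt
  have hb : ∀ x ∈ Set.Icc (1 / 4 * σ) (7 / 4 * σ), ‖γ * x ^ (γ - 1)‖ ≤
      |γ| * (((1 / 4) ^ (γ - 1) + (7 / 4) ^ (γ - 1)) * σ ^ (γ - 1)) := by
    intro x hx
    have hx0 : 0 < x := lt_of_lt_of_le (by positivity) hx.1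
    rw [norm_mul, Real.norm_eq_abs, Real.norm_of_nonneg (by positivity)]
    gcongr
    exact rpow_le_of_comparable (by norm_num) hσ hx.1 hx.2
  have := (convex_Icc _ _).norm_image_sub_le_of_norm_hasDerivWithin_le hd hb
    (show σ ∈ Set.Icc (1 / 4 * σ) (7 / 4 * σ) by constructor <;> linarith)
    (show σ + w ∈ Set.Icc (1 / 4 * σ) (7 / 4 * σ) by constructor <;> linarith)
  rw [Real.norm_eq_abs, Real.norm_eq_abs, add_sub_cancel_left] at this
  refine this.trans (le_of_eq ?_)
  ring

lemma abs_mainTerm_add_sub_le (α A : ℝ) :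
    ∃ K : ℝ, 0 ≤ K ∧ ∀ σ w : ℝ, 0 < σ → |w| ≤ 3 / 4 * σ →
      |mainTerm α A (σ + w) - mainTerm α A σ - α * w * σ ^ (A - 1)| ≤ K * (w ^ 2 * σ ^ (A - 2)) := by
  obtain ⟨K, hK, h⟩ := abs_rpow_add_sub_le (A - 1)
  refine ⟨|α| * K, by positivity, fun σ w hσ hw => ?_⟩
  set S := Set.Icc (-|w|) |w| with hS
  have hmem : ∀ x ∈ S, |x| ≤ |w| := fun x hx => abs_le.2 hx
  have hd : ∀ x ∈ S, HasDerivWithinAt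
      (fun x : ℝ => mainTerm α A (σ + x) - α * x * σ ^ (A - 1))
      (α * ((σ + x) ^ (A - 1) - σ ^ (A - 1))) S x := by
    intro x hx
    have hx' := abs_le.1 ((hmem x hx).trans hw)
    have : 0 < σ + x := by linarith
    have d1 := (hasDerivAt_mainTerm α A this).comp x ((hasDerivAt_id x).const_add σ)
    have d2 := ((hasDerivAt_id x).const_mul α).mul_const (σ ^ (A - 1))
    refine ((d1.sub d2).congr_deriv ?_).hasDerivWithinAt
    ring
  have hb : ∀ x ∈ S, ‖α * ((σ + x) ^ (A - 1) - σ ^ (A - 1))‖ ≤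
      |α| * (K * (|w| * σ ^ (A - 1 - 1))) := by
    intro x hx
    rw [norm_mul, Real.norm_eq_abs, Real.norm_eq_abs]
    gcongr
    refine (h σ x hσ ((hmem x hx).trans hw)).trans ?_
    exact mul_le_mul_of_nonneg_left (mul_le_mul_of_nonneg_right (hmem x hx) (by positivity)) hK
  have := (convex_Icc _ _).norm_image_sub_le_of_norm_hasDerivWithin_le hd hb
    (show (0 : ℝ) ∈ S by constructor <;> simp)
    (show w ∈ S by constructor; exact neg_abs_le w; exact le_abs_self w)
  rw [Real.norm_eq_abs, Real.norm_eq_abs] at this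
  simp only [add_zero, mul_zero, zero_mul, sub_zero] at this
  rw [show A - 2 = A - 1 - 1 by ring, ← sq_abs w]
  calc |mainTerm α A (σ + w) - mainTerm α A σ - α * w * σ ^ (A - 1)|
      = |mainTerm α A (σ + w) - α * w * σ ^ (A - 1) - mainTerm α A σ| := by ring_nf
    _ ≤ _ := this
    _ = _ := by ring

/-- The order of magnitude of the harmonic sum at logarithmic scale. -/
def growth (A t : ℝ) : ℝ := if A = 0 then Real.log t else t ^ A

/-- The size of the error terms: `σ^(A-1)` times the relative error `errTerm B (exp σ)`. -/
def errSize (A B σ : ℝ) : ℝ := σ ^ (A - 2) * Real.log σ + σ ^ (A - B)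

lemma errSize_eq (A B : ℝ) {σ : ℝ} (hσ : 0 < σ) :
    errSize A B σ = σ ^ (A - 1) * errTerm B (Real.exp σ) := by
  rw [errSize, errTerm, Real.log_exp, mul_add, mul_one_div, ← Real.rpow_sub hσ,
    show A - 2 = A - 1 - 1 by ring, Real.rpow_sub_one hσ.ne' (A - 1)]
  congr 1
  · ring
  · congr 1; ring

lemma rpow_add_rpow_le_errSize (A B : ℝ) {σ : ℝ} (hσ : Real.exp 1 ≤ σ) :
    σ ^ (A - 2) + σ ^ (A - B) ≤ errSize A B σ := by
  have h0 : 0 < σ := (Real.exp_pos 1).trans_le hσ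
  have h1 : 1 ≤ Real.log σ := by rwa [Real.le_log_iff_exp_le h0]
  have : 0 < σ ^ (A - 2) := by positivity
  unfold errSize
  nlinarith

lemma tendsto_growth {A : ℝ} (hA : 0 ≤ A) : Tendsto (growth A) atTop atTop := by
  unfold growth
  split_ifs with h
  · exact Real.tendsto_log_atTop
  · exact tendsto_rpow_atTop (lt_of_le_of_ne hA (Ne.symm h))

lemma rpow_le_growth (A : ℝ) {t : ℝ} (ht : Real.exp 1 ≤ t) : t ^ A ≤ growth A t := by
  unfold growth
  split_ifs with h
  · rw [h, Real.rpow_zero, Real.le_log_iff_exp_le ((Real.exp_pos 1).trans_le ht)]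
    exact ht
  · exact le_rfl

lemma growth_le (A : ℝ) {t : ℝ} (ht : Real.exp 1 ≤ t) : growth A t ≤ t ^ A * Real.log t := by
  have h0 : 0 < t := (Real.exp_pos 1).trans_le ht
  have h1 : 1 ≤ Real.log t := by rwa [Real.le_log_iff_exp_le h0]
  unfold growth
  split_ifs with h
  · simp [h]
  · have : 0 < t ^ A := by positivity
    nlinarith

lemma mainTerm_eq_growth (α A t : ℝ) :
    mainTerm α A t = (if A = 0 then α else α / A) * growth A t := by
  unfold mainTerm growth
  split_ifs <;> rfl

namespace IsRegularSequence

variable {q : ℕ → ℝ} {α β A B : ℝ}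

theorem harmonicSum_local (hq : IsRegularSequence q α β A B) :
    ∃ K σ₀ : ℝ, 0 ≤ K ∧ 1 ≤ σ₀ ∧ ∀ σ w : ℝ, σ₀ ≤ σ → |w| ≤ σ / 2 →
      |harmonicSum q (Real.exp (σ + w)) - (mainTerm α A σ +
        α * (w - Real.log β) * σ ^ (A - 1) + harmonicConst q α β A)| ≤
        K * ((1 + w ^ 2) * σ ^ (A - 2) + σ ^ (A - B)) := by
  obtain ⟨K₁, σ₁, hK₁, h₁⟩ := hq.harmonicSum_asymp
  obtain ⟨K₂, hK₂, h₂⟩ := abs_mainTerm_add_sub_le α A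
  set b := Real.log β with hb
  refine ⟨K₂ * (2 + 2 * b ^ 2) + K₁ * ((1 / 2) ^ (A - B) + (3 / 2) ^ (A - B)),
    max 1 (max (2 * σ₁) (4 * |b|)), by positivity, le_max_left _ _, fun σ w hσ hw => ?_⟩
  have hσ1 : 1 ≤ σ := (le_max_left _ _).trans hσ
  have hσ2 : 2 * σ₁ ≤ σ := (le_max_left _ _).trans ((le_max_right _ _).trans hσ)
  have hσ3 : 4 * |b| ≤ σ := (le_max_right _ _).trans ((le_max_right _ _).trans hσ)
  have hw' := abs_le.1 hw
  have e1 := h₁ (σ + w) (by linarith)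
  have hwb : |w - b| ≤ 3 / 4 * σ := by
    have := abs_sub w b
    linarith
  have e2 := h₂ σ (w - b) (by linarith) hwb
  have e3 : (σ + w) ^ (A - B) ≤ ((1 / 2) ^ (A - B) + (3 / 2) ^ (A - B)) * σ ^ (A - B) :=
    rpow_le_of_comparable (by norm_num) (by linarith) (by linarith) (by linarith)
  have e4 : (w - b) ^ 2 ≤ (2 + 2 * b ^ 2) * (1 + w ^ 2) := by
    nlinarith [sq_nonneg (w + b), mul_nonneg (sq_nonneg w) (sq_nonneg b)]
  have p2 : 0 < σ ^ (A - 2) := by positivity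
  have pB : 0 < σ ^ (A - B) := by positivity
  have f1 : K₁ * (σ + w) ^ (A - B) ≤
      K₁ * (((1 / 2) ^ (A - B) + (3 / 2) ^ (A - B)) * σ ^ (A - B)) := by gcongr
  have f2 : K₂ * ((w - b) ^ 2 * σ ^ (A - 2)) ≤
      K₂ * ((2 + 2 * b ^ 2) * (1 + w ^ 2) * σ ^ (A - 2)) := by gcongr
  have f3 : 0 ≤ K₂ * (2 + 2 * b ^ 2) * σ ^ (A - B) := by positivity
  have f4 : 0 ≤ K₁ * ((1 / 2) ^ (A - B) + (3 / 2) ^ (A - B)) * ((1 + w ^ 2) * σ ^ (A - 2)) := by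
    positivity
  rw [show σ + w - b = σ + (w - b) by ring] at e1
  rw [abs_le] at *
  constructor <;> linarith

theorem harmonicSum_local_sub (hq : IsRegularSequence q α β A B) :
    ∃ K σ₀ : ℝ, 0 ≤ K ∧ 1 ≤ σ₀ ∧ ∀ σ w : ℝ, σ₀ ≤ σ → |w| ≤ σ / 2 →
      |harmonicSum q (Real.exp (σ + w)) - harmonicSum q (Real.exp σ) - α * w * σ ^ (A - 1)| ≤
        K * ((1 + w ^ 2) * σ ^ (A - 2) + σ ^ (A - B)) := by
  obtain ⟨K, σ₀, hK, hσ₀, h⟩ := hq.harmonicSum_local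
  refine ⟨2 * K, σ₀, by positivity, hσ₀, fun σ w hσ hw => ?_⟩
  have e1 := h σ w hσ hw
  have e2 := h σ 0 hσ (by rw [abs_zero]; linarith)
  have : 0 < σ := by linarith
  have e3 : K * ((1 + 0 ^ 2) * σ ^ (A - 2) + σ ^ (A - B)) ≤
      K * ((1 + w ^ 2) * σ ^ (A - 2) + σ ^ (A - B)) := by
    nlinarith [sq_nonneg w, mul_nonneg (mul_nonneg hK (sq_nonneg w))
      (show (0 : ℝ) ≤ σ ^ (A - 2) by positivity)]
  rw [add_zero] at e2
  rw [abs_le] at *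
  constructor <;> linarith

theorem tendsto_harmonicSum_div_growth (hq : IsRegularSequence q α β A B) :
    Tendsto (fun σ => harmonicSum q (Real.exp σ) / growth A σ) atTop
      (𝓝 (if A = 0 then α else α / A)) := by
  obtain ⟨K, σ₀, hK, hσ₀, h⟩ := hq.harmonicSum_local
  have hB := hq.one_lt_B
  set a := if A = 0 then α else α / A with ha
  set b := Real.log β with hb
  rw [tendsto_iff_norm_sub_tendsto_zero]
  have t1 : Tendsto (fun σ : ℝ => |α * b| * σ ^ (-1 : ℝ) + |harmonicConst q α β A| * (growth A σ)⁻¹ +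
      K * (σ ^ (-2 : ℝ) + σ ^ (-B))) atTop (𝓝 (|α * b| * 0 + |harmonicConst q α β A| * 0 +
      K * (0 + 0))) :=
    (((tendsto_rpow_neg_atTop one_pos).const_mul _).add
      ((tendsto_growth hq.A_nonneg).inv_tendsto_atTop.const_mul _)).add
      (((tendsto_rpow_neg_atTop two_pos).add (tendsto_rpow_neg_atTop (by linarith))).const_mul _)
  simp only [mul_zero, add_zero] at t1
  refine squeeze_zero' (Filter.Eventually.of_forall fun σ => norm_nonneg _) ?_ t1
  filter_upwards [eventually_ge_atTop σ₀, eventually_ge_atTop (Real.exp 1)] with σ hσ hσe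
  have hσ0 : 0 < σ := by linarith
  have hJ := rpow_le_growth A hσe
  have hσA : 0 < σ ^ A := by positivity
  have hJ0 : 0 < growth A σ := by linarith
  have e := h σ 0 hσ (by rw [abs_zero]; linarith)
  rw [add_zero, zero_sub, mainTerm_eq_growth] at e
  have e' : |harmonicSum q (Real.exp σ) - a * growth A σ| ≤
      |α * b| * σ ^ (A - 1) + |harmonicConst q α β A| + K * (σ ^ (A - 2) + σ ^ (A - B)) := by
    have h1 := abs_le.1 e
    have h2 : |α * b * σ ^ (A - 1)| = |α * b| * σ ^ (A - 1) := by
      rw [abs_mul, abs_of_pos (show 0 < σ ^ (A - 1) by positivity)]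
    have h3 := abs_le.1 h2.le
    have h4 := abs_le.1 (le_refl |harmonicConst q α β A|)
    rw [abs_le]
    constructor <;> linarith
  have hdiv : ∀ k : ℝ, σ ^ (A - k) / growth A σ ≤ σ ^ (-k) := by
    intro k
    rw [div_le_iff₀ hJ0]
    calc σ ^ (A - k) = σ ^ (-k) * σ ^ A := by rw [← Real.rpow_add hσ0]; ring_nf
      _ ≤ _ := by gcongr
  have d1 := hdiv 1
  have d2 := hdiv 2
  have d3 := hdiv B
  rw [Real.norm_eq_abs, show harmonicSum q (Real.exp σ) / growth A σ - a =
    (harmonicSum q (Real.exp σ) - a * growth A σ) / growth A σ by field_simp,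
    abs_div, abs_of_pos hJ0]
  calc |harmonicSum q (Real.exp σ) - a * growth A σ| / growth A σ
      ≤ (|α * b| * σ ^ (A - 1) + |harmonicConst q α β A| +
          K * (σ ^ (A - 2) + σ ^ (A - B))) / growth A σ := by gcongr
    _ = |α * b| * (σ ^ (A - 1) / growth A σ) + |harmonicConst q α β A| * (growth A σ)⁻¹ +
          K * (σ ^ (A - 2) / growth A σ + σ ^ (A - B) / growth A σ) := by
        field_simp
    _ ≤ _ := by gcongr

theorem harmonicSum_growth (hq : IsRegularSequence q α β A B) :
    ∃ c K σ₀ : ℝ, 0 < c ∧ 0 < K ∧ ∀ σ : ℝ, σ₀ ≤ σ →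
      c * growth A σ ≤ harmonicSum q (Real.exp σ) ∧
      harmonicSum q (Real.exp σ) ≤ K * growth A σ := by
  have ht := hq.tendsto_harmonicSum_div_growth
  set a := if A = 0 then α else α / A with ha
  have ha0 : 0 < a := by
    have := hq.alpha_pos
    rw [ha]
    split_ifs with h
    · exact this
    · have := lt_of_le_of_ne hq.A_nonneg (Ne.symm h)
      positivity
  have h1 := ht.eventually_const_lt (show a / 2 < a by linarith)
  have h2 := ht.eventually_lt_const (show a < 2 * a by linarith)
  obtain ⟨σ₀, h⟩ := eventually_atTop.1 ((h1.and h2).and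
    ((tendsto_growth hq.A_nonneg).eventually_gt_atTop 0))
  refine ⟨a / 2, 2 * a, σ₀, by positivity, by positivity, fun σ hσ => ?_⟩
  obtain ⟨⟨g1, g2⟩, g3⟩ := h σ hσ
  rw [lt_div_iff₀ g3] at g1
  rw [div_lt_iff₀ g3] at g2
  exact ⟨g1.le, g2.le⟩

theorem eventually_mul_rpow_le_harmonicSum (hq : IsRegularSequence q α β A B) (D : ℝ) :
    ∀ᶠ σ in atTop, D * σ ^ (A - 1) ≤ harmonicSum q (Real.exp σ) := by
  obtain ⟨c, K, σ₀, hc, hK, h⟩ := hq.harmonicSum_growth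
  filter_upwards [eventually_ge_atTop σ₀, eventually_ge_atTop (Real.exp 1),
    eventually_ge_atTop (D / c)] with σ h1 h2 h3
  have h0 : 0 < σ := (Real.exp_pos 1).trans_le h2
  rw [div_le_iff₀ hc] at h3
  calc D * σ ^ (A - 1) ≤ σ * c * σ ^ (A - 1) := by gcongr
    _ = c * σ ^ A := by rw [Real.rpow_sub_one h0.ne']; field_simp
    _ ≤ c * growth A σ := by gcongr; exact rpow_le_growth A h2
    _ ≤ _ := (h σ h1).1

theorem tendsto_harmonicSum (hq : IsRegularSequence q α β A B) :
    Tendsto (fun σ => harmonicSum q (Real.exp σ)) atTop atTop := by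
  obtain ⟨c, K, σ₀, hc, hK, h⟩ := hq.harmonicSum_growth
  exact tendsto_atTop_mono' _ ((eventually_ge_atTop σ₀).mono fun σ hσ => (h σ hσ).1)
    ((tendsto_growth hq.A_nonneg).const_mul_atTop hc)

theorem harmonicSum_div_sq_le (hq : IsRegularSequence q α β A B) :
    ∃ K σ₀ : ℝ, 0 < K ∧ ∀ σ : ℝ, σ₀ ≤ σ →
      harmonicSum q (Real.exp σ) ≤ K * (σ ^ 2 * errSize A B σ) := by
  obtain ⟨c, K, σ₀, hc, hK, h⟩ := hq.harmonicSum_growth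
  refine ⟨K, max σ₀ (Real.exp 1), hK, fun σ hσ => ?_⟩
  have h2 : Real.exp 1 ≤ σ := (le_max_right _ _).trans hσ
  have h0 : 0 < σ := (Real.exp_pos 1).trans_le h2
  refine ((h σ ((le_max_left _ _).trans hσ)).2).trans ?_
  gcongr
  refine (growth_le A h2).trans ?_
  have : σ ^ A = σ ^ 2 * σ ^ (A - 2) := by
    rw [← Real.rpow_natCast, ← Real.rpow_add h0]
    norm_num
  rw [this, errSize, mul_assoc]
  gcongr
  have : 0 < σ ^ (A - B) := by positivity
  linarith

theorem harmonicSum_add_le (hq : IsRegularSequence q α β A B) :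
    ∃ σ₀ : ℝ, ∀ σ w : ℝ, σ₀ ≤ σ → 0 ≤ w →
      harmonicSum q (Real.exp (σ + w)) ≤ 2 * Real.exp (w / 4) * harmonicSum q (Real.exp σ) := by
  obtain ⟨K, σ₁, hK, hσ₁, h⟩ := hq.harmonicSum_local_sub
  have hB := hq.one_lt_B
  have hα := hq.alpha_pos
  obtain ⟨σ₂, h₂⟩ := eventually_atTop.1
    (hq.eventually_mul_rpow_le_harmonicSum (8 * (α + 3 * K)))
  have step : ∀ σ, max σ₁ (max σ₂ 2) ≤ σ → harmonicSum q (Real.exp (σ + 1)) ≤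
      Real.exp (1 / 8) * harmonicSum q (Real.exp σ) := by
    intro σ hσ
    have s1 : σ₁ ≤ σ := (le_max_left _ _).trans hσ
    have s2 : σ₂ ≤ σ := (le_max_left _ _).trans ((le_max_right _ _).trans hσ)
    have s3 : 2 ≤ σ := (le_max_right _ _).trans ((le_max_right _ _).trans hσ)
    have e1 := (abs_le.1 (h σ 1 s1 (by rw [abs_one]; linarith))).2
    have e2 := h₂ σ s2
    have p1 : σ ^ (A - 2) ≤ σ ^ (A - 1) := Real.rpow_le_rpow_of_exponent_le (by linarith) (by linarith)
    have p2 : σ ^ (A - B) ≤ σ ^ (A - 1) := Real.rpow_le_rpow_of_exponent_le (by linarith) (by linarith)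
    have p3 : K * ((1 + 1 ^ 2) * σ ^ (A - 2) + σ ^ (A - B)) ≤
        K * ((1 + 1 ^ 2) * σ ^ (A - 1) + σ ^ (A - 1)) := by gcongr
    have h8 : 9 / 8 ≤ Real.exp (1 / 8) := by
      have := Real.add_one_le_exp (1 / 8 : ℝ)
      linarith
    have := mul_le_mul_of_nonneg_right h8 (hq.harmonicSum_nonneg (Real.exp σ))
    linarith
  have iter : ∀ n : ℕ, ∀ σ, max σ₁ (max σ₂ 2) ≤ σ → harmonicSum q (Real.exp (σ + n)) ≤
      Real.exp (n / 8) * harmonicSum q (Real.exp σ) := by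
    intro n σ hσ
    induction n with
    | zero => simp
    | succ n ih =>
      have := step (σ + n) (by have : (0 : ℝ) ≤ n := n.cast_nonneg; linarith)
      push_cast
      rw [← add_assoc, add_div, Real.exp_add (_ / 8), mul_comm (Real.exp _), mul_assoc]
      refine this.trans ?_
      gcongr
  refine ⟨max σ₁ (max σ₂ 2), fun σ w hσ hw => ?_⟩
  have hc := Nat.le_ceil w
  have hc2 := (Nat.ceil_lt_add_one hw).le
  refine (hq.harmonicSum_mono (Real.exp_le_exp.2 (show σ + w ≤ σ + ⌈w⌉₊ by linarith))).trans ?_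
  refine (iter ⌈w⌉₊ σ hσ).trans ?_
  have h0 := hq.harmonicSum_nonneg (Real.exp σ)
  gcongr
  have h2 : Real.exp (1 / 8) ≤ 2 := by
    have := Real.exp_one_lt_d9
    have h1 : Real.exp (1 / 8) ≤ Real.exp (1 / 2) := Real.exp_le_exp.2 (by norm_num)
    have h3 : Real.exp (1 / 2) * Real.exp (1 / 2) = Real.exp 1 := by rw [← Real.exp_add]; norm_num
    nlinarith [Real.exp_pos (1 / 2)]
  calc Real.exp (⌈w⌉₊ / 8) ≤ Real.exp (1 / 8 + w / 4) := Real.exp_le_exp.2 (by linarith)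
    _ = Real.exp (1 / 8) * Real.exp (w / 4) := Real.exp_add _ _
    _ ≤ _ := by gcongr

/-- The logarithm of `Z(V)` is large for large `V`, and `V` is close to the value at `Z(V)` of the
smooth approximation of the harmonic sum. -/
theorem zOf_spec (hq : IsRegularSequence q α β A B) (σ₁ : ℝ) :
    ∃ K c : ℝ, 0 ≤ K ∧ ∀ V : ℝ, c ≤ V → ∃ ζ : ℝ, σ₁ ≤ ζ ∧ zOf q V = Real.exp ζ ∧
      (∀ σ, ζ < σ → V ≤ harmonicSum q (Real.exp σ)) ∧
      |V - (mainTerm α A ζ - α * Real.log β * ζ ^ (A - 1) + harmonicConst q α β A)| ≤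
        K * (ζ ^ (A - 2) + ζ ^ (A - B)) := by
  obtain ⟨K, σ₀, hK, hσ₀, h⟩ := hq.harmonicSum_local
  have hα := hq.alpha_pos
  refine ⟨2 * K + α, harmonicSum q (Real.exp (max σ₀ (max σ₁ 2))) + 1, by positivity,
    fun V hV => ?_⟩
  set σ₂ := max σ₀ (max σ₁ 2) with hσ₂
  set S := {z : ℝ | V ≤ harmonicSum q z} with hS
  have hlow : ∀ z ∈ S, Real.exp σ₂ ≤ z := by
    intro z hz
    by_contra hlt
    push Not at hlt
    have := hq.harmonicSum_mono hlt.le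
    have hz' : V ≤ harmonicSum q z := hz
    linarith
  have hne : S.Nonempty := by
    obtain ⟨σ, hσ⟩ := (hq.tendsto_harmonicSum.eventually_ge_atTop V).exists
    exact ⟨_, hσ⟩
  have hbdd : BddBelow S := ⟨_, hlow⟩
  have hZ : Real.exp σ₂ ≤ zOf q V := le_csInf hne hlow
  have hZ0 : 0 < zOf q V := (Real.exp_pos _).trans_le hZ
  have hζ : Real.exp (Real.log (zOf q V)) = zOf q V := Real.exp_log hZ0
  set ζ := Real.log (zOf q V) with hζd
  have hζ2 : σ₂ ≤ ζ := by rwa [hζd, Real.le_log_iff_exp_le hZ0]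
  have hup : ∀ σ, ζ < σ → V ≤ harmonicSum q (Real.exp σ) := by
    intro σ hσ
    have : sInf S < Real.exp σ := by
      change zOf q V < _
      rw [← hζ]
      exact Real.exp_lt_exp.2 hσ
    obtain ⟨z, hz, hz2⟩ := (csInf_lt_iff hbdd hne).1 this
    exact le_trans hz (hq.harmonicSum_mono hz2.le)
  have hdown : ∀ σ, σ < ζ → harmonicSum q (Real.exp σ) < V := by
    intro σ hσ
    have : Real.exp σ < sInf S := by
      change _ < zOf q V
      rw [← hζ]
      exact Real.exp_lt_exp.2 hσ
    have := notMem_of_lt_csInf this hbdd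
    simpa [hS] using this
  have s0 : σ₀ ≤ ζ := (le_max_left _ _).trans hζ2
  have s1 : σ₁ ≤ ζ := (le_max_left _ _).trans ((le_max_right _ _).trans hζ2)
  have s2 : 2 ≤ ζ := (le_max_right _ _).trans ((le_max_right _ _).trans hζ2)
  refine ⟨ζ, s1, hζ.symm, hup, ?_⟩
  have hz0 : 0 < ζ := by linarith
  have hinv : 0 < ζ⁻¹ := by positivity
  have hinv1 : ζ⁻¹ ≤ 1 := inv_le_one_of_one_le₀ (by linarith)
  have e1 := h ζ ζ⁻¹ s0 (by rw [abs_of_pos hinv]; linarith)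
  have e2 := h ζ (-ζ⁻¹) s0 (by rw [abs_neg, abs_of_pos hinv]; linarith)
  have g1 := hup (ζ + ζ⁻¹) (by linarith)
  have g2 := hdown (ζ + -ζ⁻¹) (by linarith)
  have pe : ζ⁻¹ * ζ ^ (A - 1) = ζ ^ (A - 2) := by
    rw [show A - 2 = A - 1 - 1 by ring, Real.rpow_sub_one hz0.ne' (A - 1)]
    field_simp
  have p1 : 0 < ζ ^ (A - 2) := by positivity
  have p2 : 0 < ζ ^ (A - B) := by positivity
  have q1 : K * ((1 + ζ⁻¹ ^ 2) * ζ ^ (A - 2) + ζ ^ (A - B)) ≤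
      K * ((1 + 1 ^ 2) * ζ ^ (A - 2) + ζ ^ (A - B)) := by gcongr
  have q2 : (-ζ⁻¹) ^ 2 = ζ⁻¹ ^ 2 := by ring
  rw [q2] at e2
  have m1 : α * (ζ⁻¹ - Real.log β) * ζ ^ (A - 1) =
      α * ζ ^ (A - 2) - α * Real.log β * ζ ^ (A - 1) := by rw [← pe]; ring
  have m2 : α * (-ζ⁻¹ - Real.log β) * ζ ^ (A - 1) =
      -(α * ζ ^ (A - 2)) - α * Real.log β * ζ ^ (A - 1) := by rw [← pe]; ring
  rw [m1] at e1
  rw [m2] at e2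
  have pk : 0 ≤ K * ζ ^ (A - B) := by positivity
  have pk2 : 0 ≤ α * ζ ^ (A - B) := by positivity
  rw [abs_le] at *
  constructor <;> linarith

end IsRegularSequence

/-! ### Cumulant generating functions of bounded centered random variables -/

/-- A measurable random variable with values in `[-1, 1]` and mean zero. -/
structure IsCentered {Ω : Type*} [MeasurableSpace Ω] (P : Measure Ω) (Y : Ω → ℝ) : Prop where
  meas : Measurable Y
  mem : ∀ᵐ ω ∂P, Y ω ∈ Set.Icc (-1 : ℝ) 1
  mean : ∫ ω, Y ω ∂P = 0

namespace IsCentered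

variable {Ω : Type*} [MeasurableSpace Ω] {P : Measure Ω} [IsProbabilityMeasure P] {Y Z : Ω → ℝ}

lemma integrable_exp (h : IsCentered P Y) (t : ℝ) : Integrable (fun ω => Real.exp (t * Y ω)) P :=
  integrable_exp_mul_of_mem_Icc h.meas.aemeasurable h.mem

lemma integrable (h : IsCentered P Y) : Integrable Y P :=
  Integrable.of_mem_Icc _ _ h.meas.aemeasurable h.mem

lemma one_le_mgf (h : IsCentered P Y) (t : ℝ) : 1 ≤ mgf Y P t := by
  have h1 : ∫ ω, (1 + t * Y ω) ∂P = 1 := by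
    rw [integral_add (integrable_const _) (h.integrable.const_mul t), integral_const_mul, h.mean]
    simp
  rw [← h1]
  apply integral_mono ((integrable_const _).add (h.integrable.const_mul t)) (h.integrable_exp t)
  intro ω
  have := Real.add_one_le_exp (t * Y ω)
  change 1 + t * Y ω ≤ _
  linarith

lemma cgf_nonneg (h : IsCentered P Y) (t : ℝ) : 0 ≤ cgf Y P t :=
  Real.log_nonneg (h.one_le_mgf t)

lemma cgf_le_sq (h : IsCentered P Y) (t : ℝ) : cgf Y P t ≤ t ^ 2 / 2 := by
  have hs := hasSubgaussianMGF_of_mem_Icc_of_integral_eq_zero h.meas.aemeasurable h.mem h.mean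
  have := hs.mgf_le t
  rw [cgf, Real.log_le_iff_le_exp (by linarith [h.one_le_mgf t])]
  refine this.trans (le_of_eq ?_)
  congr 1
  simp only [NNReal.coe_pow, NNReal.coe_div, coe_nnnorm, Real.norm_eq_abs, NNReal.coe_ofNat]
  norm_num

lemma cgf_le_abs (h : IsCentered P Y) (t : ℝ) : cgf Y P t ≤ |t| := by
  rw [cgf, Real.log_le_iff_le_exp (by linarith [h.one_le_mgf t])]
  have : ∫ _, Real.exp |t| ∂P = Real.exp |t| := by simp
  rw [mgf, ← this]
  apply integral_mono_ae (h.integrable_exp t) (integrable_const _)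
  filter_upwards [h.mem] with ω hω
  apply Real.exp_le_exp.2
  calc t * Y ω ≤ |t * Y ω| := le_abs_self _
    _ = |t| * |Y ω| := abs_mul _ _
    _ ≤ |t| * 1 := by gcongr; exact abs_le.2 hω
    _ = |t| := mul_one _

lemma cgf_le_min (h : IsCentered P Y) {t : ℝ} : cgf Y P t ≤ min |t| (t ^ 2) :=
  le_min (h.cgf_le_abs t) ((h.cgf_le_sq t).trans (by nlinarith [sq_nonneg t]))

lemma continuous_cgf (h : IsCentered P Y) : Continuous (cgf Y P) :=
  (continuous_mgf h.integrable_exp).log fun t => by linarith [h.one_le_mgf t]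

lemma cgf_div_mono (h : IsCentered P Y) {u v : ℝ} (hu : 0 < u) (huv : u ≤ v) :
    cgf Y P u / u ≤ cgf Y P v / v := by
  have hv : 0 < v := hu.trans_le huv
  have hp0 : 0 ≤ u / v := by positivity
  have hp1 : u / v ≤ 1 := by rw [div_le_one hv]; exact huv
  have hcomp : ∀ ω, Real.exp (v * Y ω) ^ (u / v) = Real.exp (u * Y ω) := by
    intro ω
    rw [← Real.exp_mul]
    congr 1
    field_simp
  have hJ := (Real.concaveOn_rpow hp0 hp1).le_map_integral (μ := P)
    (f := fun ω => Real.exp (v * Y ω))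
    (fun x _ => (Real.continuousAt_rpow_const x _ (Or.inr hp0)).continuousWithinAt) isClosed_Ici
    (Filter.Eventually.of_forall fun ω => (Real.exp_pos _).le) (h.integrable_exp v)
    (by simpa [Function.comp_def, hcomp] using h.integrable_exp u)
  simp only [hcomp] at hJ
  have h1 : cgf Y P u ≤ u / v * cgf Y P v := by
    rw [cgf, cgf, ← Real.log_rpow (by linarith [h.one_le_mgf v])]
    exact Real.log_le_log (by linarith [h.one_le_mgf u]) hJ
  rw [div_le_div_iff₀ hu hv]
  calc cgf Y P u * v ≤ (u / v * cgf Y P v) * v := by gcongr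
    _ = cgf Y P v * u := by field_simp

lemma cgf_le_add (h : IsCentered P Y) (h' : IsCentered P Z) {δ t : ℝ} (ht : 0 ≤ t)
    (hδ : ∀ᵐ ω ∂P, |Y ω - Z ω| ≤ δ) : cgf Y P t ≤ cgf Z P t + t * δ := by
  have : mgf Y P t ≤ Real.exp (t * δ) * mgf Z P t := by
    rw [mgf, mgf, ← integral_const_mul]
    apply integral_mono_ae (h.integrable_exp t) ((h'.integrable_exp t).const_mul _)
    filter_upwards [hδ] with ω hω
    rw [← Real.exp_add]
    apply Real.exp_le_exp.2
    nlinarith [(abs_le.1 hω).2]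
  have h1 := Real.log_le_log (by linarith [h.one_le_mgf t]) this
  rw [Real.log_mul (Real.exp_pos _).ne' (by linarith [h'.one_le_mgf t]), Real.log_exp] at h1
  rw [cgf, cgf]
  linarith

lemma abs_cgf_sub_le (h : IsCentered P Y) (h' : IsCentered P Z) {δ t : ℝ} (ht : 0 ≤ t)
    (hδ : ∀ᵐ ω ∂P, |Y ω - Z ω| ≤ δ) : |cgf Y P t - cgf Z P t| ≤ t * δ := by
  have h1 := h.cgf_le_add h' ht hδ
  have h2 := h'.cgf_le_add h ht (hδ.mono fun ω hω => by rwa [abs_sub_comm])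
  rw [abs_le]
  constructor <;> linarith

lemma abs_exp_sub_sub_le {x z u : ℝ} (hu1 : u ≤ 1) (hx : |x| ≤ u) (hz : |z| ≤ u) :
    |(Real.exp x - x) - (Real.exp z - z)| ≤ 2 * u * |x - z| := by
  have hd : ∀ y ∈ Set.Icc (-u) u,
      HasDerivWithinAt (fun y => Real.exp y - y) (Real.exp y - 1) (Set.Icc (-u) u) y :=
    fun y _ => ((Real.hasDerivAt_exp y).sub (hasDerivAt_id y)).hasDerivWithinAt
  have hb : ∀ y ∈ Set.Icc (-u) u, ‖Real.exp y - 1‖ ≤ 2 * u := by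
    intro y hy
    have hy' : |y| ≤ u := abs_le.2 hy
    have := Real.abs_exp_sub_one_le (hy'.trans hu1)
    rw [Real.norm_eq_abs]
    linarith
  exact (convex_Icc _ _).norm_image_sub_le_of_norm_hasDerivWithin_le hd hb (abs_le.1 hz) (abs_le.1 hx)

lemma abs_cgf_sub_le_sq (h : IsCentered P Y) (h' : IsCentered P Z) {δ t : ℝ} (ht : 0 ≤ t)
    (ht1 : t ≤ 1) (hδ : ∀ᵐ ω ∂P, |Y ω - Z ω| ≤ δ) :
    |cgf Y P t - cgf Z P t| ≤ 2 * t ^ 2 * δ := by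
  have e1 : mgf Y P t - mgf Z P t =
      ∫ ω, ((Real.exp (t * Y ω) - t * Y ω) - (Real.exp (t * Z ω) - t * Z ω)) ∂P := by
    have := integral_sub ((h.integrable_exp t).sub (h.integrable.const_mul t))
      ((h'.integrable_exp t).sub (h'.integrable.const_mul t))
    simp only [Pi.sub_apply] at this
    rw [this, integral_sub (h.integrable_exp t) (h.integrable.const_mul t),
      integral_sub (h'.integrable_exp t) (h'.integrable.const_mul t),
      integral_const_mul, integral_const_mul, h.mean, h'.mean, mgf, mgf]
    ring
  have e2 : |mgf Y P t - mgf Z P t| ≤ 2 * t ^ 2 * δ := by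
    rw [e1, ← Real.norm_eq_abs]
    have := norm_integral_le_of_norm_le_const (μ := P) (C := 2 * t ^ 2 * δ)
      (f := fun ω => (Real.exp (t * Y ω) - t * Y ω) - (Real.exp (t * Z ω) - t * Z ω)) ?_
    · simpa using this
    · filter_upwards [h.mem, h'.mem, hδ] with ω h1 h2 h3
      have a1 : |t * Y ω| ≤ t := by
        rw [abs_mul, abs_of_nonneg ht]
        nlinarith [abs_le.2 h1]
      have a2 : |t * Z ω| ≤ t := by
        rw [abs_mul, abs_of_nonneg ht]
        nlinarith [abs_le.2 h2]
      refine (abs_exp_sub_sub_le ht1 a1 a2).trans ?_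
      rw [← mul_sub, abs_mul, abs_of_nonneg ht]
      calc 2 * t * (t * |Y ω - Z ω|) ≤ 2 * t * (t * δ) := by gcongr
        _ = 2 * t ^ 2 * δ := by ring
  have key : ∀ a b : ℝ, 1 ≤ a → 1 ≤ b → Real.log a - Real.log b ≤ |a - b| := by
    intro a b ha hb
    rw [← Real.log_div (by linarith) (by linarith)]
    refine (Real.log_le_sub_one_of_pos (by positivity)).trans ?_
    have : a / b - 1 = (a - b) / b := by field_simp
    rw [this, div_le_iff₀ (by linarith)]
    nlinarith [le_abs_self (a - b), abs_nonneg (a - b)]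
  have k1 := key _ _ (h.one_le_mgf t) (h'.one_le_mgf t)
  have k2 := key _ _ (h'.one_le_mgf t) (h.one_le_mgf t)
  rw [abs_sub_comm] at k2
  rw [cgf, cgf, abs_le]
  constructor <;> linarith

lemma abs_cgf_sub_le_min (h : IsCentered P Y) (h' : IsCentered P Z) {δ t : ℝ} (ht : 0 ≤ t)
    (hδ0 : 0 ≤ δ) (hδ : ∀ᵐ ω ∂P, |Y ω - Z ω| ≤ δ) :
    |cgf Y P t - cgf Z P t| ≤ 2 * δ * min t (t ^ 2) := by
  rcases le_total t 1 with h1 | h1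
  · rw [min_eq_right (by nlinarith)]
    exact (h.abs_cgf_sub_le_sq h' ht h1 hδ).trans (le_of_eq (by ring))
  · rw [min_eq_left (by nlinarith)]
    have := h.abs_cgf_sub_le h' ht hδ
    nlinarith [mul_nonneg hδ0 ht]

lemma log_sq_le {u : ℝ} (hu : 1 ≤ u) : Real.log u ^ 2 ≤ 16 * Real.sqrt u := by
  have h0 : 0 ≤ Real.log u := Real.log_nonneg hu
  have h1 := Real.log_le_rpow_div (show 0 ≤ u by linarith) (show (0 : ℝ) < 1 / 4 by norm_num)
  have h2 : Real.log u ≤ 4 * u ^ (1 / 4 : ℝ) := by linarith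
  have h3 : (u ^ (1 / 4 : ℝ)) ^ 2 = Real.sqrt u := by
    rw [Real.sqrt_eq_rpow, ← Real.rpow_natCast, ← Real.rpow_mul (by linarith)]
    norm_num
  calc Real.log u ^ 2 ≤ (4 * u ^ (1 / 4 : ℝ)) ^ 2 := by gcongr
    _ = _ := by rw [mul_pow, h3]; norm_num

lemma sub_cgf_le (h : IsCentered P Y) {κ c : ℝ} (hκ : 0 < κ) (hc : 0 < c)
    (hlow : ∀ t : ℝ, 1 ≤ t →
      κ * Real.exp (-(c * Real.exp (Real.sqrt t))) ≤ P.real {ω | 1 - 1 / t < Y ω})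
    {u : ℝ} (hu : Real.exp 2 ≤ u) :
    u - cgf Y P u ≤ (4 + 16 * c + 16 * |Real.log κ|) * (u / Real.log u ^ 2) := by
  have hu0 : 0 < u := (Real.exp_pos 2).trans_le hu
  have hl : 2 ≤ Real.log u := by rwa [Real.le_log_iff_exp_le hu0]
  have hu1 : 1 ≤ u := by
    have := Real.add_one_le_exp (2 : ℝ)
    linarith
  set t := (Real.log u / 2) ^ 2 with ht
  have ht1 : 1 ≤ t := by nlinarith
  have hst : Real.exp (Real.sqrt t) = Real.sqrt u := by
    rw [ht, Real.sqrt_sq (by linarith), Real.exp_half, Real.exp_log hu0]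
  have h1 := hlow t ht1
  rw [hst] at h1
  have hm : MeasurableSet {ω | 1 - 1 / t < Y ω} := measurableSet_lt measurable_const h.meas
  have h2 : P.real {ω | 1 - 1 / t < Y ω} * Real.exp (u * (1 - 1 / t)) ≤ mgf Y P u := by
    have : P.real {ω | 1 - 1 / t < Y ω} * Real.exp (u * (1 - 1 / t)) =
        ∫ ω, Set.indicator {ω | 1 - 1 / t < Y ω} (fun _ => Real.exp (u * (1 - 1 / t))) ω ∂P := by
      rw [integral_indicator_const _ hm, smul_eq_mul]
    rw [this, mgf]
    apply integral_mono ((integrable_const _).indicator hm) (h.integrable_exp u)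
    intro ω
    simp only [Set.indicator_apply, Set.mem_ofPred_eq]
    split_ifs with hω
    · apply Real.exp_le_exp.2
      gcongr
    · positivity
  have h3 : κ * Real.exp (-(c * Real.sqrt u)) * Real.exp (u * (1 - 1 / t)) ≤ mgf Y P u :=
    (mul_le_mul_of_nonneg_right h1 (Real.exp_pos _).le).trans h2
  have h4 := Real.log_le_log (by positivity) h3
  rw [Real.log_mul (by positivity) (by positivity), Real.log_mul (by positivity) (by positivity),
    Real.log_exp, Real.log_exp] at h4
  have hL : 0 < Real.log u ^ 2 := by positivity
  have h5 : Real.sqrt u ≤ 16 * (u / Real.log u ^ 2) := by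
    rw [← mul_div_assoc, le_div_iff₀ hL]
    calc Real.sqrt u * Real.log u ^ 2 ≤ Real.sqrt u * (16 * Real.sqrt u) := by
          gcongr
          exact log_sq_le hu1
      _ = 16 * (Real.sqrt u * Real.sqrt u) := by ring
      _ = 16 * u := by rw [Real.mul_self_sqrt hu0.le]
  have h6 : 1 ≤ Real.sqrt u := by rw [Real.one_le_sqrt]; exact hu1
  have h7 : u * (1 - 1 / t) = u - 4 * (u / Real.log u ^ 2) := by
    rw [ht]; field_simp; ring
  rw [h7] at h4
  have h8 : c * Real.sqrt u ≤ c * (16 * (u / Real.log u ^ 2)) := by gcongr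
  have h9 : -Real.log κ ≤ |Real.log κ| * (16 * (u / Real.log u ^ 2)) := by
    have h10 : |Real.log κ| * 1 ≤ |Real.log κ| * (16 * (u / Real.log u ^ 2)) := by
      gcongr
      exact h6.trans h5
    linarith [neg_abs_le (Real.log κ)]
  rw [cgf]
  linarith

end IsCentered

/-- The constant in `u - cgf u ≤ C u / (log u) ^ 2`. -/
def tailConst (κ c : ℝ) : ℝ := 4 + 16 * c + 16 * |Real.log κ|

namespace CRVH

variable {Ω : Type*} [MeasurableSpace Ω] {P : Measure Ω} [IsProbabilityMeasure P]
  {κ c C : ℝ} {Y : ℕ → Ω → ℝ} {ν : Measure ℝ}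

omit [IsProbabilityMeasure P] in
lemma isCentered (h : CRVH P κ c C Y ν) (n : ℕ) : IsCentered P (Y n) :=
  ⟨h.measurable n, h.support n, h.mean_zero n⟩

lemma tendsto_bound (C : ℝ) :
    Tendsto (fun n : ℕ => C / Real.log ((n : ℝ) + 1) ^ 2) atTop (𝓝 0) := by
  apply Tendsto.div_atTop tendsto_const_nhds
  apply (tendsto_pow_atTop two_ne_zero).comp
  exact Real.tendsto_log_atTop.comp
    (tendsto_atTop_add_const_right _ _ tendsto_natCast_atTop_atTop)

lemma isProbabilityMeasure_law (h : CRVH P κ c C Y ν) : IsProbabilityMeasure ν := by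
  obtain ⟨Z, hZ, -, hlaw, -⟩ := h.limit
  rw [← hlaw 0]
  exact Measure.isProbabilityMeasure_map (hZ 0).aemeasurable

lemma law_isCentered (h : CRVH P κ c C Y ν) : IsCentered ν (id : ℝ → ℝ) := by
  obtain ⟨Z, hZ, -, hlaw, hYZ⟩ := h.limit
  have hbound : ∀ n : ℕ, 1 ≤ n → ∀ᵐ y ∂ν, |y| ≤ 1 + C / Real.log ((n : ℝ) + 1) ^ 2 := by
    intro n hn
    rw [← hlaw n, ae_map_iff (hZ n).aemeasurable
      (measurableSet_le (by fun_prop) measurable_const)]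
    filter_upwards [h.support n, hYZ n hn] with ω h1 h2
    have h3 := abs_le.2 h1
    have := abs_sub_abs_le_abs_sub (Z n ω) (Y n ω)
    rw [abs_sub_comm] at this
    linarith
  have hmem : ∀ᵐ y ∂ν, (id y : ℝ) ∈ Set.Icc (-1 : ℝ) 1 := by
    have hall : ∀ᵐ y ∂ν, ∀ n : ℕ, 1 ≤ n → |y| ≤ 1 + C / Real.log ((n : ℝ) + 1) ^ 2 := by
      rw [ae_all_iff]
      intro n
      by_cases hn : 1 ≤ n
      · filter_upwards [hbound n hn] with y hy _ using hy
      · exact Filter.Eventually.of_forall fun y h => absurd h hn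
    filter_upwards [hall] with y hy
    have ht := (tendsto_bound C).const_add 1
    rw [add_zero] at ht
    exact abs_le.1 (ge_of_tendsto ht ((eventually_ge_atTop 1).mono fun n hn => hy n hn))
  refine ⟨measurable_id, hmem, ?_⟩
  have hprob := h.isProbabilityMeasure_law
  have hint : Integrable (id : ℝ → ℝ) ν := Integrable.of_mem_Icc _ _ aemeasurable_id hmem
  have hb : ∀ n : ℕ, 1 ≤ n → |∫ y, id y ∂ν| ≤ C / Real.log ((n : ℝ) + 1) ^ 2 := by
    intro n hn
    have hintZ : Integrable (Z n) P := by
      have : Integrable (id ∘ Z n) P := by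
        rw [← integrable_map_measure (by fun_prop) (hZ n).aemeasurable, hlaw n]
        exact hint
      exact this
    have e1 : ∫ y, id y ∂ν = ∫ ω, (Z n ω - Y n ω) ∂P := by
      rw [integral_sub hintZ (h.isCentered n).integrable, h.mean_zero n, sub_zero, ← hlaw n,
        integral_map (hZ n).aemeasurable (by fun_prop)]
      rfl
    rw [e1, ← Real.norm_eq_abs]
    have := norm_integral_le_of_norm_le_const (μ := P) (f := fun ω => Z n ω - Y n ω)
      ((hYZ n hn).mono fun ω hω => by rw [Real.norm_eq_abs, abs_sub_comm]; exact hω)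
    simpa using this
  have := ge_of_tendsto (tendsto_bound C) ((eventually_ge_atTop 1).mono fun n hn => hb n hn)
  exact abs_eq_zero.1 (le_antisymm this (abs_nonneg _))

lemma exists_approx (h : CRVH P κ c C Y ν) (n : ℕ) (hn : 1 ≤ n) :
    ∃ Z : Ω → ℝ, IsCentered P Z ∧ cgf Z P = cgf id ν ∧
      ∀ᵐ ω ∂P, |Y n ω - Z ω| ≤ C / Real.log ((n : ℝ) + 1) ^ 2 := by
  obtain ⟨Z, hZ, -, hlaw, hYZ⟩ := h.limit
  have hc := h.law_isCentered
  refine ⟨Z n, ⟨hZ n, ?_, ?_⟩, ?_, hYZ n hn⟩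
  · have := hc.mem
    rw [← hlaw n, ae_map_iff (hZ n).aemeasurable (measurableSet_Icc.preimage measurable_id)] at this
    exact this
  · have := hc.mean
    rw [← hlaw n, integral_map (hZ n).aemeasurable (by fun_prop)] at this
    exact this
  · ext t
    rw [cgf, cgf, ← hlaw n, mgf_id_map (hZ n).aemeasurable]

lemma abs_cgf_sub_le_min (h : CRVH P κ c C Y ν) {n : ℕ} (hn : 1 ≤ n) {t : ℝ} (ht : 0 ≤ t) :
    |cgf (Y n) P t - cgf id ν t| ≤ 2 * (|C| / Real.log ((n : ℝ) + 1) ^ 2) * min t (t ^ 2) := by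
  obtain ⟨Z, hZ, he, hYZ⟩ := h.exists_approx n hn
  rw [← he]
  apply (h.isCentered n).abs_cgf_sub_le_min hZ ht (by positivity)
  filter_upwards [hYZ] with ω hω
  refine hω.trans ?_
  gcongr
  exact le_abs_self C

lemma sub_cgf_le (h : CRVH P κ c C Y ν) (hκ : 0 < κ) (hc : 0 < c) (n : ℕ) {u : ℝ}
    (hu : Real.exp 2 ≤ u) : u - cgf (Y n) P u ≤ tailConst κ c * (u / Real.log u ^ 2) :=
  (h.isCentered n).sub_cgf_le hκ hc (h.lower_bound n) hu

lemma sub_cgf_law_le (h : CRVH P κ c C Y ν) (hκ : 0 < κ) (hc : 0 < c) {u : ℝ}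
    (hu : Real.exp 2 ≤ u) : u - cgf id ν u ≤ tailConst κ c * (u / Real.log u ^ 2) := by
  have hu0 : 0 ≤ u := (Real.exp_pos 2).le.trans hu
  have ht : Tendsto (fun n : ℕ => tailConst κ c * (u / Real.log u ^ 2) +
      2 * (|C| / Real.log ((n : ℝ) + 1) ^ 2) * min u (u ^ 2)) atTop
      (𝓝 (tailConst κ c * (u / Real.log u ^ 2) + 2 * 0 * min u (u ^ 2))) :=
    (((tendsto_bound |C|).const_mul 2).mul_const _).const_add _
  rw [mul_zero, zero_mul, add_zero] at ht
  refine ge_of_tendsto ht ((eventually_ge_atTop 1).mono fun n hn => ?_)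
  have h1 := (abs_le.1 (h.abs_cgf_sub_le_min hn hu0)).2
  have h2 := h.sub_cgf_le hκ hc n hu
  linarith

end CRVH

/-- A continuous distribution function on the logarithmic scale, with tails `e^w` at `-∞` and
`C / w ^ 2` at `∞`. -/
structure IsProfile (C : ℝ) (ψ : ℝ → ℝ) : Prop where
  mono : Monotone ψ
  cont : Continuous ψ
  nonneg : ∀ w, 0 ≤ ψ w
  le_exp : ∀ w, ψ w ≤ Real.exp w
  le_one : ∀ w, ψ w ≤ 1
  tail : ∀ w, 2 ≤ w → 1 - ψ w ≤ C / w ^ 2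

lemma CRVH.isProfile {Ω : Type*} [MeasurableSpace Ω] {P : Measure Ω} [IsProbabilityMeasure P]
    {κ c C : ℝ} {Y : ℕ → Ω → ℝ} {ν : Measure ℝ} (h : CRVH P κ c C Y ν) (hκ : 0 < κ) (hc : 0 < c) :
    IsProfile (tailConst κ c) (fun w => cgf id ν (Real.exp w) / Real.exp w) := by
  have hprob := h.isProbabilityMeasure_law
  have hν := h.law_isCentered
  refine ⟨fun w w' hw => ?_, ?_, fun w => ?_, fun w => ?_, fun w => ?_, fun w hw => ?_⟩
  · exact hν.cgf_div_mono (Real.exp_pos w) (Real.exp_le_exp.2 hw)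
  · exact (hν.continuous_cgf.comp Real.continuous_exp).div Real.continuous_exp
      fun w => (Real.exp_pos w).ne'
  · have := hν.cgf_nonneg (Real.exp w)
    positivity
  · rw [div_le_iff₀ (Real.exp_pos w), ← pow_two]
    exact hν.cgf_le_min.trans (min_le_right _ _)
  · rw [div_le_one (Real.exp_pos w)]
    have := hν.cgf_le_abs (Real.exp w)
    rwa [abs_of_pos (Real.exp_pos w)] at this
  · have h1 := h.sub_cgf_law_le hκ hc (Real.exp_le_exp.2 hw)
    rw [Real.log_exp] at h1
    have : 1 - cgf id ν (Real.exp w) / Real.exp w =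
        (Real.exp w - cgf id ν (Real.exp w)) / Real.exp w := by
      rw [sub_div, div_self (Real.exp_pos w).ne']
    rw [this, div_le_iff₀ (Real.exp_pos w)]
    refine h1.trans (le_of_eq ?_)
    ring

lemma isProfile_min : IsProfile 1 (fun w => min (Real.exp w) 1) := by
  refine ⟨fun w w' hw => ?_, by fun_prop, fun w => ?_, fun w => min_le_left _ _,
    fun w => min_le_right _ _, fun w hw => ?_⟩
  · exact min_le_min (Real.exp_le_exp.2 hw) le_rfl
  · exact le_min (Real.exp_pos w).le zero_le_one
  · have : (1 : ℝ) ≤ Real.exp w := Real.one_le_exp (by linarith)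
    rw [min_eq_right this, sub_self]
    positivity

/-! ### Integrals against a measure with prescribed tails -/

lemma setIntegral_le_of_tail {Ω : Type*} [MeasurableSpace Ω] {μ : Measure Ω} [IsFiniteMeasure μ]
    {X : Ω → ℝ} (hX : Measurable X) {a : ℝ} (ha : 0 ≤ a) {K K' S : ℝ → ℝ}
    (hK : ∀ t, a ≤ t → HasDerivAt K (K' t) t) (hc : ContinuousOn K' (Set.Ici a))
    (h0 : ∀ t, a ≤ t → 0 ≤ K' t) (hKa : 0 ≤ K a)
    (hS : ∀ t, a ≤ t → μ.real {ω | t < X ω} ≤ S t)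
    (hint : IntegrableOn (fun t => K' t * S t) (Set.Ioi a)) :
    IntegrableOn (fun ω => K (X ω)) {ω | a < X ω} μ ∧
      ∫ ω in {ω | a < X ω}, K (X ω) ∂μ ≤ K a * S a + ∫ t in Set.Ioi a, K' t * S t := by
  set E := {ω | a < X ω} with hE
  have hEm : MeasurableSet E := measurableSet_lt measurable_const hX
  have hFTC : ∀ x, a ≤ x → ∫ t in a..x, K' t = K x - K a := by
    intro x hx
    apply intervalIntegral.integral_eq_sub_of_hasDerivAt
    · intro t ht
      rw [Set.uIcc_of_le hx] at ht
      exact hK t ht.1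
    · apply ContinuousOn.intervalIntegrable
      rw [Set.uIcc_of_le hx]
      exact hc.mono fun t ht => ht.1
  have hKmono : ∀ x, a ≤ x → K a ≤ K x := by
    intro x hx
    have h1 := hFTC x hx
    have h2 : 0 ≤ ∫ t in a..x, K' t := intervalIntegral.integral_nonneg hx fun t ht => h0 t ht.1
    linarith
  set g : ℝ → ℝ := Set.indicator (Set.Ioi a) K' with hg
  have hgloc : ∀ x, a ≤ x → IntegrableOn K' (Set.Ioc a x) := by
    intro x hx
    have : IntegrableOn K' (Set.Icc a x) := (hc.mono fun t ht => ht.1).integrableOn_Icc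
    exact this.mono_set Set.Ioc_subset_Icc_self
  have hgint : ∀ t > 0, IntervalIntegrable g volume 0 t := by
    intro t ht
    rw [intervalIntegrable_iff_integrableOn_Ioc_of_le ht.le, hg, IntegrableOn,
      integrable_indicator_iff measurableSet_Ioi, IntegrableOn,
      Measure.restrict_restrict measurableSet_Ioi]
    apply (hgloc (max a t) (le_max_left _ _)).mono_set
    intro s hs
    exact ⟨hs.1, hs.2.2.trans (le_max_right _ _)⟩
  have hgI : ∀ x, a < x → ∫ t in (0 : ℝ)..x, g t = K x - K a := by
    intro x hx
    rw [← hFTC x hx.le, intervalIntegral.integral_of_le (ha.trans hx.le),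
      intervalIntegral.integral_of_le hx.le, hg, integral_indicator measurableSet_Ioi,
      Measure.restrict_restrict measurableSet_Ioi]
    congr 2
    ext s
    simp only [Set.mem_inter_iff, Set.mem_Ioi, Set.mem_Ioc]
    exact ⟨fun h => ⟨h.1, h.2.2⟩, fun h => ⟨h.1, ha.trans_lt h.1, h.2⟩⟩
  have hg0 : ∀ t, 0 ≤ g t := fun t => Set.indicator_nonneg (fun s hs => h0 s (le_of_lt hs)) t
  have hpos : ∀ᵐ ω ∂(μ.restrict E), 0 ≤ X ω :=
    (ae_restrict_iff' hEm).2 (Filter.Eventually.of_forall fun ω hω => ha.trans (le_of_lt hω))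
  have hcake := lintegral_comp_eq_lintegral_meas_lt_mul (μ.restrict E) (f := X) (g := g)
    hpos hX.aemeasurable hgint (Filter.Eventually.of_forall fun t => hg0 t)
  have hSnn : ∀ t, a ≤ t → 0 ≤ S t := fun t ht => measureReal_nonneg.trans (hS t ht)
  have hR : ∫⁻ t in Set.Ioi 0, (μ.restrict E) {ω | t < X ω} * ENNReal.ofReal (g t) ≤
      ENNReal.ofReal (∫ t in Set.Ioi a, K' t * S t) := by
    rw [ofReal_integral_eq_lintegral_ofReal hint ((ae_restrict_iff' measurableSet_Ioi).2
      (Filter.Eventually.of_forall fun t ht => mul_nonneg (h0 t (le_of_lt ht))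
        (hSnn t (le_of_lt ht)))),
      ← lintegral_indicator (f := fun t => ENNReal.ofReal (K' t * S t)) measurableSet_Ioi]
    refine (setLIntegral_le_lintegral _ _).trans (lintegral_mono fun t => ?_)
    by_cases ht : a < t
    · have h1 : (μ.restrict E) {ω | t < X ω} ≤ ENNReal.ofReal (S t) := by
        refine (Measure.restrict_apply_le _ _).trans ?_
        rw [← ofReal_measureReal]
        exact ENNReal.ofReal_le_ofReal (hS t ht.le)
      rw [Set.indicator_of_mem (Set.mem_Ioi.2 ht), mul_comm (K' t), ENNReal.ofReal_mul (hSnn t ht.le),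
        hg, Set.indicator_of_mem (Set.mem_Ioi.2 ht)]
      gcongr
    · rw [hg, Set.indicator_of_notMem (by simpa using ht)]
      simp
  have hmeas : AEStronglyMeasurable (fun ω => K (X ω)) (μ.restrict E) := by
    have hcont : Continuous fun x => K (max x a) := by
      rw [continuous_iff_continuousAt]
      intro x
      exact ((hK (max x a) (le_max_right _ _)).continuousAt).comp (f := fun x => max x a)
        (by fun_prop)
    have := (hcont.measurable.comp hX).aestronglyMeasurable (μ := μ.restrict E)
    refine this.congr ((ae_restrict_iff' hEm).2 (Filter.Eventually.of_forall fun ω hω => ?_))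
    have : a < X ω := hω
    simp [max_eq_left this.le]
  have hnn : 0 ≤ᵐ[μ.restrict E] fun ω => K (X ω) :=
    (ae_restrict_iff' hEm).2 (Filter.Eventually.of_forall fun ω hω =>
      hKa.trans (hKmono _ (le_of_lt hω)))
  have hI0 : 0 ≤ ∫ t in Set.Ioi a, K' t * S t :=
    setIntegral_nonneg measurableSet_Ioi fun t ht =>
      mul_nonneg (h0 t (le_of_lt ht)) (hSnn t (le_of_lt ht))
  have hL : ∫⁻ ω in E, ENNReal.ofReal (K (X ω)) ∂μ ≤
      ENNReal.ofReal (K a * S a + ∫ t in Set.Ioi a, K' t * S t) := by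
    have e1 : ∫⁻ ω in E, ENNReal.ofReal (K (X ω)) ∂μ =
        ∫⁻ ω in E, (ENNReal.ofReal (∫ t in (0 : ℝ)..X ω, g t) + ENNReal.ofReal (K a)) ∂μ := by
      apply setLIntegral_congr_fun hEm
      intro ω hω
      have hω' : a < X ω := hω
      simp only
      rw [hgI _ hω', ← ENNReal.ofReal_add (by linarith [hKmono _ hω'.le]) hKa]
      congr 1
      ring
    rw [e1, lintegral_add_right _ measurable_const, hcake, lintegral_const,
      Measure.restrict_apply MeasurableSet.univ, Set.univ_inter, add_comm,
      ENNReal.ofReal_add (mul_nonneg hKa (hSnn a le_rfl)) hI0, ENNReal.ofReal_mul hKa]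
    gcongr
    rw [← ofReal_measureReal]
    exact ENNReal.ofReal_le_ofReal (hS a le_rfl)
  refine ⟨⟨hmeas, ?_⟩, ?_⟩
  · rw [hasFiniteIntegral_iff_ofReal hnn]
    exact hL.trans_lt ENNReal.ofReal_lt_top
  · rw [integral_eq_lintegral_of_nonneg_ae hnn hmeas]
    exact ENNReal.toReal_le_of_le_ofReal (add_nonneg (mul_nonneg hKa (hSnn a le_rfl)) hI0) hL

lemma integrableOn_const_div_sq (C : ℝ) {a : ℝ} (ha : 0 < a) :
    IntegrableOn (fun t : ℝ => C / t ^ 2) (Set.Ioi a) ∧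
      ∫ t in Set.Ioi a, C / t ^ 2 = C / a := by
  have e : ∀ t ∈ Set.Ioi a, C / t ^ 2 = C * t ^ (-2 : ℝ) := by
    intro t ht
    have : 0 < t := ha.trans ht
    rw [Real.rpow_neg this.le, div_eq_mul_inv]
    norm_num
  constructor
  · have h1 : IntegrableOn (fun t : ℝ => C * t ^ (-2 : ℝ)) (Set.Ioi a) :=
      (integrableOn_Ioi_rpow_of_lt (by norm_num) ha).const_mul C
    exact h1.congr_fun (fun t ht => (e t ht).symm) measurableSet_Ioi
  · rw [setIntegral_congr_fun measurableSet_Ioi e, integral_const_mul,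
      integral_Ioi_rpow_of_lt (by norm_num) ha]
    norm_num
    rw [Real.rpow_neg_one]
    rfl

/-- A probability measure on the line whose lower tail is at most exponential, and whose upper tail
is at most `C / t ^ 2`. -/
structure HasTails (C : ℝ) (μ : Measure ℝ) : Prop where
  prob : IsProbabilityMeasure μ
  C_nonneg : 0 ≤ C
  upper : ∀ t, 2 ≤ t → μ.real (Set.Ioi t) ≤ C / t ^ 2
  lower : ∀ t, 0 ≤ t → μ.real (Set.Iio (-t)) ≤ Real.exp (-t)

namespace HasTails

variable {C : ℝ} {μ : Measure ℝ}

lemma setIntegral_id (h : HasTails C μ) {T : ℝ} (hT : 2 ≤ T) :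
    IntegrableOn (fun w : ℝ => w) (Set.Ioi T) μ ∧ ∫ w in Set.Ioi T, w ∂μ ≤ 2 * C / T := by
  have := h.prob
  have hT0 : 0 < T := by linarith
  obtain ⟨i1, i2⟩ := integrableOn_const_div_sq C hT0
  have := setIntegral_le_of_tail (μ := μ) (X := id) measurable_id hT0.le (K := fun t => t)
    (K' := fun _ => 1) (S := fun t => C / t ^ 2) (fun t _ => hasDerivAt_id t) continuousOn_const
    (fun _ _ => zero_le_one) hT0.le (fun t ht => h.upper t (hT.trans ht)) (by simpa using i1)
  refine ⟨this.1, this.2.trans (le_of_eq ?_)⟩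
  simp only [one_mul]
  rw [i2]
  field_simp
  ring

lemma setIntegral_sq (h : HasTails C μ) {T : ℝ} (hT : 2 ≤ T) :
    ∫ w in Set.Ioc 2 T, w ^ 2 ∂μ ≤ C + 2 * C * Real.log T := by
  have := h.prob
  have hC := h.C_nonneg
  set S : ℝ → ℝ := Set.indicator (Set.Iio T) (fun t => C / t ^ 2) with hS
  have hprod : ∀ t ∈ Set.Ioi (2 : ℝ), (Set.Ioo 2 T).indicator (fun t => 2 * C / t) t =
      (fun t => 2 * t * S t) t := by
    intro t ht
    have ht0 : (0 : ℝ) < t := two_pos.trans ht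
    simp only [hS, Set.indicator_apply, Set.mem_Ioo, Set.mem_Iio, show (2 : ℝ) < t from ht, true_and]
    split_ifs
    · field_simp
    · simp
  have hcont : ContinuousOn (fun t : ℝ => 2 * C / t) (Set.Icc 2 T) := by
    apply continuousOn_const.div continuousOn_id
    intro t ht
    have : (0 : ℝ) < t := two_pos.trans_le ht.1
    exact this.ne'
  have hsub : Set.Ioi (2 : ℝ) ∩ Set.Ioo 2 T = Set.Ioo 2 T :=
    Set.inter_eq_right.2 fun t ht => ht.1
  have hint : IntegrableOn (fun t => 2 * t * S t) (Set.Ioi 2) := by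
    apply IntegrableOn.congr_fun _ hprod measurableSet_Ioi
    apply IntegrableOn.integrable_indicator _ measurableSet_Ioo |>.integrableOn
    exact hcont.integrableOn_Icc.mono_set Set.Ioo_subset_Icc_self
  have hval : ∫ t in Set.Ioi 2, 2 * t * S t ≤ 2 * C * Real.log T := by
    rw [← setIntegral_congr_fun measurableSet_Ioi hprod, setIntegral_indicator measurableSet_Ioo, hsub,
      ← integral_Ioc_eq_integral_Ioo, ← intervalIntegral.integral_of_le hT]
    simp only [div_eq_mul_inv]
    rw [intervalIntegral.integral_const_mul, integral_inv_of_pos two_pos (by linarith)]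
    gcongr
    linarith
  have := setIntegral_le_of_tail (μ := μ.restrict (Set.Iic T)) (X := id) measurable_id two_pos.le
    (K := fun t => t ^ 2) (K' := fun t => 2 * t) (S := S)
    (fun t _ => by simpa using hasDerivAt_pow 2 t) (by fun_prop)
    (fun t ht => by linarith) (by norm_num) (fun t ht => ?_) hint
  · have h2 := this.2
    change ∫ w in Set.Ioi 2, w ^ 2 ∂(μ.restrict (Set.Iic T)) ≤ _ at h2
    rw [Measure.restrict_restrict measurableSet_Ioi, Set.Ioi_inter_Iic] at h2
    refine h2.trans ?_
    have hS2 : (2 : ℝ) ^ 2 * S 2 ≤ C := by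
      simp only [hS, Set.indicator_apply]
      split_ifs
      · linarith
      · simpa using hC
    linarith
  · change (μ.restrict (Set.Iic T)).real (Set.Ioi t) ≤ _
    rw [measureReal_restrict_apply measurableSet_Ioi]
    simp only [hS, Set.indicator_apply, Set.mem_Iio]
    split_ifs with htT
    · exact (measureReal_mono Set.inter_subset_left).trans (h.upper t ht)
    · have : (Set.Ioi t ∩ Set.Iic T : Set ℝ) = ∅ := by
        rw [Set.Ioi_inter_Iic]
        exact Set.Ioc_eq_empty (by simpa using htT)
      rw [this]
      simp

lemma neg_tail (h : HasTails C μ) {t : ℝ} (ht : 0 ≤ t) :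
    μ.real {w : ℝ | t < -w} ≤ Real.exp (-t) := by
  have : {w : ℝ | t < -w} = Set.Iio (-t) := by
    ext w
    exact lt_neg (a := _) (b := w)
  rw [this]
  exact h.lower t ht

lemma setIntegral_one_sub (h : HasTails C μ) {v : ℝ} (hv : 0 ≤ v) :
    IntegrableOn (fun w : ℝ => 1 - w) (Set.Iio (-v)) μ ∧
      ∫ w in Set.Iio (-v), (1 - w) ∂μ ≤ (2 + v) * Real.exp (-v) := by
  have := h.prob
  have hi : IntegrableOn (fun t : ℝ => 1 * Real.exp (-t)) (Set.Ioi v) := by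
    simpa using integrableOn_exp_mul_Ioi (show (-1 : ℝ) < 0 by norm_num) v
  have := setIntegral_le_of_tail (μ := μ) (X := fun w => -w) measurable_neg hv
    (K := fun t => 1 + t) (K' := fun _ => 1) (S := fun t => Real.exp (-t))
    (fun t _ => (hasDerivAt_id t).const_add 1) continuousOn_const
    (fun _ _ => zero_le_one) (by linarith) (fun t ht => h.neg_tail (hv.trans ht)) hi
  have hset : {w : ℝ | v < -w} = Set.Iio (-v) := by
    ext w
    exact lt_neg (a := _) (b := w)
  rw [hset] at this
  simp only [← sub_eq_add_neg] at this
  refine ⟨this.1, this.2.trans (le_of_eq ?_)⟩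
  simp only [one_mul]
  rw [integral_exp_neg_Ioi]
  ring

lemma setIntegral_exp (h : HasTails C μ) {v : ℝ} (hv : 0 ≤ v) :
    IntegrableOn (fun w : ℝ => Real.exp (-w / 4)) (Set.Iio (-v)) μ ∧
      ∫ w in Set.Iio (-v), Real.exp (-w / 4) ∂μ ≤ 2 * Real.exp (-(3 / 4 * v)) := by
  have := h.prob
  have e : ∀ t : ℝ, Real.exp (t / 4) * (1 / 4) * Real.exp (-t) =
      1 / 4 * Real.exp (-(3 / 4) * t) := by
    intro t
    rw [mul_right_comm, ← Real.exp_add, mul_comm]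
    congr 2
    ring
  have hi : IntegrableOn (fun t : ℝ => Real.exp (t / 4) * (1 / 4) * Real.exp (-t)) (Set.Ioi v) := by
    simp only [e]
    exact (integrableOn_exp_mul_Ioi (show (-(3 / 4) : ℝ) < 0 by norm_num) v).const_mul _
  have := setIntegral_le_of_tail (μ := μ) (X := fun w => -w) measurable_neg hv
    (K := fun t => Real.exp (t / 4)) (K' := fun t => Real.exp (t / 4) * (1 / 4))
    (S := fun t => Real.exp (-t))
    (fun t _ => ((hasDerivAt_id t).div_const 4).exp) (by fun_prop)
    (fun _ _ => by positivity) (by positivity) (fun t ht => h.neg_tail (hv.trans ht)) hi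
  have hset : {w : ℝ | v < -w} = Set.Iio (-v) := by
    ext w
    exact lt_neg (a := _) (b := w)
  rw [hset] at this
  refine ⟨this.1, this.2.trans ?_⟩
  simp only [e]
  rw [integral_const_mul, integral_exp_mul_Ioi (by norm_num), ← Real.exp_add]
  have h1 : Real.exp (v / 4 + -v) = Real.exp (-(3 / 4 * v)) := by congr 1; ring
  have h2 : Real.exp (-(3 / 4) * v) = Real.exp (-(3 / 4 * v)) := by congr 1; ring
  rw [h1, h2]
  have := Real.exp_pos (-(3 / 4 * v))
  norm_num
  linarith

lemma integrable_id (h : HasTails C μ) : Integrable (fun w : ℝ => w) μ := by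
  have := h.prob
  have i1 := (h.setIntegral_id le_rfl).1
  have i2 : IntegrableOn (fun w : ℝ => w) (Set.Iio (-0)) μ := by
    have h1 := (h.setIntegral_one_sub le_rfl).1
    have : IntegrableOn (fun w : ℝ => 1 - (1 - w)) (Set.Iio (-0)) μ :=
      (integrable_const (1 : ℝ)).integrableOn.sub h1
    simpa using this
  have i3 : IntegrableOn (fun w : ℝ => w) (Set.Icc 0 2) μ := continuousOn_id.integrableOn_Icc
  have : (Set.univ : Set ℝ) = Set.Iio (-0) ∪ (Set.Icc 0 2 ∪ Set.Ioi 2) := by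
    ext w
    simp only [Set.mem_univ, neg_zero, Set.mem_union, Set.mem_Iio, Set.mem_Icc, Set.mem_Ioi, true_iff]
    rcases lt_or_ge w 0 with h | h
    · exact Or.inl h
    · rcases le_or_gt w 2 with h' | h'
      · exact Or.inr (Or.inl ⟨h, h'⟩)
      · exact Or.inr (Or.inr h')
  rw [← integrableOn_univ, this]
  exact i2.union (i3.union i1)

end HasTails

namespace IsProfile

variable {C : ℝ} {ψ : ℝ → ℝ}

lemma tendsto_atBot (h : IsProfile C ψ) : Tendsto ψ atBot (𝓝 0) :=
  squeeze_zero h.nonneg h.le_exp Real.tendsto_exp_atBot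

lemma C_nonneg (h : IsProfile C ψ) : 0 ≤ C := by
  have h1 := h.tail 2 le_rfl
  have h2 := h.le_one 2
  linarith

lemma tendsto_atTop (h : IsProfile C ψ) : Tendsto ψ atTop (𝓝 1) := by
  have h1 : Tendsto (fun w : ℝ => 1 - C / w ^ 2) atTop (𝓝 (1 - 0)) :=
    (Tendsto.div_atTop tendsto_const_nhds (tendsto_pow_atTop two_ne_zero)).const_sub 1
  rw [sub_zero] at h1
  refine tendsto_of_tendsto_of_tendsto_of_le_of_le' h1 tendsto_const_nhds ?_
    (Filter.Eventually.of_forall h.le_one)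
  filter_upwards [eventually_ge_atTop 2] with w hw
  linarith [h.tail w hw]

/-- The Stieltjes function of a profile. -/
def stieltjes (h : IsProfile C ψ) : StieltjesFunction ℝ :=
  ⟨ψ, h.mono, fun _ => h.cont.continuousAt.continuousWithinAt⟩

/-- The probability measure with distribution function `ψ`. -/
def measure (h : IsProfile C ψ) : Measure ℝ := h.stieltjes.measure

lemma isProbabilityMeasure (h : IsProfile C ψ) : IsProbabilityMeasure h.measure :=
  h.stieltjes.isProbabilityMeasure h.tendsto_atBot h.tendsto_atTop

lemma measureReal_Iic (h : IsProfile C ψ) (w : ℝ) : h.measure.real (Set.Iic w) = ψ w := by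
  rw [Measure.real, measure, h.stieltjes.measure_Iic h.tendsto_atBot, sub_zero]
  exact ENNReal.toReal_ofReal (h.nonneg w)

lemma measureReal_Ioi (h : IsProfile C ψ) (w : ℝ) : h.measure.real (Set.Ioi w) = 1 - ψ w := by
  rw [Measure.real, measure, h.stieltjes.measure_Ioi h.tendsto_atTop]
  exact ENNReal.toReal_ofReal (sub_nonneg.2 (h.le_one w))

lemma measureReal_Iio (h : IsProfile C ψ) (w : ℝ) : h.measure.real (Set.Iio w) = ψ w := by
  rw [Measure.real, measure, h.stieltjes.measure_Iio h.tendsto_atBot, sub_zero]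
  have : Function.leftLim h.stieltjes w = ψ w :=
    (h.cont.continuousAt.continuousWithinAt).leftLim_eq
  rw [this]
  exact ENNReal.toReal_ofReal (h.nonneg w)

lemma hasTails (h : IsProfile C ψ) : HasTails C h.measure :=
  ⟨h.isProbabilityMeasure, h.C_nonneg, fun t ht => by rw [h.measureReal_Ioi]; exact h.tail t ht,
    fun t _ => by rw [h.measureReal_Iio]; exact h.le_exp _⟩

lemma integral_id (h : IsProfile C ψ) :
    IntegrableOn (fun w => 1 - ψ w) (Set.Ioi 0) ∧ IntegrableOn ψ (Set.Iic 0) ∧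
    ∫ w, w ∂h.measure = (∫ w in Set.Ioi 0, (1 - ψ w)) - ∫ w in Set.Iic 0, ψ w := by
  have hprob := h.isProbabilityMeasure
  have hint := h.hasTails.integrable_id
  have hpos : Integrable (fun w : ℝ => max w 0) h.measure := hint.pos_part
  have hneg : Integrable (fun w : ℝ => max (-w) 0) h.measure := hint.neg_part
  have e1 : ∫ w, max w 0 ∂h.measure = ∫ w in Set.Ioi 0, (1 - ψ w) := by
    rw [hpos.integral_eq_integral_meas_lt (Filter.Eventually.of_forall fun w => le_max_right _ _)]
    apply setIntegral_congr_fun measurableSet_Ioi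
    intro t ht
    have ht0 : (0 : ℝ) < t := ht
    simp only
    rw [← h.measureReal_Ioi]
    congr 1
    ext w
    simp [not_lt.2 ht0.le]
  have e2 : ∫ w, max (-w) 0 ∂h.measure = ∫ w in Set.Iic 0, ψ w := by
    rw [hneg.integral_eq_integral_meas_lt (Filter.Eventually.of_forall fun w => le_max_right _ _)]
    have : ∫ w in Set.Iic 0, ψ w = ∫ w in Set.Ioi 0, ψ (-w) := by
      rw [integral_comp_neg_Ioi, neg_zero]
    rw [this]
    apply setIntegral_congr_fun measurableSet_Ioi
    intro t ht
    have ht0 : (0 : ℝ) < t := ht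
    simp only
    rw [← h.measureReal_Iio]
    congr 1
    ext w
    simp only [Set.mem_ofPred_eq, lt_max_iff, not_lt.2 ht0.le, or_false, Set.mem_Iio]
    exact lt_neg
  refine ⟨?_, ?_, ?_⟩
  · have h1 : IntegrableOn (fun w => 1 - ψ w) (Set.Ioc 0 2) :=
      ((continuous_const.sub h.cont).continuousOn.integrableOn_Icc).mono_set Set.Ioc_subset_Icc_self
    have h2 : IntegrableOn (fun w => 1 - ψ w) (Set.Ioi 2) := by
      refine Integrable.mono' (integrableOn_const_div_sq C two_pos).1
        (continuous_const.sub h.cont).aestronglyMeasurable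
        ((ae_restrict_iff' measurableSet_Ioi).2 (Filter.Eventually.of_forall fun w hw => ?_))
      rw [Real.norm_of_nonneg (by linarith [h.le_one w])]
      exact h.tail w (le_of_lt hw)
    have := h1.union h2
    rwa [Set.Ioc_union_Ioi_eq_Ioi (by norm_num)] at this
  · refine Integrable.mono' (integrableOn_exp_Iic 0) h.cont.aestronglyMeasurable
      ((ae_restrict_iff' measurableSet_Iic).2 (Filter.Eventually.of_forall fun w _ => ?_))
    rw [Real.norm_of_nonneg (h.nonneg w)]
    exact h.le_exp w
  · rw [← e1, ← e2, ← integral_sub hpos hneg]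
    congr 1
    ext w
    rcases le_total 0 w with hw | hw
    · rw [max_eq_left hw, max_eq_right (by linarith), sub_zero]
    · rw [max_eq_right hw, max_eq_left (by linarith)]
      ring

/-- The mean of a profile is bounded in terms of its constant. -/
lemma abs_integral_id_le (h : IsProfile C ψ) : |∫ w, w ∂h.measure| ≤ 3 + C := by
  obtain ⟨i1, i2, e⟩ := h.integral_id
  have hC := h.C_nonneg
  rw [e]
  have a1 : 0 ≤ ∫ w in Set.Ioi 0, (1 - ψ w) :=
    setIntegral_nonneg measurableSet_Ioi fun w _ => by linarith [h.le_one w]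
  have a2 : 0 ≤ ∫ w in Set.Iic 0, ψ w :=
    setIntegral_nonneg measurableSet_Iic fun w _ => h.nonneg w
  have a3 : ∫ w in Set.Iic 0, ψ w ≤ 1 := by
    refine (setIntegral_mono i2 (integrableOn_exp_Iic 0) h.le_exp).trans ?_
    rw [integral_exp_Iic, Real.exp_zero]
  have a4 : ∫ w in Set.Ioi 0, (1 - ψ w) ≤ 2 + C / 2 := by
    rw [← Set.Ioc_union_Ioi_eq_Ioi (show (0 : ℝ) ≤ 2 by norm_num),
      setIntegral_union (Set.Ioc_disjoint_Ioi le_rfl) measurableSet_Ioi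
        (i1.mono_set Set.Ioc_subset_Ioi_self) (i1.mono_set (Set.Ioi_subset_Ioi two_pos.le))]
    have b1 : ∫ w in Set.Ioc 0 2, (1 - ψ w) ≤ ∫ _ in Set.Ioc (0 : ℝ) 2, (1 : ℝ) :=
      setIntegral_mono (i1.mono_set Set.Ioc_subset_Ioi_self) (by simp)
        fun w => by linarith [h.nonneg w]
    have b2 : ∫ w in Set.Ioi 2, (1 - ψ w) ≤ C / 2 := by
      rw [← (integrableOn_const_div_sq C two_pos).2]
      exact setIntegral_mono_on (i1.mono_set (Set.Ioi_subset_Ioi two_pos.le))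
        (integrableOn_const_div_sq C two_pos).1 measurableSet_Ioi
        fun w hw => h.tail w (le_of_lt hw)
    simp at b1
    linarith
  rw [abs_le]
  constructor <;> linarith

end IsProfile

lemma eta_eq_neg_integral {C : ℝ} {ν : Measure ℝ}
    (h : IsProfile C (fun w => cgf id ν (Real.exp w) / Real.exp w)) :
    eta ν = -∫ w, w ∂h.measure := by
  obtain ⟨i1, i2, e⟩ := h.integral_id
  rw [e]
  set ψ : ℝ → ℝ := fun w => cgf id ν (Real.exp w) / Real.exp w with hψ
  have hf : ∀ t, fLaw ν t = if t < 1 then cgf id ν t else cgf id ν t - t := fun t => rfl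
  have e1 : eta ν = ∫ w in Set.univ, |Real.exp w| • (fLaw ν (Real.exp w) / Real.exp w ^ 2) := by
    rw [eta, ← Real.range_exp, ← Set.image_univ]
    exact integral_image_eq_integral_abs_deriv_smul MeasurableSet.univ
      (fun x _ => (Real.hasDerivAt_exp x).hasDerivWithinAt) Real.exp_injective.injOn _
  have neg : ∀ w ∈ Set.Iio (0 : ℝ), |Real.exp w| • (fLaw ν (Real.exp w) / Real.exp w ^ 2) = ψ w := by
    intro w hw
    have : Real.exp w < 1 := by rw [← Real.exp_zero]; exact Real.exp_lt_exp.2 hw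
    rw [hf, if_pos this, abs_of_pos (Real.exp_pos w), smul_eq_mul, hψ]
    field_simp
  have pos : ∀ w ∈ Set.Ici (0 : ℝ), |Real.exp w| • (fLaw ν (Real.exp w) / Real.exp w ^ 2) =
      -(1 - ψ w) := by
    intro w hw
    have : ¬ Real.exp w < 1 := not_lt.2 (Real.one_le_exp hw)
    rw [hf, if_neg this, abs_of_pos (Real.exp_pos w), smul_eq_mul, hψ]
    field_simp
    ring
  have j1 : IntegrableOn (fun w => |Real.exp w| • (fLaw ν (Real.exp w) / Real.exp w ^ 2))
      (Set.Iio 0) :=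
    (i2.mono_set Set.Iio_subset_Iic_self).congr_fun (fun w hw => (neg w hw).symm) measurableSet_Iio
  have j2 : IntegrableOn (fun w => |Real.exp w| • (fLaw ν (Real.exp w) / Real.exp w ^ 2))
      (Set.Ici 0) := by
    have : IntegrableOn (fun w => -(1 - ψ w)) (Set.Ici 0) :=
      ((integrableOn_Ici_iff_integrableOn_Ioi (by simp)).2 i1).neg
    exact this.congr_fun (fun w hw => (pos w hw).symm) measurableSet_Ici
  rw [e1, ← Set.Iio_union_Ici (a := (0 : ℝ)), setIntegral_union
    (Set.Iio_disjoint_Ici le_rfl) measurableSet_Ici j1 j2,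
    setIntegral_congr_fun measurableSet_Iio neg, setIntegral_congr_fun measurableSet_Ici pos,
    integral_neg, integral_Ici_eq_integral_Ioi, integral_Iic_eq_integral_Iio]
  ring

/-! ### Sums of a profile over the sequence -/

namespace IsRegularSequence

variable {q : ℕ → ℝ} {α β A B : ℝ} {C : ℝ} {ψ : ℝ → ℝ}

lemma profile_sum_eq_integral (hq : IsRegularSequence q α β A B) (h : IsProfile C ψ) (σ y : ℝ) :
    Integrable (fun w => harmonicSum q (Real.exp (min (σ - w) y))) h.measure ∧
    ∑ n ∈ hq.idx (Real.exp y), 1 / q n * ψ (σ - Real.log (q n)) =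
      ∫ w, harmonicSum q (Real.exp (min (σ - w) y)) ∂h.measure := by
  have hprob := h.isProbabilityMeasure
  have e : ∀ w, harmonicSum q (Real.exp (min (σ - w) y)) =
      ∑ n ∈ hq.idx (Real.exp y), Set.indicator (Set.Iic (σ - Real.log (q n))) (fun _ => 1 / q n) w := by
    intro w
    rw [hq.harmonicSum_eq, ← hq.idx_filter (Real.exp_le_exp.2 (min_le_right (σ - w) y)),
      Finset.sum_filter]
    refine Finset.sum_congr rfl fun n hn => ?_
    rw [hq.mem_idx, ← Real.log_le_iff_le_exp (hq.pos n)] at hn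
    have : q n ≤ Real.exp (min (σ - w) y) ↔ w ∈ Set.Iic (σ - Real.log (q n)) := by
      rw [← Real.log_le_iff_le_exp (hq.pos n), le_min_iff, Set.mem_Iic]
      exact ⟨fun h => by linarith [h.1], fun h => ⟨by linarith, hn⟩⟩
    simp only [this, Set.indicator_apply]
  have hi : ∀ n ∈ hq.idx (Real.exp y), Integrable
      (Set.indicator (Set.Iic (σ - Real.log (q n))) (fun _ => 1 / q n)) h.measure :=
    fun n _ => (integrable_const _).indicator measurableSet_Iic
  simp only [e]
  refine ⟨integrable_finsetSum _ hi, ?_⟩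
  rw [integral_finsetSum _ hi]
  refine Finset.sum_congr rfl fun n _ => ?_
  rw [integral_indicator_const _ measurableSet_Iic, h.measureReal_Iic, smul_eq_mul, mul_comm]

lemma sq_le_exp_div_four {w : ℝ} (hw : w ≤ 0) : w ^ 2 ≤ 32 * Real.exp (-w / 4) := by
  have := Real.quadratic_le_exp_of_nonneg (show 0 ≤ -w / 4 by linarith)
  nlinarith

set_option maxHeartbeats 800000 in
theorem abs_profile_sum_sub_le (hq : IsRegularSequence q α β A B) (C : ℝ) :
    ∃ K σ₀ : ℝ, 0 ≤ K ∧ ∀ (ψ : ℝ → ℝ) (h : IsProfile C ψ) (σ y : ℝ), σ₀ ≤ σ →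
      σ + Real.log σ ≤ y →
      |∑ n ∈ hq.idx (Real.exp y), 1 / q n * ψ (σ - Real.log (q n)) -
        (harmonicSum q (Real.exp σ) - α * σ ^ (A - 1) * ∫ w, w ∂h.measure)| ≤
        K * errSize A B σ := by
  obtain ⟨K, σ₁, hK, hσ₁, hloc⟩ := hq.harmonicSum_local_sub
  obtain ⟨σ₂, hadd⟩ := hq.harmonicSum_add_le
  obtain ⟨Kh, σ₃, hKh, hdiv⟩ := hq.harmonicSum_div_sq_le
  have hα := hq.alpha_pos
  refine ⟨|5 * K + 3 * C * K + 64 * K + (4 * C * Kh + 4 * C * α) + 6 * α + (64 * Kh + 128 * α)|,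
    max (max σ₁ σ₂) (max σ₃ 4), by positivity, fun ψ h σ y hσ hy => ?_⟩
  have hprob := h.isProbabilityMeasure
  have hT := h.hasTails
  have hC := h.C_nonneg
  have s1 : σ₁ ≤ σ := (le_max_left _ _).trans ((le_max_left _ _).trans hσ)
  have s2 : σ₂ ≤ σ := (le_max_right _ _).trans ((le_max_left _ _).trans hσ)
  have s3 : σ₃ ≤ σ := (le_max_left _ _).trans ((le_max_right _ _).trans hσ)
  have s4 : 4 ≤ σ := (le_max_right _ _).trans ((le_max_right _ _).trans hσ)
  have hσ0 : 0 < σ := by linarith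
  have hσe : Real.exp 1 ≤ σ := by linarith [Real.exp_one_lt_d9]
  have hl1 : 1 ≤ Real.log σ := by rwa [Real.le_log_iff_exp_le hσ0]
  have hl2 : Real.log σ ≤ σ / 2 := by
    have h1 : Real.log σ = 2 * Real.log (Real.sqrt σ) := by
      rw [Real.log_sqrt hσ0.le]; ring
    have h2 := Real.log_le_sub_one_of_pos (Real.sqrt_pos.2 hσ0)
    have h3 := Real.sq_sqrt hσ0.le
    nlinarith only [h1, h2, h3, sq_nonneg (Real.sqrt σ - 2)]
  set H := harmonicSum q (Real.exp σ) with hH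
  have hH0 : 0 ≤ H := hq.harmonicSum_nonneg _
  set r := errSize A B σ with hr
  have hr1 : σ ^ (A - 2) + σ ^ (A - B) ≤ r := rpow_add_rpow_le_errSize A B hσe
  have p2 : 0 < σ ^ (A - 2) := by positivity
  have pB : 0 < σ ^ (A - B) := by positivity
  have p1 : 0 < σ ^ (A - 1) := by positivity
  have p12 : σ ^ (A - 1) = σ * σ ^ (A - 2) := by
    rw [show A - 2 = A - 1 - 1 by ring, Real.rpow_sub_one hσ0.ne' (A - 1)]
    field_simp
  have hr2 : σ ^ (A - 2) * Real.log σ ≤ r := by rw [hr, errSize]; linarith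
  have hr0 : 0 < r := by linarith
  have hHr : H ≤ Kh * (σ ^ 2 * r) := hdiv σ s3
  obtain ⟨iF, eF⟩ := hq.profile_sum_eq_integral h σ y
  set F : ℝ → ℝ := fun w => harmonicSum q (Real.exp (min (σ - w) y)) with hF
  have eD : ∑ n ∈ hq.idx (Real.exp y), 1 / q n * ψ (σ - Real.log (q n)) -
        (H - α * σ ^ (A - 1) * ∫ w, w ∂h.measure) =
      ∫ w, (F w - H + α * σ ^ (A - 1) * w) ∂h.measure := by
    have iG : Integrable (fun w => F w - H) h.measure := iF.sub (integrable_const _)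
    rw [eF, integral_add iG (hT.integrable_id.const_mul _),
      integral_sub iF (integrable_const _), integral_const_mul]
    simp only [integral_const, probReal_univ, one_smul]
    ring
  clear_value r
  set b₁ : ℝ → ℝ := fun _ => 5 * K * (σ ^ (A - 2) + σ ^ (A - B)) with hb₁
  set b₂ : ℝ → ℝ := (Set.Ioc 2 (σ / 2)).indicator (fun w => K * σ ^ (A - 2) * w ^ 2) with hb₂
  set b₃ : ℝ → ℝ := (Set.Iio (-0)).indicator
    (fun w => K * σ ^ (A - 2) * 32 * Real.exp (-w / 4)) with hb₃
  set b₄ : ℝ → ℝ := (Set.Ioi (σ / 2)).indicator (fun w => H + α * σ ^ (A - 1) * w) with hb₄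
  set b₅ : ℝ → ℝ := (Set.Iio (-Real.log σ)).indicator
    (fun w => 2 * α * σ ^ (A - 1) * (1 - w)) with hb₅
  set b₆ : ℝ → ℝ := (Set.Iio (-(σ / 2))).indicator
    (fun w => (2 * H + 4 * α * σ ^ (A - 1)) * Real.exp (-w / 4)) with hb₆
  have i₁ : Integrable b₁ h.measure := integrable_const _
  have i₂ : Integrable b₂ h.measure := by
    apply IntegrableOn.integrable_indicator _ measurableSet_Ioc
    apply IntegrableOn.mono_set _ Set.Ioc_subset_Icc_self
    exact ContinuousOn.integrableOn_Icc (by fun_prop)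
  have i₃ : Integrable b₃ h.measure :=
    IntegrableOn.integrable_indicator ((hT.setIntegral_exp le_rfl).1.const_mul _) measurableSet_Iio
  have j₄ := hT.setIntegral_id (show 2 ≤ σ / 2 by linarith)
  have i₄ : Integrable b₄ h.measure :=
    IntegrableOn.integrable_indicator ((integrable_const H).integrableOn.add (j₄.1.const_mul _))
      measurableSet_Ioi
  have j₅ := hT.setIntegral_one_sub (show 0 ≤ Real.log σ by linarith)
  have i₅ : Integrable b₅ h.measure :=
    IntegrableOn.integrable_indicator (j₅.1.const_mul _) measurableSet_Iio
  have j₆ := hT.setIntegral_exp (show 0 ≤ σ / 2 by linarith)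
  have i₆ : Integrable b₆ h.measure :=
    IntegrableOn.integrable_indicator (j₆.1.const_mul _) measurableSet_Iio
  have v₁ : ∫ w, b₁ w ∂h.measure ≤ 5 * K * r := by
    simp only [hb₁, integral_const, probReal_univ, one_smul]
    gcongr
  have v₂ : ∫ w, b₂ w ∂h.measure ≤ 3 * C * K * r := by
    rw [hb₂, integral_indicator measurableSet_Ioc, integral_const_mul]
    have h1 := hT.setIntegral_sq (show 2 ≤ σ / 2 by linarith)
    have h2 : Real.log (σ / 2) ≤ Real.log σ := Real.log_le_log (by positivity) (by linarith)
    calc K * σ ^ (A - 2) * ∫ w in Set.Ioc 2 (σ / 2), w ^ 2 ∂h.measure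
        ≤ K * σ ^ (A - 2) * (C + 2 * C * Real.log (σ / 2)) := by gcongr
      _ ≤ K * σ ^ (A - 2) * (C * Real.log σ + 2 * C * Real.log σ) := by
        gcongr
        exact le_mul_of_one_le_right hC hl1
      _ = 3 * C * K * (σ ^ (A - 2) * Real.log σ) := by ring
      _ ≤ _ := by gcongr
  have v₃ : ∫ w, b₃ w ∂h.measure ≤ 64 * K * r := by
    rw [hb₃, integral_indicator measurableSet_Iio, integral_const_mul]
    have h1 := (hT.setIntegral_exp le_rfl).2
    rw [mul_zero, neg_zero, Real.exp_zero] at h1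
    calc K * σ ^ (A - 2) * 32 * ∫ w in Set.Iio (-0), Real.exp (-w / 4) ∂h.measure
        ≤ K * σ ^ (A - 2) * 32 * (2 * 1) := by
          rw [neg_zero] at *
          gcongr
      _ = 64 * K * σ ^ (A - 2) := by ring
      _ ≤ _ := by gcongr; linarith
  have v₄ : ∫ w, b₄ w ∂h.measure ≤ (4 * C * Kh + 4 * C * α) * r := by
    rw [hb₄, integral_indicator measurableSet_Ioi, integral_add (integrable_const H).integrableOn
      (j₄.1.const_mul _), setIntegral_const, smul_eq_mul, integral_const_mul]
    have h1 := hT.upper (σ / 2) (by linarith)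
    have h2 : h.measure.real (Set.Ioi (σ / 2)) * H ≤ 4 * C * Kh * r := by
      calc h.measure.real (Set.Ioi (σ / 2)) * H ≤ C / (σ / 2) ^ 2 * (Kh * (σ ^ 2 * r)) := by gcongr
        _ = 4 * C * Kh * r := by field_simp; ring
    have h3 : α * σ ^ (A - 1) * ∫ w in Set.Ioi (σ / 2), w ∂h.measure ≤ 4 * C * α * r := by
      calc α * σ ^ (A - 1) * ∫ w in Set.Ioi (σ / 2), w ∂h.measure
          ≤ α * σ ^ (A - 1) * (2 * C / (σ / 2)) := by gcongr; exact j₄.2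
        _ = 4 * C * α * σ ^ (A - 2) := by rw [p12]; field_simp; ring
        _ ≤ _ := by gcongr; linarith
    linarith
  have v₅ : ∫ w, b₅ w ∂h.measure ≤ 6 * α * r := by
    rw [hb₅, integral_indicator measurableSet_Iio, integral_const_mul]
    have h1 := j₅.2
    rw [Real.exp_neg, Real.exp_log hσ0] at h1
    calc 2 * α * σ ^ (A - 1) * ∫ w in Set.Iio (-Real.log σ), (1 - w) ∂h.measure
        ≤ 2 * α * σ ^ (A - 1) * ((2 + Real.log σ) * σ⁻¹) := by gcongr
      _ ≤ 2 * α * σ ^ (A - 1) * ((2 * Real.log σ + Real.log σ) * σ⁻¹) := by gcongr; linarith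
      _ = 6 * α * (σ ^ (A - 2) * Real.log σ) := by rw [p12]; field_simp; ring
      _ ≤ _ := by gcongr
  have v₆ : ∫ w, b₆ w ∂h.measure ≤ (64 * Kh + 128 * α) * r := by
    rw [hb₆, integral_indicator measurableSet_Iio, integral_const_mul]
    have h1 := j₆.2
    have h2 : Real.exp (-(3 / 4 * (σ / 2))) ≤ 16 / σ ^ 2 := by
      rw [Real.exp_neg, inv_le_comm₀ (Real.exp_pos _) (by positivity), inv_div]
      have := Real.quadratic_le_exp_of_nonneg (show 0 ≤ 3 / 4 * (σ / 2) by linarith)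
      have e : (3 / 4 * (σ / 2)) ^ 2 = 9 / 64 * σ ^ 2 := by ring
      linarith [sq_nonneg σ]
    have h3 : σ ^ (A - 1) / σ ^ 2 ≤ r := by
      rw [p12, div_le_iff₀ (by positivity), mul_comm r]
      exact mul_le_mul (by nlinarith only [s4]) (by linarith) p2.le (by positivity)
    calc (2 * H + 4 * α * σ ^ (A - 1)) * ∫ w in Set.Iio (-(σ / 2)), Real.exp (-w / 4) ∂h.measure
        ≤ (2 * H + 4 * α * σ ^ (A - 1)) * (2 * (16 / σ ^ 2)) := by
          gcongr
          exact h1.trans (by gcongr)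
      _ ≤ (2 * (Kh * (σ ^ 2 * r)) + 4 * α * σ ^ (A - 1)) * (2 * (16 / σ ^ 2)) := by gcongr
      _ = 64 * Kh * r + 128 * α * (σ ^ (A - 1) / σ ^ 2) := by field_simp; ring
      _ ≤ 64 * Kh * r + 128 * α * r := by gcongr
      _ = _ := by ring
  have hbound : ∀ w, ‖F w - H + α * σ ^ (A - 1) * w‖ ≤
      b₁ w + b₂ w + b₃ w + b₄ w + b₅ w + b₆ w := by
    intro w
    have n₁ : 0 ≤ b₁ w := by positivity
    have n₂ : 0 ≤ b₂ w := Set.indicator_nonneg (fun w _ => by positivity) w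
    have n₃ : 0 ≤ b₃ w := Set.indicator_nonneg (fun w _ => by positivity) w
    have n₄ : 0 ≤ b₄ w := Set.indicator_nonneg (fun w hw => by
      have : σ / 2 < w := hw
      have : 0 < w := by linarith
      positivity) w
    have n₅ : 0 ≤ b₅ w := Set.indicator_nonneg (fun w hw => by
      have : w < -Real.log σ := hw
      have : 0 ≤ 1 - w := by linarith
      positivity) w
    have n₆ : 0 ≤ b₆ w := Set.indicator_nonneg (fun w _ => by positivity) w
    have hF0 : 0 ≤ F w := hq.harmonicSum_nonneg _
    have hFle : F w ≤ harmonicSum q (Real.exp (σ - w)) :=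
      hq.harmonicSum_mono (Real.exp_le_exp.2 (min_le_left _ _))
    have hα1 : 0 < α * σ ^ (A - 1) := by positivity
    rw [Real.norm_eq_abs, abs_le]
    rcases lt_or_ge (σ / 2) w with c1 | c1
    · have e4 : b₄ w = H + α * σ ^ (A - 1) * w := Set.indicator_of_mem (Set.mem_Ioi.2 c1) _
      have : F w ≤ H := hFle.trans (hq.harmonicSum_mono (Real.exp_le_exp.2 (by linarith)))
      have : 0 ≤ α * σ ^ (A - 1) * w := mul_nonneg hα1.le (by linarith)
      constructor <;> linarith
    have hwsq : K * σ ^ (A - 2) * w ^ 2 ≤ 4 * (K * σ ^ (A - 2)) + b₂ w + b₃ w := by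
      rcases lt_or_ge w 0 with h0 | h0
      · have e3 : b₃ w = K * σ ^ (A - 2) * 32 * Real.exp (-w / 4) :=
          Set.indicator_of_mem (by simpa using h0) _
        have := mul_le_mul_of_nonneg_left (sq_le_exp_div_four h0.le)
          (show 0 ≤ K * σ ^ (A - 2) by positivity)
        have : 0 ≤ K * σ ^ (A - 2) := by positivity
        linarith
      · rcases le_or_gt w 2 with h2 | h2
        · have := mul_le_mul_of_nonneg_left (show w ^ 2 ≤ 4 by nlinarith only [h0, h2])
            (show 0 ≤ K * σ ^ (A - 2) by positivity)
          linarith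
        · have e2 : b₂ w = K * σ ^ (A - 2) * w ^ 2 := Set.indicator_of_mem (Set.mem_Ioc.2 ⟨h2, c1⟩) _
          have : 0 ≤ K * σ ^ (A - 2) := by positivity
          linarith
    have hloc' : K * ((1 + (-w) ^ 2) * σ ^ (A - 2) + σ ^ (A - B)) ≤ b₁ w + b₂ w + b₃ w := by
      have : b₁ w = 5 * K * (σ ^ (A - 2) + σ ^ (A - B)) := rfl
      have : 0 ≤ K * σ ^ (A - B) := by positivity
      linarith
    rcases lt_or_ge w (-(σ / 2)) with c2 | c2
    · have e6 : b₆ w = (2 * H + 4 * α * σ ^ (A - 1)) * Real.exp (-w / 4) :=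
        Set.indicator_of_mem (Set.mem_Iio.2 c2) _
      have hup := hadd σ (-w) s2 (by linarith)
      rw [← sub_eq_add_neg] at hup
      have hlo : H ≤ F w := hq.harmonicSum_mono (Real.exp_le_exp.2 (le_min (by linarith)
        (by linarith)))
      have h4 : -w ≤ 4 * Real.exp (-w / 4) := by
        linarith [Real.add_one_le_exp (-w / 4)]
      have h5 := mul_le_mul_of_nonneg_left h4 hα1.le
      have h6 : α * σ ^ (A - 1) * w ≤ 0 := mul_nonpos_of_nonneg_of_nonpos hα1.le (by linarith)
      have h7 : 0 ≤ 2 * Real.exp (-w / 4) * H := by positivity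
      constructor <;> linarith
    have hl := hloc σ (-w) s1 (by rw [abs_neg, abs_le]; constructor <;> linarith)
    rw [← sub_eq_add_neg] at hl
    have hl' := abs_le.1 hl
    rcases lt_or_ge w (-Real.log σ) with c3 | c3
    · have e5 : b₅ w = 2 * α * σ ^ (A - 1) * (1 - w) := Set.indicator_of_mem (Set.mem_Iio.2 c3) _
      have hlo : H ≤ F w := hq.harmonicSum_mono (Real.exp_le_exp.2 (le_min (by linarith)
        (by linarith)))
      have h6 : α * σ ^ (A - 1) * w ≤ 0 := mul_nonpos_of_nonneg_of_nonpos hα1.le (by linarith)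
      constructor <;> linarith
    · have hFeq : F w = harmonicSum q (Real.exp (σ - w)) := by
        simp only [hF]
        rw [min_eq_left (by linarith)]
      rw [hFeq]
      constructor <;> linarith
  rw [eD, ← Real.norm_eq_abs]
  refine (norm_integral_le_of_norm_le (((((i₁.add i₂).add i₃).add i₄).add i₅).add i₆)
    (Filter.Eventually.of_forall hbound)).trans ?_
  have : ∫ w, (b₁ + b₂ + b₃ + b₄ + b₅ + b₆) w ∂h.measure =
      ∫ w, b₁ w ∂h.measure + ∫ w, b₂ w ∂h.measure + ∫ w, b₃ w ∂h.measure + ∫ w, b₄ w ∂h.measure +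
      ∫ w, b₅ w ∂h.measure + ∫ w, b₆ w ∂h.measure := by
    rw [integral_add' ((((i₁.add i₂).add i₃).add i₄).add i₅) i₆,
      integral_add' (((i₁.add i₂).add i₃).add i₄) i₅, integral_add' ((i₁.add i₂).add i₃) i₄,
      integral_add' (i₁.add i₂) i₃, integral_add' i₁ i₂]
  rw [this]
  have hfin := mul_le_mul_of_nonneg_right (le_abs_self
    (5 * K + 3 * C * K + 64 * K + (4 * C * Kh + 4 * C * α) + 6 * α + (64 * Kh + 128 * α))) hr0.le
  linarith

/-- The sum of `min (s / q_n) 1 / q_n` is of the order of the harmonic sum at `s`. -/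
theorem sum_min_le (hq : IsRegularSequence q α β A B) :
    ∃ K σ₀ : ℝ, 0 < K ∧ ∀ (σ Q : ℝ), σ₀ ≤ σ →
      ∑ n ∈ hq.idx Q, 1 / q n * min (Real.exp (σ - Real.log (q n))) 1 ≤
        K * harmonicSum q (Real.exp σ) := by
  obtain ⟨σ₂, hadd⟩ := hq.harmonicSum_add_le
  refine ⟨5, σ₂, by norm_num, fun σ Q hσ => ?_⟩
  have h := isProfile_min
  have hprob := h.isProbabilityMeasure
  have hT := h.hasTails
  set H := harmonicSum q (Real.exp σ) with hH
  have hH0 : 0 ≤ H := hq.harmonicSum_nonneg _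
  set y := Real.log (max Q 1) with hy
  have hsub : hq.idx Q ⊆ hq.idx (Real.exp y) := by
    apply hq.idx_mono
    rw [hy, Real.exp_log (by positivity)]
    exact le_max_left _ _
  refine (Finset.sum_le_sum_of_subset_of_nonneg hsub fun n _ _ => ?_).trans ?_
  · have := hq.pos n
    positivity
  obtain ⟨iF, eF⟩ := hq.profile_sum_eq_integral h σ y
  rw [eF]
  have j := hT.setIntegral_exp le_rfl
  have i₂ : Integrable ((Set.Iio (-0)).indicator fun w => 2 * H * Real.exp (-w / 4)) h.measure :=
    IntegrableOn.integrable_indicator (j.1.const_mul _) measurableSet_Iio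
  have hb : ∀ w, harmonicSum q (Real.exp (min (σ - w) y)) ≤
      H + (Set.Iio (-0)).indicator (fun w => 2 * H * Real.exp (-w / 4)) w := by
    intro w
    have h1 : harmonicSum q (Real.exp (min (σ - w) y)) ≤ harmonicSum q (Real.exp (σ - w)) :=
      hq.harmonicSum_mono (Real.exp_le_exp.2 (min_le_left _ _))
    by_cases hw : w < 0
    · rw [Set.indicator_of_mem (by simpa using hw)]
      have := hadd σ (-w) hσ (by linarith)
      rw [← sub_eq_add_neg] at this
      linarith
    · rw [Set.indicator_of_notMem (by simpa using hw), add_zero]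
      exact h1.trans (hq.harmonicSum_mono (Real.exp_le_exp.2 (by linarith)))
  refine (integral_mono iF ((integrable_const H).add i₂) hb).trans ?_
  rw [integral_add' (integrable_const H) i₂, integral_indicator measurableSet_Iio, integral_const_mul]
  have h2 := j.2
  rw [mul_zero, neg_zero, Real.exp_zero] at h2
  rw [neg_zero]
  simp only [integral_const, probReal_univ, one_smul]
  nlinarith

end IsRegularSequence

/-! ### The cumulant generating function of the weighted sum -/

namespace IsRegularSequence

variable {q : ℕ → ℝ} {α β A B : ℝ}

lemma weightedSum_eq (hq : IsRegularSequence q α β A B) {Ω : Type*} (X : ℕ → Ω → ℝ) (Q : ℝ)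
    (ω : Ω) : weightedSum q X Q ω = ∑ n ∈ hq.idx Q, X n ω / q n :=
  hq.finsum_eq_sum Q fun n => X n ω / q n

lemma exp_sub_log (hq : IsRegularSequence q α β A B) (σ : ℝ) (n : ℕ) :
    Real.exp (σ - Real.log (q n)) = Real.exp σ / q n := by
  rw [Real.exp_sub, Real.exp_log (hq.pos n)]

section

variable {Ω : Type*} [MeasurableSpace Ω] {P : Measure Ω} [IsProbabilityMeasure P]
  {κ c C : ℝ} {Y : ℕ → Ω → ℝ} {ν : Measure ℝ}

lemma integrable_exp_weightedSum (hq : IsRegularSequence q α β A B) (h : CRVH P κ c C Y ν)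
    (Q s : ℝ) : Integrable (fun ω => Real.exp (s * weightedSum q Y Q ω)) P ∧
    cgf (weightedSum q Y Q) P s = ∑ n ∈ hq.idx Q, cgf (Y n) P (s / q n) := by
  set X : ℕ → Ω → ℝ := fun n ω => Y n ω / q n with hX
  have hmeas : ∀ n, Measurable (X n) := fun n => (h.measurable n).div_const _
  have hind : iIndepFun X P := h.indep.comp (fun n y => y / q n) fun n => by fun_prop
  have hexp : ∀ n t, (fun ω => Real.exp (t * X n ω)) = fun ω => Real.exp (t / q n * Y n ω) := by
    intro n t
    ext ω
    simp only [hX]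
    congr 1
    ring
  have hint : ∀ n ∈ hq.idx Q, Integrable (fun ω => Real.exp (s * X n ω)) P := by
    intro n _
    rw [hexp]
    exact (h.isCentered n).integrable_exp _
  have hsum : weightedSum q Y Q = ∑ n ∈ hq.idx Q, X n := by
    ext ω
    rw [hq.weightedSum_eq, Finset.sum_apply]
  rw [hsum]
  refine ⟨hind.integrable_exp_mul_sum hmeas hint, ?_⟩
  rw [hind.cgf_sum hmeas hint]
  refine Finset.sum_congr rfl fun n _ => ?_
  rw [cgf, cgf, mgf, mgf, hexp]

lemma one_le_mgf_weightedSum (hq : IsRegularSequence q α β A B) (h : CRVH P κ c C Y ν)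
    (Q s : ℝ) : 0 ≤ cgf (weightedSum q Y Q) P s := by
  rw [(hq.integrable_exp_weightedSum h Q s).2]
  exact Finset.sum_nonneg fun n _ => (h.isCentered n).cgf_nonneg _

end

lemma sum_min_sq_eq (hq : IsRegularSequence q α β A B) (Q σ : ℝ) :
    ∑ n ∈ hq.idx Q, min (Real.exp σ / q n) ((Real.exp σ / q n) ^ 2) =
      Real.exp σ * ∑ n ∈ hq.idx Q, 1 / q n * min (Real.exp (σ - Real.log (q n))) 1 := by
  rw [Finset.mul_sum]
  refine Finset.sum_congr rfl fun n _ => ?_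
  have hn := hq.pos n
  rw [hq.exp_sub_log, ← mul_assoc, mul_one_div, mul_min_of_nonneg _ _ (by positivity), mul_one,
    min_comm, ← pow_two]

theorem cgf_weightedSum_le (hq : IsRegularSequence q α β A B) :
    ∃ D σ₀ : ℝ, 0 < D ∧ ∀ {Ω : Type*} [MeasurableSpace Ω] {P : Measure Ω} [IsProbabilityMeasure P]
      {κ c C : ℝ} {Y : ℕ → Ω → ℝ} {ν : Measure ℝ}, CRVH P κ c C Y ν → ∀ Q σ : ℝ, σ₀ ≤ σ →
      cgf (weightedSum q Y Q) P (Real.exp σ) ≤ D * (Real.exp σ * harmonicSum q (Real.exp σ)) ∧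
      cgf (weightedSum q Y Q) P (-Real.exp σ) ≤ D * (Real.exp σ * harmonicSum q (Real.exp σ)) := by
  obtain ⟨K, σ₀, hK, hmin⟩ := hq.sum_min_le
  refine ⟨K, σ₀, hK, fun {Ω} _ {P} _ {κ c C Y ν} h Q σ hσ => ?_⟩
  have key : ∀ s : ℝ, |s| = Real.exp σ → cgf (weightedSum q Y Q) P s ≤
      K * (Real.exp σ * harmonicSum q (Real.exp σ)) := by
    intro s hs
    rw [(hq.integrable_exp_weightedSum h Q s).2]
    calc ∑ n ∈ hq.idx Q, cgf (Y n) P (s / q n)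
        ≤ ∑ n ∈ hq.idx Q, min (Real.exp σ / q n) ((Real.exp σ / q n) ^ 2) := by
          refine Finset.sum_le_sum fun n _ => ?_
          have := (h.isCentered n).cgf_le_min (t := s / q n)
          rw [abs_div, hs, abs_of_pos (hq.pos n), ← sq_abs (s / q n), abs_div, hs,
            abs_of_pos (hq.pos n)] at this
          exact this
      _ ≤ Real.exp σ * (K * harmonicSum q (Real.exp σ)) := by
          rw [hq.sum_min_sq_eq]
          gcongr
          exact hmin σ Q hσ
      _ = _ := by ring
  exact ⟨key _ (abs_of_pos (Real.exp_pos σ)), key _ (by rw [abs_neg, abs_of_pos (Real.exp_pos σ)])⟩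

lemma le_log_index (hq : IsRegularSequence q α β A B) :
    ∃ σ₀ : ℝ, ∀ (σ : ℝ) (n : ℕ), σ₀ ≤ σ → Real.exp (σ / 2) ≤ q n →
      1 ≤ n ∧ σ / 8 ≤ Real.log ((n : ℝ) + 1) := by
  obtain ⟨x₀, hx₀⟩ := eventually_atTop.1 hq.sqrt_le_count
  refine ⟨max 1 (4 * Real.log (max x₀ 1)), fun σ n hσ hn => ?_⟩
  have hσ1 : 1 ≤ σ := (le_max_left _ _).trans hσ
  have hx : x₀ ≤ Real.exp (σ / 4) := by
    refine (le_max_left x₀ 1).trans ?_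
    rw [← Real.log_le_iff_le_exp (by positivity)]
    linarith [(le_max_right 1 (4 * Real.log (max x₀ 1))).trans hσ]
  have h1 := hx₀ _ hx
  have h2 : Real.sqrt (Real.exp (σ / 4)) = Real.exp (σ / 8) := by
    rw [← Real.exp_half]
    congr 1
    ring
  have h3 : hq.idx (Real.exp (σ / 4)) ⊆ Finset.range n := by
    intro k hk
    rw [hq.mem_idx] at hk
    rw [Finset.mem_range]
    by_contra hkn
    push Not at hkn
    have h4 := hq.monotone hkn
    have h5 : Real.exp (σ / 4) < Real.exp (σ / 2) := Real.exp_lt_exp.2 (by linarith)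
    linarith
  have h6 : (count q (Real.exp (σ / 4)) : ℝ) ≤ n := by
    rw [hq.count_eq]
    have := Finset.card_le_card h3
    rw [Finset.card_range] at this
    exact_mod_cast this
  rw [h2] at h1
  have h7 : Real.exp (σ / 8) ≤ n := h1.trans h6
  constructor
  · have : (0 : ℝ) < n := (Real.exp_pos _).trans_le h7
    exact_mod_cast this
  · rw [Real.le_log_iff_exp_le (by positivity)]
    linarith

theorem abs_cgf_weightedSum_sub_le (hq : IsRegularSequence q α β A B) {κ c : ℝ} (hκ : 0 < κ)
    (hc : 0 < c) (C : ℝ) :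
    ∃ K σ₀ : ℝ, 0 ≤ K ∧ ∀ {Ω : Type*} [MeasurableSpace Ω] {P : Measure Ω} [IsProbabilityMeasure P]
      {Y : ℕ → Ω → ℝ} {ν : Measure ℝ}, CRVH P κ c C Y ν → ∀ y σ : ℝ, σ₀ ≤ σ →
      σ + Real.log σ ≤ y →
      |cgf (weightedSum q Y (Real.exp y)) P (Real.exp σ) -
        Real.exp σ * (harmonicSum q (Real.exp σ) + α * eta ν * σ ^ (A - 1))| ≤
        K * (Real.exp σ * errSize A B σ) := by
  obtain ⟨K₁, σ₁, hK₁, hprof⟩ := hq.abs_profile_sum_sub_le (tailConst κ c)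
  obtain ⟨K₂, σ₂, hK₂, hmin⟩ := hq.sum_min_le
  obtain ⟨K₃, σ₃, hK₃, hdiv⟩ := hq.harmonicSum_div_sq_le
  obtain ⟨σ₄, hidx⟩ := hq.le_log_index
  set T := tailConst κ c with hT
  have hT0 : 0 < T := by
    rw [hT, tailConst]
    positivity
  set D := 128 * |C| + 4 * T with hD
  refine ⟨K₁ + D * (K₂ * K₃), max (max σ₁ σ₂) (max (max σ₃ σ₄) 4), by positivity,
    fun {Ω} _ {P} _ {Y ν} h y σ hσ hy => ?_⟩
  have s1 : σ₁ ≤ σ := (le_max_left _ _).trans ((le_max_left _ _).trans hσ)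
  have s2 : σ₂ ≤ σ := (le_max_right _ _).trans ((le_max_left _ _).trans hσ)
  have s3 : σ₃ ≤ σ :=
    (le_max_left _ _).trans ((le_max_left _ _).trans ((le_max_right _ _).trans hσ))
  have s4 : σ₄ ≤ σ :=
    (le_max_right _ _).trans ((le_max_left _ _).trans ((le_max_right _ _).trans hσ))
  have s5 : 4 ≤ σ := (le_max_right _ _).trans ((le_max_right _ _).trans hσ)
  have hσ0 : 0 < σ := by linarith
  have hprob := h.isProbabilityMeasure_law
  have hν := h.law_isCentered
  have hψ := h.isProfile hκ hc
  have e1 := hprof _ hψ σ y s1 hy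
  have hE := Real.exp_pos σ
  have hsum : ∑ n ∈ hq.idx (Real.exp y), 1 / q n * (cgf id ν (Real.exp (σ - Real.log (q n))) /
      Real.exp (σ - Real.log (q n))) =
      (∑ n ∈ hq.idx (Real.exp y), cgf id ν (Real.exp σ / q n)) / Real.exp σ := by
    rw [Finset.sum_div]
    refine Finset.sum_congr rfl fun n _ => ?_
    have hn := hq.pos n
    rw [hq.exp_sub_log]
    field_simp
  have heta := eta_eq_neg_integral hψ
  rw [hsum] at e1
  have e2 : |∑ n ∈ hq.idx (Real.exp y), cgf id ν (Real.exp σ / q n) -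
      Real.exp σ * (harmonicSum q (Real.exp σ) + α * eta ν * σ ^ (A - 1))| ≤
      K₁ * (Real.exp σ * errSize A B σ) := by
    have : ∑ n ∈ hq.idx (Real.exp y), cgf id ν (Real.exp σ / q n) -
      Real.exp σ * (harmonicSum q (Real.exp σ) + α * eta ν * σ ^ (A - 1)) =
      Real.exp σ * ((∑ n ∈ hq.idx (Real.exp y), cgf id ν (Real.exp σ / q n)) / Real.exp σ -
        (harmonicSum q (Real.exp σ) - α * σ ^ (A - 1) * ∫ w, w ∂hψ.measure)) := by
      rw [heta]
      field_simp
      ring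
    rw [this, abs_mul, abs_of_pos hE]
    calc _ ≤ Real.exp σ * (K₁ * errSize A B σ) := by gcongr
      _ = _ := by ring
  have hterm : ∀ n, |cgf (Y n) P (Real.exp σ / q n) - cgf id ν (Real.exp σ / q n)| ≤
      D / σ ^ 2 * min (Real.exp σ / q n) ((Real.exp σ / q n) ^ 2) := by
    intro n
    have hn := hq.pos n
    set u := Real.exp σ / q n with hu
    have hu0 : 0 < u := by positivity
    have hm0 : 0 ≤ min u (u ^ 2) := le_min hu0.le (sq_nonneg u)
    rcases le_or_gt (Real.exp (σ / 2)) (q n) with hcase | hcase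
    · obtain ⟨n1, nl⟩ := hidx σ n s4 hcase
      refine (h.abs_cgf_sub_le_min n1 hu0.le).trans ?_
      apply mul_le_mul_of_nonneg_right _ hm0
      calc 2 * (|C| / Real.log ((n : ℝ) + 1) ^ 2) ≤ 2 * (|C| / (σ / 8) ^ 2) := by gcongr
        _ = 128 * |C| / σ ^ 2 := by field_simp; ring
        _ ≤ D / σ ^ 2 := by
          gcongr
          rw [hD]
          linarith
    · have hu2 : Real.exp (σ / 2) ≤ u := by
        rw [hu, le_div_iff₀ hn]
        calc Real.exp (σ / 2) * q n ≤ Real.exp (σ / 2) * Real.exp (σ / 2) := by gcongr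
          _ = Real.exp σ := by rw [← Real.exp_add]; ring_nf
      have hue : Real.exp 2 ≤ u := (Real.exp_le_exp.2 (by linarith)).trans hu2
      have hul : σ / 2 ≤ Real.log u := by rwa [Real.le_log_iff_exp_le hu0]
      have hu1 : 1 ≤ u := by linarith [Real.add_one_le_exp (2 : ℝ)]
      have a1 := h.sub_cgf_le hκ hc n hue
      have a2 := h.sub_cgf_law_le hκ hc hue
      have a3 := (h.isCentered n).cgf_le_abs u
      have a4 := hν.cgf_le_abs u
      rw [abs_of_pos hu0] at a3 a4
      rw [min_eq_left (by nlinarith)]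
      have a5 : tailConst κ c * (u / Real.log u ^ 2) ≤ D / σ ^ 2 * u := by
        calc T * (u / Real.log u ^ 2) ≤ T * (u / (σ / 2) ^ 2) := by gcongr
          _ = 4 * T / σ ^ 2 * u := by field_simp; ring
          _ ≤ D / σ ^ 2 * u := by
            gcongr
            rw [hD]
            linarith [abs_nonneg C]
      rw [abs_le]
      constructor <;> linarith
  have e3 : |∑ n ∈ hq.idx (Real.exp y), cgf (Y n) P (Real.exp σ / q n) -
      ∑ n ∈ hq.idx (Real.exp y), cgf id ν (Real.exp σ / q n)| ≤
      D * (K₂ * K₃) * (Real.exp σ * errSize A B σ) := by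
    rw [← Finset.sum_sub_distrib]
    calc _ ≤ ∑ n ∈ hq.idx (Real.exp y),
          |cgf (Y n) P (Real.exp σ / q n) - cgf id ν (Real.exp σ / q n)| :=
          Finset.abs_sum_le_sum_abs _ _
      _ ≤ ∑ n ∈ hq.idx (Real.exp y),
          D / σ ^ 2 * min (Real.exp σ / q n) ((Real.exp σ / q n) ^ 2) :=
          Finset.sum_le_sum fun n _ => hterm n
      _ ≤ D / σ ^ 2 * (Real.exp σ * (K₂ * (K₃ * (σ ^ 2 * errSize A B σ)))) := by
          rw [← Finset.mul_sum, hq.sum_min_sq_eq]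
          gcongr
          exact (hmin σ _ s2).trans (by gcongr; exact hdiv σ s3)
      _ = _ := by field_simp
  rw [(hq.integrable_exp_weightedSum h _ _).2]
  have e2' := abs_le.1 e2
  have e3' := abs_le.1 e3
  rw [abs_le]
  constructor <;> linarith

end IsRegularSequence

/-! ### The truncated exponential series -/

/-- The Taylor polynomial of degree `k` of the exponential function. -/
def expTrunc (k : ℕ) (x : ℝ) : ℝ := ∑ j ∈ Finset.range (k + 1), x ^ j / j.factorial

lemma expTrunc_succ (k : ℕ) (x : ℝ) :
    expTrunc (k + 1) x = expTrunc k x + x ^ (k + 1) / (k + 1).factorial := by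
  rw [expTrunc, Finset.sum_range_succ, expTrunc]

@[simp] lemma expTrunc_zero_right (k : ℕ) : expTrunc k 0 = 1 := by
  rw [expTrunc, Finset.sum_range_succ']
  simp

lemma hasDerivAt_expTrunc_succ (k : ℕ) (x : ℝ) :
    HasDerivAt (expTrunc (k + 1)) (expTrunc k x) x := by
  have h : HasDerivAt (fun x : ℝ => ∑ j ∈ Finset.range (k + 1 + 1), x ^ j / (j.factorial : ℝ))
      (∑ j ∈ Finset.range (k + 1 + 1), (j * x ^ (j - 1)) / (j.factorial : ℝ)) x :=
    HasDerivAt.fun_sum fun j _ => (hasDerivAt_pow j x).div_const _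
  refine h.congr_deriv ?_
  rw [Finset.sum_range_succ', expTrunc]
  simp only [Nat.cast_zero, zero_mul, zero_div, add_zero]
  refine Finset.sum_congr rfl fun j _ => ?_
  rw [Nat.add_sub_cancel, Nat.factorial_succ]
  push_cast
  field_simp

lemma continuous_expTrunc (k : ℕ) : Continuous (expTrunc k) := by
  unfold expTrunc
  fun_prop

lemma expTrunc_alternating (m : ℕ) : ∀ x ≤ (0 : ℝ),
    Real.exp x ≤ expTrunc (2 * m) x ∧ expTrunc (2 * m + 1) x ≤ Real.exp x := by
  have down : ∀ k : ℕ, (∀ x ≤ (0 : ℝ), Real.exp x ≤ expTrunc k x) →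
      ∀ x ≤ (0 : ℝ), expTrunc (k + 1) x ≤ Real.exp x := by
    intro k hk x hx
    have hmono : AntitoneOn (fun x => Real.exp x - expTrunc (k + 1) x) (Set.Iic 0) := by
      apply antitoneOn_of_deriv_nonpos (convex_Iic 0)
      · exact (Real.continuous_exp.sub (continuous_expTrunc _)).continuousOn
      · exact fun y _ => ((Real.hasDerivAt_exp y).sub
          (hasDerivAt_expTrunc_succ k y)).differentiableAt.differentiableWithinAt
      · intro y hy
        rw [interior_Iic] at hy
        rw [((Real.hasDerivAt_exp y).fun_sub (hasDerivAt_expTrunc_succ k y)).deriv]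
        linarith [hk y (le_of_lt hy)]
    have := hmono hx (Set.mem_Iic.2 le_rfl) hx
    simp at this
    linarith
  have up : ∀ k : ℕ, (∀ x ≤ (0 : ℝ), expTrunc k x ≤ Real.exp x) →
      ∀ x ≤ (0 : ℝ), Real.exp x ≤ expTrunc (k + 1) x := by
    intro k hk x hx
    have hmono : MonotoneOn (fun x => Real.exp x - expTrunc (k + 1) x) (Set.Iic 0) := by
      apply monotoneOn_of_deriv_nonneg (convex_Iic 0)
      · exact (Real.continuous_exp.sub (continuous_expTrunc _)).continuousOn
      · exact fun y _ => ((Real.hasDerivAt_exp y).sub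
          (hasDerivAt_expTrunc_succ k y)).differentiableAt.differentiableWithinAt
      · intro y hy
        rw [interior_Iic] at hy
        rw [((Real.hasDerivAt_exp y).fun_sub (hasDerivAt_expTrunc_succ k y)).deriv]
        linarith [hk y (le_of_lt hy)]
    have := hmono hx (Set.mem_Iic.2 le_rfl) hx
    simp at this
    linarith
  induction m with
  | zero =>
    have h0 : ∀ x ≤ (0 : ℝ), Real.exp x ≤ expTrunc 0 x := fun x hx => by
      simpa [expTrunc] using Real.exp_le_one_iff.2 hx
    exact fun x hx => ⟨h0 x hx, down 0 h0 x hx⟩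
  | succ m ih =>
    have h1 := up (2 * m + 1) fun x hx => (ih x hx).2
    exact fun x hx => ⟨h1 x hx, down _ h1 x hx⟩

lemma expTrunc_le_exp (k : ℕ) {x : ℝ} (hx : 0 ≤ x) : expTrunc k x ≤ Real.exp x :=
  Real.sum_le_exp_of_nonneg hx _

lemma one_le_expTrunc (k : ℕ) {x : ℝ} (hx : 0 ≤ x) : 1 ≤ expTrunc k x := by
  rw [expTrunc, Finset.sum_range_succ']
  have : 0 ≤ ∑ j ∈ Finset.range k, x ^ (j + 1) / ((j + 1).factorial : ℝ) :=
    Finset.sum_nonneg fun j _ => by positivity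
  simpa using this

lemma expTrunc_mono (k : ℕ) {x y : ℝ} (hx : 0 ≤ x) (hxy : x ≤ y) : expTrunc k x ≤ expTrunc k y := by
  unfold expTrunc
  gcongr

lemma expTrunc_pos {k : ℕ} (hk : Even k) (x : ℝ) : 0 < expTrunc k x := by
  obtain ⟨m, rfl⟩ := even_iff_two_dvd.1 hk
  rcases le_total 0 x with hx | hx
  · linarith [one_le_expTrunc (2 * m) hx]
  · exact (Real.exp_pos x).trans_le (expTrunc_alternating m x hx).1

lemma expTrunc_le {k : ℕ} (hk : Even k) (x : ℝ) :
    expTrunc k x ≤ Real.exp x + x ^ k / k.factorial := by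
  have hpow : 0 ≤ x ^ k / k.factorial := div_nonneg (hk.pow_nonneg x) (by positivity)
  rcases le_total 0 x with hx | hx
  · linarith [expTrunc_le_exp k hx]
  · obtain ⟨m, rfl⟩ := even_iff_two_dvd.1 hk
    cases m with
    | zero =>
      simp [expTrunc]
      positivity
    | succ m =>
      have := (expTrunc_alternating m x hx).2
      rw [show 2 * (m + 1) = 2 * m + 1 + 1 by ring, expTrunc_succ]
      gcongr

lemma expTrunc_le_pow_mul_exp (k : ℕ) {x l : ℝ} (hx : 0 ≤ x) (hl : 1 ≤ l) :
    expTrunc k x ≤ l ^ k * Real.exp (x / l) := by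
  have hl0 : 0 < l := by linarith
  calc expTrunc k x ≤ l ^ k * expTrunc k (x / l) := by
        rw [expTrunc, expTrunc, Finset.mul_sum]
        refine Finset.sum_le_sum fun j hj => ?_
        have hjk : j ≤ k := Nat.lt_succ_iff.1 (Finset.mem_range.1 hj)
        rw [div_pow]
        have h1 : l ^ j ≤ l ^ k := pow_le_pow_right₀ hl hjk
        have h2 : x ^ j / (j.factorial : ℝ) = l ^ j * (x ^ j / l ^ j / j.factorial) := by
          field_simp
        rw [h2]
        gcongr
    _ ≤ _ := by
        gcongr
        exact expTrunc_le_exp k (by positivity)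

lemma pow_div_factorial_le (k : ℕ) {x l : ℝ} (hx : 0 ≤ x) (hl : 1 ≤ l) :
    x ^ k / k.factorial ≤ l ^ k * Real.exp (x / l) :=
  (Finset.single_le_sum (f := fun j : ℕ => x ^ j / (j.factorial : ℝ))
    (fun j _ => by positivity) (Finset.self_mem_range_succ k)).trans
    (expTrunc_le_pow_mul_exp k hx hl)

lemma pow_div_factorial_le_exp {k : ℕ} (hk : Even k) (x : ℝ) {l : ℝ} (hl : 0 < l) :
    x ^ k / k.factorial ≤ (l ^ k)⁻¹ * (Real.exp (l * x) + Real.exp (-(l * x))) := by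
  have h1 : (l * |x|) ^ k / k.factorial ≤ Real.exp (l * |x|) :=
    Real.pow_div_factorial_le_exp _ (by positivity) k
  have h2 : Real.exp (l * |x|) ≤ Real.exp (l * x) + Real.exp (-(l * x)) := by
    rcases abs_cases x with ⟨h, _⟩ | ⟨h, _⟩
    · rw [h]; linarith [Real.exp_pos (-(l * x))]
    · rw [h, mul_neg]; linarith [Real.exp_pos (l * x)]
  rw [mul_pow, hk.pow_abs] at h1
  rw [inv_mul_eq_div, le_div_iff₀ (by positivity)]
  calc x ^ k / k.factorial * l ^ k = l ^ k * x ^ k / k.factorial := by ring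
    _ ≤ _ := h1.trans h2

lemma exp_le_expTrunc_add {k : ℕ} (hk : Even k) (x : ℝ) {l : ℝ} (hl : 1 ≤ l) :
    Real.exp x ≤ expTrunc k x + (l ^ k)⁻¹ * Real.exp (l * x) := by
  have hl0 : 0 < l := by linarith
  rcases le_total 0 x with hx | hx
  · have hs : HasSum (fun j : ℕ => x ^ j / (j.factorial : ℝ)) (Real.exp x) := by
      have := NormedSpace.expSeries_div_hasSum_exp (𝔸 := ℝ) x
      rwa [← Real.exp_eq_exp_ℝ] at this
    have hs2 : HasSum (fun j : ℕ => (l ^ k)⁻¹ * ((l * x) ^ j / (j.factorial : ℝ)))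
        ((l ^ k)⁻¹ * Real.exp (l * x)) := by
      have := NormedSpace.expSeries_div_hasSum_exp (𝔸 := ℝ) (l * x)
      rw [← Real.exp_eq_exp_ℝ] at this
      exact this.mul_left _
    have h1 := hs.summable.sum_add_tsum_nat_add (k + 1)
    rw [hs.tsum_eq] at h1
    have h2 : ∑' j, x ^ (j + (k + 1)) / ((j + (k + 1)).factorial : ℝ) ≤
        ∑' j, (l ^ k)⁻¹ * ((l * x) ^ (j + (k + 1)) / ((j + (k + 1)).factorial : ℝ)) := by
      apply Summable.tsum_le_tsum _ ((summable_nat_add_iff (k + 1)).2 hs.summable)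
        ((summable_nat_add_iff (k + 1)).2 hs2.summable)
      intro j
      rw [mul_pow, mul_div_assoc, ← mul_assoc]
      have : 1 ≤ (l ^ k)⁻¹ * l ^ (j + (k + 1)) := by
        rw [inv_mul_eq_div, le_div_iff₀ (by positivity), one_mul]
        exact pow_le_pow_right₀ hl (by omega)
      have h0 : 0 ≤ x ^ (j + (k + 1)) / ((j + (k + 1)).factorial : ℝ) := by positivity
      nlinarith
    have h3 := hs2.summable.sum_add_tsum_nat_add (k + 1)
    rw [hs2.tsum_eq] at h3
    have h4 : 0 ≤ ∑ i ∈ Finset.range (k + 1), (l ^ k)⁻¹ * ((l * x) ^ i / (i.factorial : ℝ)) :=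
      Finset.sum_nonneg fun i _ => by positivity
    rw [expTrunc]
    linarith
  · obtain ⟨m, rfl⟩ := even_iff_two_dvd.1 hk
    have := (expTrunc_alternating m x hx).1
    have : 0 ≤ (l ^ (2 * m))⁻¹ * Real.exp (l * x) := by positivity
    linarith

lemma half_exp_le_expTrunc {k : ℕ} (hk : Even k) {x : ℝ} (hx : 0 ≤ x) (hkx : 2 * x + 1 ≤ k) :
    1 / 2 * Real.exp x ≤ expTrunc k x := by
  have h1 := exp_le_expTrunc_add hk x (Real.one_le_exp zero_le_one)
  have h2 : (Real.exp 1 ^ k)⁻¹ * Real.exp (Real.exp 1 * x) ≤ 1 / 2 * Real.exp x := by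
    rw [← Real.exp_nat_mul, ← Real.exp_neg, ← Real.exp_add]
    have e1 : -((k : ℝ) * 1) + Real.exp 1 * x ≤ -1 + x := by
      have := Real.exp_one_lt_d9
      nlinarith
    refine (Real.exp_le_exp.2 e1).trans ?_
    rw [Real.exp_add]
    gcongr
    rw [Real.exp_neg, inv_le_comm₀ (Real.exp_pos 1) (by norm_num)]
    have := Real.exp_one_gt_d9
    norm_num
    linarith
  linarith

lemma expTrunc_add_le (k : ℕ) {x y : ℝ} (hx : 0 ≤ x) (hxy : x ≤ y) :
    expTrunc k y ≤ Real.exp (y - x) * expTrunc k x := by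
  have hanti : AntitoneOn (fun t => Real.exp (-t) * expTrunc k t) (Set.Ici 0) := by
    cases k with
    | zero =>
      intro a _ b _ hab
      simpa [expTrunc] using hab
    | succ k =>
      have hd : ∀ t, HasDerivAt (fun t => Real.exp (-t) * expTrunc (k + 1) t)
          (Real.exp (-t) * (-1) * expTrunc (k + 1) t + Real.exp (-t) * expTrunc k t) t :=
        fun t => ((hasDerivAt_neg t).exp).mul (hasDerivAt_expTrunc_succ k t)
      apply antitoneOn_of_deriv_nonpos (convex_Ici 0)
      · exact fun t _ => (hd t).continuousAt.continuousWithinAt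
      · exact fun t _ => (hd t).differentiableAt.differentiableWithinAt
      · intro t ht
        rw [interior_Ici] at ht
        have ht0 : (0 : ℝ) < t := ht
        rw [(hd t).deriv, expTrunc_succ]
        have : 0 ≤ Real.exp (-t) * (t ^ (k + 1) / (k + 1).factorial) := by positivity
        linarith
  have := hanti (Set.mem_Ici.2 hx) (Set.mem_Ici.2 (hx.trans hxy)) hxy
  simp only at this
  have h2 := mul_le_mul_of_nonneg_left this (Real.exp_pos y).le
  rw [← mul_assoc, ← mul_assoc, ← Real.exp_add, ← Real.exp_add] at h2
  simpa [sub_eq_add_neg] using h2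

/-- The ratio `expTrunc k (t * x) / expTrunc k (s * x)` is increasing in `x` for `s ≤ t`. -/
lemma expTrunc_mul_le (k : ℕ) {s t v x : ℝ} (hs : 0 ≤ s) (hst : s ≤ t) (hv : 0 ≤ v) (hvx : v ≤ x) :
    expTrunc k (s * x) * expTrunc k (t * v) ≤ expTrunc k (t * x) * expTrunc k (s * v) := by
  have ht : 0 ≤ t := hs.trans hst
  have hx : 0 ≤ x := hv.trans hvx
  have hprod : ∀ a b : ℝ, expTrunc k a * expTrunc k b =
      ∑ i ∈ Finset.range (k + 1), ∑ j ∈ Finset.range (k + 1),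
        a ^ i * b ^ j / (i.factorial * j.factorial) := by
    intro a b
    rw [expTrunc, expTrunc, Finset.sum_mul_sum]
    refine Finset.sum_congr rfl fun i _ => Finset.sum_congr rfl fun j _ => ?_
    rw [div_mul_div_comm]
  have hprod' : ∀ a b : ℝ, expTrunc k a * expTrunc k b =
      ∑ i ∈ Finset.range (k + 1), ∑ j ∈ Finset.range (k + 1),
        a ^ j * b ^ i / (i.factorial * j.factorial) := by
    intro a b
    rw [mul_comm, hprod]
    refine Finset.sum_congr rfl fun i _ => Finset.sum_congr rfl fun j _ => ?_
    ring
  have key : 2 * (expTrunc k (s * x) * expTrunc k (t * v)) ≤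
      2 * (expTrunc k (t * x) * expTrunc k (s * v)) := by
    rw [two_mul, two_mul]
    nth_rw 1 [hprod]
    nth_rw 1 [hprod']
    nth_rw 1 [hprod]
    nth_rw 1 [hprod']
    simp only [← Finset.sum_add_distrib]
    refine Finset.sum_le_sum fun i _ => Finset.sum_le_sum fun j _ => ?_
    rw [← add_div, ← add_div]
    gcongr ?_ / _
    have sgn : ∀ i j : ℕ, i ≤ j → 0 ≤ (t ^ j * s ^ i - t ^ i * s ^ j) ∧
        0 ≤ (x ^ j * v ^ i - x ^ i * v ^ j) := by
      intro i j hij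
      obtain ⟨d, rfl⟩ := Nat.exists_eq_add_of_le hij
      constructor
      · have : t ^ (i + d) * s ^ i - t ^ i * s ^ (i + d) = t ^ i * s ^ i * (t ^ d - s ^ d) := by ring
        rw [this]
        have : s ^ d ≤ t ^ d := by gcongr
        have : 0 ≤ t ^ d - s ^ d := by linarith
        positivity
      · have : x ^ (i + d) * v ^ i - x ^ i * v ^ (i + d) = x ^ i * v ^ i * (x ^ d - v ^ d) := by ring
        rw [this]
        have : v ^ d ≤ x ^ d := by gcongr
        have : 0 ≤ x ^ d - v ^ d := by linarith
        positivity
    have hp : 0 ≤ (t ^ j * s ^ i - t ^ i * s ^ j) * (x ^ j * v ^ i - x ^ i * v ^ j) := by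
      rcases le_total i j with hij | hij
      · exact mul_nonneg (sgn i j hij).1 (sgn i j hij).2
      · have := mul_nonneg (sgn j i hij).1 (sgn j i hij).2
        linarith
    simp only [mul_pow]
    linarith
  linarith

/-! ### Transfer of moments -/

section

variable {Ω Ω' : Type*} [MeasurableSpace Ω] [MeasurableSpace Ω'] {P : Measure Ω} {P' : Measure Ω'}
  {q : ℕ → ℝ} {α β A B C L Q : ℝ} {X : ℕ → Ω → ℝ} {Y : ℕ → Ω' → ℝ}

omit [MeasurableSpace Ω] in
lemma IsRegularSequence.weightedSum_pow (hq : IsRegularSequence q α β A B) (X : ℕ → Ω → ℝ)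
    (Q : ℝ) (j : ℕ) (ω : Ω) : weightedSum q X Q ω ^ j =
      ∑ p ∈ Fintype.piFinset (fun _ : Fin j => hq.idx Q), (∏ i, 1 / q (p i)) * ∏ i, X (p i) ω := by
  rw [hq.weightedSum_eq, ← Fin.prod_const, Finset.prod_univ_sum]
  refine Finset.sum_congr rfl fun p _ => ?_
  rw [← Finset.prod_mul_distrib]
  refine Finset.prod_congr rfl fun i _ => ?_
  ring

lemma AIH.moment_weightedSum (h : AIH P P' q C L Q X Y) (hq : IsRegularSequence q α β A B) {j : ℕ}
    (hj : (j : ℝ) ≤ L) : Integrable (fun ω => weightedSum q X Q ω ^ j) P ∧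
      Integrable (fun ω => weightedSum q Y Q ω ^ j) P' ∧
      |(∫ ω, weightedSum q X Q ω ^ j ∂P) - ∫ ω, weightedSum q Y Q ω ^ j ∂P'| ≤
        C * Real.exp (-L) * harmonicSum q Q ^ j := by
  have hmem : ∀ p ∈ Fintype.piFinset (fun _ : Fin j => hq.idx Q), ∀ i, q (p i) ≤ Q := by
    intro p hp i
    exact hq.mem_idx.1 (Fintype.mem_piFinset.1 hp i)
  have iX : ∀ p ∈ Fintype.piFinset (fun _ : Fin j => hq.idx Q),
      Integrable (fun ω => (∏ i, 1 / q (p i)) * ∏ i, X (p i) ω) P :=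
    fun p hp => (h.integrable_X j hj p (hmem p hp)).const_mul _
  have iY : ∀ p ∈ Fintype.piFinset (fun _ : Fin j => hq.idx Q),
      Integrable (fun ω => (∏ i, 1 / q (p i)) * ∏ i, Y (p i) ω) P' :=
    fun p hp => (h.integrable_Y j hj p (hmem p hp)).const_mul _
  simp only [hq.weightedSum_pow]
  refine ⟨integrable_finsetSum _ iX, integrable_finsetSum _ iY, ?_⟩
  rw [integral_finsetSum _ iX, integral_finsetSum _ iY, ← Finset.sum_sub_distrib]
  have hH : harmonicSum q Q ^ j =
      ∑ p ∈ Fintype.piFinset (fun _ : Fin j => hq.idx Q), ∏ i, 1 / q (p i) := by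
    rw [hq.harmonicSum_eq, ← Fin.prod_const, Finset.prod_univ_sum]
  rw [hH, Finset.mul_sum]
  refine (Finset.abs_sum_le_sum_abs _ _).trans (Finset.sum_le_sum fun p hp => ?_)
  rw [integral_const_mul, integral_const_mul, ← mul_sub, abs_mul, mul_comm]
  have hpos : 0 ≤ ∏ i, 1 / q (p i) := Finset.prod_nonneg fun i _ => by
    have := hq.pos (p i)
    positivity
  rw [abs_of_nonneg hpos]
  gcongr
  exact h.moment j hj p (hmem p hp)

lemma expTrunc_mul_eq (k : ℕ) (s w : ℝ) :
    expTrunc k (s * w) = ∑ j ∈ Finset.range (k + 1), s ^ j / j.factorial * w ^ j := by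
  rw [expTrunc]
  refine Finset.sum_congr rfl fun j _ => ?_
  rw [mul_pow]
  ring

lemma integrable_expTrunc {W : Ω → ℝ} {k : ℕ} (hW : ∀ j ≤ k, Integrable (fun ω => W ω ^ j) P)
    (s : ℝ) : Integrable (fun ω => expTrunc k (s * W ω)) P := by
  simp only [expTrunc_mul_eq]
  exact integrable_finsetSum _ fun j hj =>
    (hW j (Nat.lt_succ_iff.1 (Finset.mem_range.1 hj))).const_mul _

lemma integral_expTrunc {W : Ω → ℝ} {k : ℕ} (hW : ∀ j ≤ k, Integrable (fun ω => W ω ^ j) P)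
    (s : ℝ) : ∫ ω, expTrunc k (s * W ω) ∂P =
      ∑ j ∈ Finset.range (k + 1), s ^ j / j.factorial * ∫ ω, W ω ^ j ∂P := by
  simp only [expTrunc_mul_eq]
  rw [integral_finsetSum _ fun j hj =>
    (hW j (Nat.lt_succ_iff.1 (Finset.mem_range.1 hj))).const_mul _]
  refine Finset.sum_congr rfl fun j _ => ?_
  rw [integral_const_mul]

lemma AIH.abs_expTrunc_sub_le (h : AIH P P' q C L Q X Y) (hq : IsRegularSequence q α β A B) {k : ℕ}
    (hk : (k : ℝ) ≤ L) {s l : ℝ} (hs : 0 ≤ s) (hl : 1 ≤ l) :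
    |(∫ ω, expTrunc k (s * weightedSum q X Q ω) ∂P) -
        ∫ ω, expTrunc k (s * weightedSum q Y Q ω) ∂P'| ≤
      |C| * Real.exp (-L) * (l ^ k * Real.exp (s * harmonicSum q Q / l)) ∧
    |(∫ ω, (s * weightedSum q X Q ω) ^ k / k.factorial ∂P) -
        ∫ ω, (s * weightedSum q Y Q ω) ^ k / k.factorial ∂P'| ≤
      |C| * Real.exp (-L) * (l ^ k * Real.exp (s * harmonicSum q Q / l)) := by
  have hj : ∀ j ≤ k, (j : ℝ) ≤ L := fun j hj => (Nat.cast_le.2 hj).trans hk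
  have hH := hq.harmonicSum_nonneg Q
  have hmom : ∀ j ≤ k, |(∫ ω, weightedSum q X Q ω ^ j ∂P) - ∫ ω, weightedSum q Y Q ω ^ j ∂P'| ≤
      |C| * Real.exp (-L) * harmonicSum q Q ^ j := by
    intro j hjk
    refine ((h.moment_weightedSum hq (hj j hjk)).2.2).trans ?_
    gcongr
    exact le_abs_self C
  have hterm : ∀ j ≤ k, |s ^ j / j.factorial * (∫ ω, weightedSum q X Q ω ^ j ∂P) -
      s ^ j / j.factorial * ∫ ω, weightedSum q Y Q ω ^ j ∂P'| ≤
      |C| * Real.exp (-L) * ((s * harmonicSum q Q) ^ j / j.factorial) := by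
    intro j hjk
    rw [← mul_sub, abs_mul, abs_of_nonneg (by positivity)]
    calc _ ≤ s ^ j / j.factorial * (|C| * Real.exp (-L) * harmonicSum q Q ^ j) := by
          gcongr
          exact hmom j hjk
      _ = _ := by rw [mul_pow]; ring
  constructor
  · rw [integral_expTrunc fun j hjk => (h.moment_weightedSum hq (hj j hjk)).1,
      integral_expTrunc fun j hjk => (h.moment_weightedSum hq (hj j hjk)).2.1,
      ← Finset.sum_sub_distrib]
    refine (Finset.abs_sum_le_sum_abs _ _).trans ?_
    calc _ ≤ ∑ j ∈ Finset.range (k + 1),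
          |C| * Real.exp (-L) * ((s * harmonicSum q Q) ^ j / j.factorial) :=
          Finset.sum_le_sum fun j hjk => hterm j (Nat.lt_succ_iff.1 (Finset.mem_range.1 hjk))
      _ = |C| * Real.exp (-L) * expTrunc k (s * harmonicSum q Q) := by
          rw [← Finset.mul_sum, expTrunc]
      _ ≤ _ := by
          gcongr
          exact expTrunc_le_pow_mul_exp k (by positivity) hl
  · have e : ∀ {Ω : Type _} [MeasurableSpace Ω] (P : Measure Ω) (W : Ω → ℝ),
        ∫ ω, (s * W ω) ^ k / k.factorial ∂P = s ^ k / k.factorial * ∫ ω, W ω ^ k ∂P := by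
      intro Ω _ P W
      rw [← integral_const_mul]
      congr 1
      ext ω
      rw [mul_pow]
      ring
    have e' : ∀ (W : Ω' → ℝ),
        ∫ ω, (s * W ω) ^ k / k.factorial ∂P' = s ^ k / k.factorial * ∫ ω, W ω ^ k ∂P' := by
      intro W
      rw [← integral_const_mul]
      congr 1
      ext ω
      rw [mul_pow]
      ring
    rw [e, e']
    refine (hterm k le_rfl).trans ?_
    gcongr
    exact pow_div_factorial_le k (by positivity) hl

end

/-! ### A tail estimate from truncated exponential moments -/

section

variable {Ω : Type*} [MeasurableSpace Ω] {P : Measure Ω} [IsProbabilityMeasure P]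

lemma measureReal_mul_expTrunc_le {W : Ω → ℝ} (hWm : Measurable W) {k : ℕ} (hk : Even k)
    (hW : ∀ j ≤ k, Integrable (fun ω => W ω ^ j) P) {s V : ℝ} (hs : 0 ≤ s) (hV : 0 ≤ V) :
    P.real {ω | V < W ω} * expTrunc k (s * V) ≤ ∫ ω, expTrunc k (s * W ω) ∂P := by
  have hmeas : MeasurableSet {ω | V < W ω} := measurableSet_lt measurable_const hWm
  calc P.real {ω | V < W ω} * expTrunc k (s * V)
      = ∫ ω, Set.indicator {ω | V < W ω} (fun _ => expTrunc k (s * V)) ω ∂P := by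
        rw [integral_indicator hmeas, setIntegral_const, smul_eq_mul]
    _ ≤ _ := by
        refine integral_mono ((integrable_const _).indicator hmeas) (integrable_expTrunc hW s) ?_
        intro ω
        by_cases hω : ω ∈ {ω | V < W ω}
        · rw [Set.indicator_of_mem hω]
          have : V < W ω := hω
          exact expTrunc_mono k (by positivity) (by gcongr)
        · rw [Set.indicator_of_notMem hω]
          exact (expTrunc_pos hk _).le

lemma expTrunc_le_sum {k : ℕ} (hk : Even k) {s₀ s s₂ V V' w : ℝ} (h0 : 0 ≤ s₀) (h1 : s₀ ≤ s)
    (h2 : s ≤ s₂) (hV' : 0 ≤ V') :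
    expTrunc k (s * w) ≤ 1 + (s * w) ^ k / k.factorial +
      Real.exp ((s - s₀) * V) * expTrunc k (s₀ * w) +
      Set.indicator {w | V < w} (fun _ => Real.exp (s * V')) w +
      Real.exp (s * V') / expTrunc k (s₂ * V') * expTrunc k (s₂ * w) := by
  have p1 : 0 ≤ (s * w) ^ k / k.factorial := div_nonneg (hk.pow_nonneg _) (by positivity)
  have p2 : 0 ≤ Real.exp ((s - s₀) * V) * expTrunc k (s₀ * w) :=
    mul_nonneg (Real.exp_pos _).le (expTrunc_pos hk _).le
  have p3 : 0 ≤ Set.indicator {w | V < w} (fun _ => Real.exp (s * V')) w :=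
    Set.indicator_nonneg (fun _ _ => (Real.exp_pos _).le) _
  have p4 : 0 ≤ Real.exp (s * V') / expTrunc k (s₂ * V') * expTrunc k (s₂ * w) :=
    mul_nonneg (div_nonneg (Real.exp_pos _).le (expTrunc_pos hk _).le) (expTrunc_pos hk _).le
  have hs : 0 ≤ s := h0.trans h1
  rcases lt_or_ge w 0 with hw | hw
  · have e1 := expTrunc_le hk (s * w)
    have e2 : Real.exp (s * w) ≤ 1 :=
      Real.exp_le_one_iff.2 (mul_nonpos_of_nonneg_of_nonpos hs hw.le)
    linarith
  rcases le_or_gt w V with hwV | hwV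
  · have e1 : expTrunc k (s * w) ≤ Real.exp (s * w - s₀ * w) * expTrunc k (s₀ * w) :=
      expTrunc_add_le k (by positivity) (by gcongr)
    have e2 : Real.exp (s * w - s₀ * w) * expTrunc k (s₀ * w) ≤
        Real.exp ((s - s₀) * V) * expTrunc k (s₀ * w) := by
      apply mul_le_mul_of_nonneg_right _ (expTrunc_pos hk _).le
      rw [← sub_mul]
      exact Real.exp_le_exp.2 (mul_le_mul_of_nonneg_left hwV (by linarith))
    linarith
  have e0 : expTrunc k (s * V') ≤ Real.exp (s * V') := expTrunc_le_exp k (by positivity)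
  rcases le_or_gt w V' with hwV' | hwV'
  · have hmem : w ∈ {w | V < w} := hwV
    rw [Set.indicator_of_mem hmem]
    have : expTrunc k (s * w) ≤ expTrunc k (s * V') :=
      expTrunc_mono k (by positivity) (by gcongr)
    linarith
  · have e1 := expTrunc_mul_le k hs h2 hV' hwV'.le
    have hp := expTrunc_pos hk (s₂ * V')
    have e2 : expTrunc k (s * w) ≤
        Real.exp (s * V') / expTrunc k (s₂ * V') * expTrunc k (s₂ * w) := by
      rw [div_mul_eq_mul_div, le_div_iff₀ hp]
      refine e1.trans ?_
      rw [mul_comm]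
      exact mul_le_mul_of_nonneg_right e0 (expTrunc_pos hk _).le
    linarith

lemma integral_expTrunc_le_sum {W : Ω → ℝ} (hWm : Measurable W) {k : ℕ} (hk : Even k)
    (hW : ∀ j ≤ k, Integrable (fun ω => W ω ^ j) P) {s₀ s s₂ V V' : ℝ} (h0 : 0 ≤ s₀) (h1 : s₀ ≤ s)
    (h2 : s ≤ s₂) (hV' : 0 ≤ V') :
    ∫ ω, expTrunc k (s * W ω) ∂P ≤ 1 + ∫ ω, (s * W ω) ^ k / k.factorial ∂P +
      Real.exp ((s - s₀) * V) * ∫ ω, expTrunc k (s₀ * W ω) ∂P +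
      Real.exp (s * V') * P.real {ω | V < W ω} +
      Real.exp (s * V') / expTrunc k (s₂ * V') * ∫ ω, expTrunc k (s₂ * W ω) ∂P := by
  have hmeas : MeasurableSet {ω | V < W ω} := measurableSet_lt measurable_const hWm
  have i1 : Integrable (fun ω => (s * W ω) ^ k / k.factorial) P := by
    have : (fun ω => (s * W ω) ^ k / (k.factorial : ℝ)) =
        fun ω => s ^ k / k.factorial * W ω ^ k := by
      ext ω
      rw [mul_pow]
      ring
    rw [this]
    exact (hW k le_rfl).const_mul _
  have i0 : Integrable (fun _ : Ω => (1 : ℝ)) P := integrable_const _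
  have i2 := (integrable_expTrunc hW s₀).const_mul (Real.exp ((s - s₀) * V))
  have i3 : Integrable (Set.indicator {ω | V < W ω} fun _ => Real.exp (s * V')) P :=
    (integrable_const _).indicator hmeas
  have i4 := (integrable_expTrunc hW s₂).const_mul (Real.exp (s * V') / expTrunc k (s₂ * V'))
  calc ∫ ω, expTrunc k (s * W ω) ∂P
      ≤ ∫ ω, (1 + (s * W ω) ^ k / k.factorial +
        Real.exp ((s - s₀) * V) * expTrunc k (s₀ * W ω) +
        Set.indicator {ω | V < W ω} (fun _ => Real.exp (s * V')) ω +
        Real.exp (s * V') / expTrunc k (s₂ * V') * expTrunc k (s₂ * W ω)) ∂P :=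
        integral_mono (integrable_expTrunc hW s) ((((i0.add i1).add i2).add i3).add i4)
          fun ω => expTrunc_le_sum hk h0 h1 h2 hV'
    _ = _ := by
        rw [integral_add (((i0.fun_add i1).fun_add i2).fun_add i3) i4,
          integral_add ((i0.fun_add i1).fun_add i2) i3, integral_add (i0.fun_add i1) i2, integral_add i0 i1, integral_const_mul, integral_const_mul,
          integral_indicator hmeas, setIntegral_const, smul_eq_mul]
        simp [mul_comm]

lemma one_add_exp_mul_sub_one_ge {x : ℝ} (hx : 0 ≤ x) :
    x ^ 2 / 2 ≤ 1 + Real.exp x * (x - 1) := by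
  have hmono : MonotoneOn (fun x => 1 + Real.exp x * (x - 1) - x ^ 2 / 2) (Set.Ici 0) := by
    have hd : ∀ x : ℝ, HasDerivAt (fun x => 1 + Real.exp x * (x - 1) - x ^ 2 / 2)
        (x * (Real.exp x - 1)) x := by
      intro x
      have h1 := ((((Real.hasDerivAt_exp x).fun_mul ((hasDerivAt_id' x).sub_const 1)).const_add 1).fun_sub
        ((hasDerivAt_pow 2 x).div_const 2))
      refine h1.congr_deriv ?_
      push_cast
      ring
    apply monotoneOn_of_deriv_nonneg (convex_Ici 0)
    · exact fun y _ => (hd y).continuousAt.continuousWithinAt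
    · exact fun y _ => (hd y).differentiableAt.differentiableWithinAt
    · intro y hy
      rw [interior_Ici] at hy
      have hy0 : (0 : ℝ) < y := hy
      rw [(hd y).deriv]
      have := Real.one_le_exp hy0.le
      exact mul_nonneg hy0.le (by linarith)
  have := hmono (Set.mem_Ici.2 le_rfl) hx hx
  simp at this
  linarith

lemma sixteen_le_exp {x : ℝ} (hx : 15 ≤ x) : 16 ≤ Real.exp x := by
  linarith [Real.add_one_le_exp x]

set_option maxHeartbeats 1000000 in
/-- The tail estimate: if the truncated exponential moments of `W` at `s₀ e^τ` are of size
`exp (g τ)`, and `g τ` is close to `s₀ e^τ (V + N (τ - 1))`, then `P(W > V)` is close to `exp (-s₀ N)`. -/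
theorem exists_measureReal_eq_exp {W : Ω → ℝ} (hWm : Measurable W) {k : ℕ} (hk : Even k)
    (hW : ∀ j ≤ k, Integrable (fun ω => W ω ^ j) P) {V N s₀ ε δ : ℝ} {g : ℝ → ℝ} (hN : 0 < N)
    (hs₀ : 0 < s₀) (hVN : 4 * N ≤ V) (hε : 0 < ε) (hε1 : ε ≤ 1) (hδ0 : 0 ≤ δ)
    (hδ : 8 * δ ≤ ε ^ 2) (hNδ : 10 ≤ s₀ * N * δ)
    (hkV : 2 * (s₀ * Real.exp 2 * (V + 2 * N)) + 1 ≤ k)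
    (hF : ∀ τ, 0 ≤ τ → τ ≤ 2 →
      1 / 2 * Real.exp (g τ) ≤ ∫ ω, expTrunc k (s₀ * Real.exp τ * W ω) ∂P ∧
      ∫ ω, expTrunc k (s₀ * Real.exp τ * W ω) ∂P ≤ 2 * Real.exp (g τ))
    (hpow : ∀ τ, 0 ≤ τ → τ ≤ 2 → ∫ ω, (s₀ * Real.exp τ * W ω) ^ k / k.factorial ∂P ≤ 1)
    (hg : ∀ τ, 0 ≤ τ → τ ≤ 2 →
      |g τ - s₀ * Real.exp τ * (V + N * (τ - 1))| ≤ δ * (s₀ * N)) :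
    ∃ θ : ℝ, |θ| ≤ 6 * ε ∧ P.real {ω | V < W ω} = Real.exp (-(s₀ * N * (1 + θ))) := by
  have hV : 0 < V := by linarith
  set p := P.real {ω | V < W ω} with hp
  set s := s₀ * Real.exp ε with hs
  set s₂ := s₀ * Real.exp (2 * ε) with hs₂
  set V' := V + 2 * ε * N with hV'
  have hM : 0 < s₀ * N := by positivity
  have hV'0 : 0 < V' := by positivity
  have hV'2 : V' ≤ V + 2 * N := by
    have := mul_le_of_le_one_left hN.le hε1
    linarith
  have hx1 : 1 ≤ Real.exp ε := Real.one_le_exp hε.le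
  have hx2 : Real.exp (2 * ε) = Real.exp ε * Real.exp ε := by rw [← Real.exp_add]; ring_nf
  have hx3 : Real.exp (2 * ε) ≤ Real.exp 2 := Real.exp_le_exp.2 (by linarith)
  have hx4 : 1 ≤ Real.exp 2 := Real.one_le_exp (by norm_num)
  have hx5 : Real.exp ε ≤ 1 + 2 * ε := by
    have := Real.abs_exp_sub_one_le (x := ε) (by rw [abs_of_pos hε]; exact hε1)
    rw [abs_of_pos hε] at this
    linarith [(abs_le.1 this).2]
  have hss : s₀ ≤ s := by
    rw [hs]
    exact le_mul_of_one_le_right hs₀.le hx1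
  have hss2 : s ≤ s₂ := by
    rw [hs, hs₂, hx2]
    rw [← mul_assoc]
    exact le_mul_of_one_le_right (by positivity) hx1
  have hs₂0 : 0 < s₂ := by positivity
  have g0 := hg 0 le_rfl (by norm_num)
  have g1 := hg ε hε.le (by linarith)
  have g2 := hg (2 * ε) (by linarith) (by linarith)
  have F0 := hF 0 le_rfl (by norm_num)
  have F1 := hF ε hε.le (by linarith)
  have F2 := hF (2 * ε) (by linarith) (by linarith)
  have pw := hpow ε hε.le (by linarith)
  rw [Real.exp_zero, mul_one] at g0 F0
  rw [← hs] at g1 F1 pw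
  rw [← hs₂] at g2 F2
  rw [abs_le] at g0 g1 g2
  have hδM : δ * (s₀ * N) = s₀ * N * δ := by ring
  have t0 : 1 / 2 * Real.exp (s₀ * V) ≤ expTrunc k (s₀ * V) := by
    refine half_exp_le_expTrunc hk (by positivity) (le_trans ?_ hkV)
    have : s₀ * V ≤ s₀ * Real.exp 2 * (V + 2 * N) := by
      have h1 : s₀ * 1 ≤ s₀ * Real.exp 2 := by gcongr
      rw [mul_one] at h1
      have h2 : V ≤ V + 2 * N := by linarith
      gcongr
    linarith
  have t2 : 1 / 2 * Real.exp (s₂ * V') ≤ expTrunc k (s₂ * V') := by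
    refine half_exp_le_expTrunc hk (by positivity) (le_trans ?_ hkV)
    have : s₂ * V' ≤ s₀ * Real.exp 2 * (V + 2 * N) := by
      rw [hs₂]
      gcongr
    linarith
  have upper : p ≤ Real.exp (-(s₀ * N * (1 - 2 * δ))) := by
    have h1 := measureReal_mul_expTrunc_le hWm hk hW hs₀.le hV.le
    rw [← hp] at h1
    have hp0 : 0 ≤ p := measureReal_nonneg
    have h2 : p * (1 / 2 * Real.exp (s₀ * V)) ≤ 2 * Real.exp (g 0) :=
      (mul_le_mul_of_nonneg_left t0 hp0).trans (h1.trans F0.2)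
    have h3 : p ≤ 4 * Real.exp (g 0 - s₀ * V) := by
      rw [Real.exp_sub, mul_div_assoc', le_div_iff₀ (Real.exp_pos _)]
      linarith
    have h4 : (4 : ℝ) ≤ Real.exp (s₀ * N * δ) := by
      linarith [Real.add_one_le_exp (s₀ * N * δ)]
    calc p ≤ 4 * Real.exp (g 0 - s₀ * V) := h3
      _ ≤ Real.exp (s₀ * N * δ) * Real.exp (g 0 - s₀ * V) := by gcongr
      _ ≤ _ := by
        rw [← Real.exp_add]
        apply Real.exp_le_exp.2
        linarith [g0.2]
  have lower : Real.exp (-(s₀ * N * (1 + 6 * ε))) ≤ p := by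
    have h1 := integral_expTrunc_le_sum (V := V) hWm hk hW hs₀.le hss hss2 hV'0.le
    rw [← hp] at h1
    have b1 : 16 ≤ Real.exp (g ε - Real.log 2) := by
      apply sixteen_le_exp
      have hNε := mul_pos hN hε
      have : V - N ≤ Real.exp ε * (V + N * (ε - 1)) := by
        refine le_trans (b := V + N * (ε - 1)) (by linarith) ?_
        exact le_mul_of_one_le_left (by linarith) hx1
      have : s₀ * (V - N) ≤ s * (V + N * (ε - 1)) := by
        rw [hs, mul_assoc]
        gcongr
      have hε2 : ε ^ 2 ≤ 1 := pow_le_one₀ hε.le hε1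
      have hδ1 : δ ≤ 1 := by linarith
      have h10 : 10 ≤ s₀ * N := hNδ.trans (mul_le_of_le_one_right hM.le hδ1)
      have h11 : δ * (s₀ * N) ≤ s₀ * N := mul_le_of_le_one_left hM.le hδ1
      have : s₀ * (4 * N) ≤ s₀ * V := by gcongr
      have := Real.log_two_lt_d9
      linarith [g1.1]
    rw [Real.exp_sub, Real.exp_log (by norm_num)] at b1
    have b2 : 32 * (Real.exp ((s - s₀) * V) * Real.exp (g 0)) ≤ Real.exp (g ε) := by
      have e1 := one_add_exp_mul_sub_one_ge hε.le
      have e2 : s₀ * N * (4 * δ) ≤ s₀ * N * (1 + Real.exp ε * (ε - 1)) := by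
        gcongr
        linarith
      have e3 : s * (V + N * (ε - 1)) - s₀ * (V + N * (0 - 1)) - (s - s₀) * V =
          s₀ * N * (1 + Real.exp ε * (ε - 1)) := by rw [hs]; ring
      have e4 : 20 ≤ g ε - g 0 - (s - s₀) * V := by linarith [g1.1, g0.2]
      have e5 : Real.exp (g ε) = Real.exp (g ε - g 0 - (s - s₀) * V - Real.log 2) * 2 *
          (Real.exp ((s - s₀) * V) * Real.exp (g 0)) := by
        rw [Real.exp_sub, Real.exp_log (by norm_num), ← Real.exp_add, div_mul_cancel₀ _ (by norm_num),
          ← Real.exp_add]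
        congr 1
        ring
      rw [e5]
      have e6 := sixteen_le_exp (x := g ε - g 0 - (s - s₀) * V - Real.log 2)
        (by linarith [Real.log_two_lt_d9])
      have h0 : 0 < Real.exp ((s - s₀) * V) * Real.exp (g 0) := by positivity
      exact mul_le_mul_of_nonneg_right (by linarith) h0.le
    have b3 : 64 * (Real.exp (s * V') / Real.exp (s₂ * V') * Real.exp (g (2 * ε))) ≤
        Real.exp (g ε) := by
      have e1 : ε ^ 2 / 2 ≤ Real.exp ε * (Real.exp ε - 1 - ε) := by
        have := Real.quadratic_le_exp_of_nonneg hε.le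
        refine le_trans (b := Real.exp ε - 1 - ε) (by linarith) ?_
        exact le_mul_of_one_le_left (by linarith [sq_nonneg ε]) hx1
      have e2 : s₀ * N * (4 * δ) ≤ s₀ * N * (Real.exp ε * (Real.exp ε - 1 - ε)) :=
        mul_le_mul_of_nonneg_left (by linarith) hM.le
      have e3 : s * (V + N * (ε - 1)) - s₂ * (V + N * (2 * ε - 1)) + (s₂ - s) * V' =
          s₀ * N * (Real.exp ε * (Real.exp ε - 1 - ε)) := by
        rw [hs, hs₂, hV', hx2]; ring
      have e4 : 20 ≤ g ε - g (2 * ε) + (s₂ - s) * V' := by linarith [g1.1, g2.2]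
      have e5 : Real.exp (g ε) =
          Real.exp (g ε - g (2 * ε) + (s₂ - s) * V' - Real.log 2 - Real.log 2) * 2 * 2 *
          (Real.exp (s * V') / Real.exp (s₂ * V') * Real.exp (g (2 * ε))) := by
        rw [Real.exp_sub, Real.exp_sub, Real.exp_log (by norm_num), div_mul_cancel₀ _ (by norm_num),
          div_mul_cancel₀ _ (by norm_num), ← Real.exp_sub, ← Real.exp_add, ← Real.exp_add]
        congr 1
        ring
      rw [e5]
      have e6 := sixteen_le_exp (x := g ε - g (2 * ε) + (s₂ - s) * V' - Real.log 2 - Real.log 2)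
        (by linarith [Real.log_two_lt_d9])
      have h0 : 0 < Real.exp (s * V') / Real.exp (s₂ * V') * Real.exp (g (2 * ε)) := by positivity
      exact mul_le_mul_of_nonneg_right (by linarith) h0.le
    have b4 : Real.exp (s * V') / expTrunc k (s₂ * V') * ∫ ω, expTrunc k (s₂ * W ω) ∂P ≤
        4 * (Real.exp (s * V') / Real.exp (s₂ * V') * Real.exp (g (2 * ε))) := by
      calc _ ≤ Real.exp (s * V') / (1 / 2 * Real.exp (s₂ * V')) * (2 * Real.exp (g (2 * ε))) := by
            have := expTrunc_pos hk (s₂ * V')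
            have h0 : 0 ≤ ∫ ω, expTrunc k (s₂ * W ω) ∂P := le_trans (by positivity) F2.1
            exact mul_le_mul (by gcongr) F2.2 h0 (by positivity)
        _ = _ := by field_simp; ring
    have b5 : Real.exp ((s - s₀) * V) * ∫ ω, expTrunc k (s₀ * W ω) ∂P ≤
        Real.exp ((s - s₀) * V) * (2 * Real.exp (g 0)) := by
      gcongr
      exact F0.2
    have b6 : 1 / 4 * Real.exp (g ε) ≤ Real.exp (s * V') * p := by
      linarith [F1.1]
    have b7 : 1 / 4 * Real.exp (g ε - s * V') ≤ p := by
      rw [Real.exp_sub, mul_div_assoc', div_le_iff₀ (Real.exp_pos _)]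
      linarith
    have h4 : (4 : ℝ) ≤ Real.exp (s₀ * N * δ) := by
      linarith [Real.add_one_le_exp (s₀ * N * δ)]
    have b8 : Real.exp (-(s₀ * N * δ)) ≤ 1 / 4 := by
      rw [Real.exp_neg, one_div]
      gcongr
    refine le_trans ?_ b7
    calc Real.exp (-(s₀ * N * (1 + 6 * ε)))
        ≤ Real.exp (-(s₀ * N * δ) + (g ε - s * V')) := by
          apply Real.exp_le_exp.2
          have e3 : s * (V + N * (ε - 1)) - s * V' = -(s₀ * N * (Real.exp ε * (1 + ε))) := by
            rw [hs, hV']; ring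
          have e4 : s₀ * N * (Real.exp ε * (1 + ε) + 2 * δ) ≤ s₀ * N * (1 + 6 * ε) := by
            apply mul_le_mul_of_nonneg_left _ hM.le
            have e5 : Real.exp ε * (1 + ε) ≤ (1 + 2 * ε) * (1 + ε) := by gcongr
            have e6 : ε * ε ≤ ε := mul_le_of_le_one_left hε.le hε1
            linarith
          linarith [g1.1]
      _ ≤ _ := by
        rw [Real.exp_add]
        gcongr
  have hp0 : 0 < p := (Real.exp_pos _).trans_le lower
  refine ⟨-Real.log p / (s₀ * N) - 1, ?_, ?_⟩
  · have l1 : -(s₀ * N * (1 + 6 * ε)) ≤ Real.log p := (Real.le_log_iff_exp_le hp0).2 lower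
    have l2 : Real.log p ≤ -(s₀ * N * (1 - 2 * δ)) := (Real.log_le_iff_le_exp hp0).2 upper
    rw [abs_le]
    constructor
    · rw [le_sub_iff_add_le, le_div_iff₀ hM]
      have : s₀ * N * (-(6 * ε) + 1) ≤ s₀ * N * (1 - 2 * δ) := by
        gcongr
        have e6 : ε * ε ≤ ε := mul_le_of_le_one_left hε.le hε1
        linarith
      linarith
    · rw [sub_le_iff_le_add, div_le_iff₀ hM]
      linarith
  · have : -(s₀ * N * (1 + (-Real.log p / (s₀ * N) - 1))) = Real.log p := by
      field_simp
      ring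
    rw [this, Real.exp_log hp0]

end

/-! ### The range of `V` -/

lemma eventually_mul_rpow_le_exp (C γ : ℝ) {b : ℝ} (hb : 0 < b) :
    ∀ᶠ x : ℝ in atTop, C * x ^ γ ≤ Real.exp (b * x) := by
  have h := (isLittleO_rpow_exp_pos_mul_atTop γ hb).bound (c := (|C| + 1)⁻¹) (by positivity)
  filter_upwards [h, eventually_ge_atTop 0] with x hx hx0
  rw [Real.norm_eq_abs, Real.norm_eq_abs, Real.abs_exp, abs_of_nonneg (by positivity),
    inv_mul_eq_div, le_div_iff₀ (by positivity)] at hx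
  have h1 : 0 ≤ x ^ γ := by positivity
  have h2 : C * x ^ γ ≤ (|C| + 1) * x ^ γ := by
    gcongr
    linarith [le_abs_self C]
  linarith

lemma one_le_growth {A : ℝ} (hA : 0 ≤ A) {y : ℝ} (hy : Real.exp 1 ≤ y) : 1 ≤ growth A y :=
  (Real.one_le_rpow ((Real.one_le_exp zero_le_one).trans hy) hA).trans (rpow_le_growth A hy)

lemma growth_le_rpow (A : ℝ) {y : ℝ} (hy : Real.exp 1 ≤ y) : growth A y ≤ y ^ (A + 1) := by
  have h0 : 0 < y := (Real.exp_pos 1).trans_le hy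
  refine (growth_le A hy).trans ?_
  rw [Real.rpow_add_one h0.ne']
  gcongr
  exact (Real.log_le_sub_one_of_pos h0).trans (by linarith)

lemma log_growth_le {A : ℝ} (hA : 0 ≤ A) {y : ℝ} (hy : Real.exp 1 ≤ y) :
    Real.log (growth A y) ≤ (A + 1) * Real.log y := by
  have h0 : 0 < y := (Real.exp_pos 1).trans_le hy
  rw [← Real.log_rpow h0]
  exact Real.log_le_log (zero_lt_one.trans_le (one_le_growth hA hy)) (growth_le_rpow A hy)

lemma mul_log_le_log_growth (A : ℝ) {y : ℝ} (hy : Real.exp 1 ≤ y) :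
    A * Real.log y ≤ Real.log (growth A y) := by
  have h0 : 0 < y := (Real.exp_pos 1).trans_le hy
  rw [← Real.log_rpow h0]
  exact Real.log_le_log (by positivity) (rpow_le_growth A hy)

lemma le_mul_exp_neg_of_mainTerm_le {α A ξ l T : ℝ} (hα : 0 < α) (hA : 0 ≤ A)
    (hl : 0 < l) (h : mainTerm α A ξ ≤ mainTerm α A l - α * T * l ^ (A - 1)) :
    ξ ≤ l * Real.exp (-(T / l)) := by
  have hpos : 0 < l * Real.exp (-(T / l)) := by positivity
  have hT : α * T * l ^ (A - 1) = α * (T / l) * l ^ A := by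
    rw [Real.rpow_sub_one hl.ne']
    field_simp
  rw [hT] at h
  by_contra hlt
  push Not at hlt
  unfold mainTerm at h
  split_ifs at h with hA0
  · have h1 := Real.log_lt_log hpos hlt
    rw [Real.log_mul hl.ne' (Real.exp_pos _).ne', Real.log_exp] at h1
    rw [hA0, Real.rpow_zero] at h
    have := mul_lt_mul_of_pos_left h1 hα
    linarith
  · have hA1 : 0 < A := lt_of_le_of_ne hA (Ne.symm hA0)
    have h1 := Real.rpow_lt_rpow hpos.le hlt hA1
    rw [Real.mul_rpow hl.le (Real.exp_pos _).le, ← Real.exp_mul] at h1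
    have h2 : 1 - A * (T / l) ≤ Real.exp (-(T / l) * A) := by
      have := Real.add_one_le_exp (-(T / l) * A)
      linarith
    have h3 : l ^ A * (1 - A * (T / l)) ≤ l ^ A * Real.exp (-(T / l) * A) := by gcongr
    have h4 := mul_lt_mul_of_pos_left (h3.trans_lt h1) (show 0 < α / A by positivity)
    have h5 : α / A * (l ^ A * (1 - A * (T / l))) = α / A * l ^ A - α * (T / l) * l ^ A := by
      field_simp
    linarith

lemma mul_one_add_log_div_le {V H : ℝ} (hV : 0 < V) (hH : 0 < H) :
    V * (1 + Real.log (H / V)) ≤ H := by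
  have h := Real.log_le_sub_one_of_pos (show 0 < H / V by positivity)
  calc V * (1 + Real.log (H / V)) ≤ V * (H / V) := by gcongr; linarith
    _ = H := by field_simp

/-- The two alternatives for a point `ξ` lying below `l` in the sense of `mainTerm`. -/
lemma sub_ge_of_le_mul_exp_neg {ξ l T : ℝ} (hl : 0 < l) (hT : 0 ≤ T) (hξ : l / 3 ≤ ξ)
    (h : ξ ≤ l * Real.exp (-(T / l))) : T / 3 ≤ l - ξ ∧ (T ^ 2 ≤ l → T - 1 ≤ l - ξ) := by
  have hp : 0 ≤ T / l := by positivity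
  have h1 : Real.exp (-(T / l)) ≤ l / (l + T) := by
    rw [Real.exp_neg, inv_le_comm₀ (Real.exp_pos _) (by positivity), inv_div]
    calc (l + T) / l = T / l + 1 := by field_simp; ring
      _ ≤ _ := Real.add_one_le_exp _
  have h2 : ξ ≤ l * (l / (l + T)) := h.trans (by gcongr)
  have hlT : 0 < l + T := by positivity
  rw [mul_div_assoc', le_div_iff₀ hlT] at h2
  have h3 : T ≤ 2 * l := by nlinarith
  constructor
  · nlinarith
  · intro hTl
    nlinarith

namespace IsRegularSequence

variable {q : ℕ → ℝ} {α β A B : ℝ}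

lemma log_count_le (hq : IsRegularSequence q α β A B) : ∃ C y₀ : ℝ, ∀ y l : ℝ, y₀ ≤ y →
    Real.exp l ≤ count q (Real.exp y) → l ≤ y + (A - 1) * Real.log y + C := by
  obtain ⟨K, hK, h⟩ := hq.count_le
  obtain ⟨x₀, hx₀⟩ := eventually_atTop.1 h
  obtain ⟨y₁, hy₁⟩ := eventually_atTop.1 (Real.tendsto_exp_atTop.eventually_ge_atTop x₀)
  refine ⟨Real.log K, max y₁ 1, fun y l hy hl => ?_⟩
  have hy0 : 0 < y := by linarith [(le_max_right y₁ 1).trans hy]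
  have h1 := hx₀ _ (hy₁ y ((le_max_left _ _).trans hy))
  rw [Real.log_exp] at h1
  have h2 := hl.trans h1
  rw [← Real.le_log_iff_exp_le (by positivity), Real.log_mul (by positivity) (by positivity),
    Real.log_mul (by positivity) (by positivity), Real.log_exp, Real.log_rpow hy0] at h2
  linarith

lemma range_upper (hq : IsRegularSequence q α β A B) (K : ℝ) :
    ∃ M l₀ : ℝ, 0 ≤ M ∧ ∀ Θ G V ζ l : ℝ, 0 ≤ Θ → 0 ≤ G → l₀ ≤ l → l / 2 ≤ ζ →
      |V - (mainTerm α A ζ - α * Real.log β * ζ ^ (A - 1) + harmonicConst q α β A)| ≤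
        K * (ζ ^ (A - 2) + ζ ^ (A - B)) →
      V ≤ mainTerm α A l + harmonicConst q α β A - (α * G + Θ) * l ^ (A - 1) →
      (G + Θ / α) / 3 ≤ l + M - ζ ∧ ((G + Θ / α) ^ 2 ≤ l → G + Θ / α - 1 ≤ l + M - ζ) := by
  obtain ⟨K₁, hK₁, hmain⟩ := abs_mainTerm_add_sub_le α A
  have hα := hq.alpha_pos
  have hB := hq.one_lt_B
  set K' := α * |Real.log β| + 2 * |K| with hK'
  have hK'0 : 0 ≤ K' := by positivity
  set M := (K' + 1) / α with hM
  have hM0 : 0 < M := by positivity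
  refine ⟨M, 6 * M + 2 + 2 * (K₁ * M ^ 2), hM0.le, fun Θ G V ζ l hΘ hG hl hζ hV hVR => ?_⟩
  have hKM : 0 ≤ K₁ * M ^ 2 := by positivity
  have hl0 : 0 < l := by linarith
  have hζ1 : 1 ≤ ζ := by linarith
  have hζ0 : 0 < ζ := by linarith
  set T := G + Θ / α with hT
  have hT0 : 0 ≤ T := by positivity
  have hp : 0 < ζ ^ (A - 1) := by positivity
  have e1 : ζ ^ (A - 2) ≤ ζ ^ (A - 1) := Real.rpow_le_rpow_of_exponent_le hζ1 (by linarith)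
  have e2 : ζ ^ (A - B) ≤ ζ ^ (A - 1) := Real.rpow_le_rpow_of_exponent_le hζ1 (by linarith)
  have e3 : K * (ζ ^ (A - 2) + ζ ^ (A - B)) ≤ 2 * |K| * ζ ^ (A - 1) := by
    calc K * (ζ ^ (A - 2) + ζ ^ (A - B)) ≤ |K| * (ζ ^ (A - 1) + ζ ^ (A - 1)) := by
          gcongr
          exact le_abs_self K
      _ = _ := by ring
  have e4 : α * Real.log β * ζ ^ (A - 1) ≤ α * |Real.log β| * ζ ^ (A - 1) := by
    gcongr
    exact le_abs_self _
  have e5 := hmain ζ (-M) hζ0 (by rw [abs_neg, abs_of_pos hM0]; linarith)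
  have e6 : K₁ * ((-M) ^ 2 * ζ ^ (A - 2)) ≤ ζ ^ (A - 1) := by
    have : ζ ^ (A - 1) = ζ ^ (A - 2) * ζ := by
      rw [← Real.rpow_add_one hζ0.ne']
      congr 1
      ring
    rw [this, neg_sq, ← mul_assoc, mul_comm]
    gcongr
    linarith
  have e7 : α * -M * ζ ^ (A - 1) = -(K' + 1) * ζ ^ (A - 1) := by
    rw [hM]
    field_simp
  have e8 : mainTerm α A (ζ + -M) ≤ mainTerm α A l - α * T * l ^ (A - 1) := by
    have e9 : α * T = α * G + Θ := by
      rw [hT]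
      field_simp
    rw [e9]
    have := (abs_le.1 hV).1
    have := (abs_le.1 e5).2
    rw [e7] at this
    have e10 : K' * ζ ^ (A - 1) = α * |Real.log β| * ζ ^ (A - 1) + 2 * |K| * ζ ^ (A - 1) := by
      rw [hK']; ring
    linarith
  have e9 := le_mul_exp_neg_of_mainTerm_le hα hq.A_nonneg hl0 e8
  have e10 := sub_ge_of_le_mul_exp_neg hl0 hT0 (by linarith) e9
  constructor
  · linarith [e10.1]
  · intro h
    linarith [e10.2 h]

end IsRegularSequence

lemma eventually_log_le_mul (C : ℝ) {b : ℝ} (hb : 0 < b) :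
    ∀ᶠ x : ℝ in atTop, C * Real.log x ≤ b * x := by
  have h := Real.isLittleO_log_id_atTop.bound (c := b / (|C| + 1)) (by positivity)
  filter_upwards [h, eventually_ge_atTop 1] with x hx hx1
  have h1 := Real.log_nonneg hx1
  rw [Real.norm_of_nonneg h1, id, Real.norm_of_nonneg (by linarith), div_mul_eq_mul_div,
    le_div_iff₀ (by positivity)] at hx
  have h2 : C * Real.log x ≤ (|C| + 1) * Real.log x := by
    gcongr
    linarith [le_abs_self C]
  linarith

lemma eventually_log_sq_le_mul (C : ℝ) {b : ℝ} (hb : 0 < b) :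
    ∀ᶠ x : ℝ in atTop, C * Real.log x ^ 2 ≤ b * x := by
  have h := (Real.isLittleO_pow_log_id_atTop (n := 2)).bound (c := b / (|C| + 1)) (by positivity)
  filter_upwards [h, eventually_ge_atTop 1] with x hx hx1
  rw [Real.norm_of_nonneg (by positivity), id, Real.norm_of_nonneg (by linarith),
    div_mul_eq_mul_div, le_div_iff₀ (by positivity)] at hx
  have h2 : C * Real.log x ^ 2 ≤ (|C| + 1) * Real.log x ^ 2 := by
    gcongr
    linarith [le_abs_self C]
  linarith

lemma rangeBound_eq (q : ℕ → ℝ) (α β A Θ L : ℝ) {Q : ℝ} (hQ : 0 < Real.log Q) :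
    rangeBound q α β A Θ L Q = mainTerm α A (Real.log L) + harmonicConst q α β A -
      (α * Real.log (growth A (Real.log Q)) + Θ) * Real.log L ^ (A - 1) := by
  unfold rangeBound mainTerm growth
  split_ifs with h
  · rw [h, zero_sub, Real.rpow_neg_one, div_eq_mul_inv]
  · rw [Real.log_rpow hQ]
    ring

namespace IsRegularSequence

variable {q : ℕ → ℝ} {α β A B : ℝ}

theorem range_spec (hq : IsRegularSequence q α β A B) (K : ℝ) {D : ℝ} (hD : 0 < D) :
    ∃ Θ l₀ y₀ : ℝ, 0 < Θ ∧ ∀ y l ζ V : ℝ, y₀ ≤ y → l₀ ≤ l →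
      Real.exp l ≤ count q (Real.exp y) → 1 ≤ ζ → 1 ≤ V → harmonicConst q α β A ≤ V →
      (∀ σ, ζ < σ → V ≤ harmonicSum q (Real.exp σ)) →
      |V - (mainTerm α A ζ - α * Real.log β * ζ ^ (A - 1) + harmonicConst q α β A)| ≤
        K * (ζ ^ (A - 2) + ζ ^ (A - B)) →
      V ≤ mainTerm α A l + harmonicConst q α β A -
        (α * Real.log (growth A y) + Θ) * l ^ (A - 1) →
      ζ + Real.log ζ + D ≤ y ∧ V ≤ harmonicSum q (Real.exp y) ∧
      D * (Real.exp ζ * (V * (1 + Real.log (harmonicSum q (Real.exp y) / V)))) ≤ Real.exp l := by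
  obtain ⟨c₂, K₂, σ₂, hc₂, hK₂, hgrow⟩ := hq.harmonicSum_growth
  obtain ⟨C₁, y₁, hcount⟩ := hq.log_count_le
  obtain ⟨M, l₁, hM, hup⟩ := hq.range_upper K
  have hα := hq.alpha_pos
  have hA := hq.A_nonneg
  set a := if A = 0 then α else α / A with ha
  have ha0 : 0 < a := by
    rw [ha]
    split_ifs with h
    · exact hα
    · have : 0 < A := lt_of_le_of_ne hA (Ne.symm h)
      positivity
  set t := |C₁| + M + 1 + D + |Real.log (D * K₂)| with ht
  have ht0 : 0 < t := by positivity
  set E₁ := D * K₂ * 2 ^ (A + 1) * (1 + |Real.log K₂| + a / α) with hE₁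
  set E₂ := D * Real.exp M * K₂ * 2 ^ (A + 1) * (2 + |Real.log K₂|) with hE₂
  obtain ⟨T₀, hT₀⟩ := eventually_atTop.1
    (eventually_mul_rpow_le_exp E₂ (2 * (A + 1) + 1) (b := 1 / 3) (by norm_num))
  obtain ⟨l₂, hl₂⟩ := eventually_atTop.1 (((eventually_mul_rpow_le_exp E₁ (A + 3) (b := 1 / 2)
    (by norm_num)).and (eventually_log_le_mul 1 (b := 1 / 8) (by norm_num))).and
    ((eventually_ge_atTop (8 * D)).and (eventually_ge_atTop (max l₁ (M + 1)))))
  obtain ⟨y₂, hy₂⟩ := eventually_atTop.1 ((((eventually_log_le_mul (A - 1) (b := 1 / 6)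
    (by norm_num)).and (eventually_ge_atTop (6 * C₁))).and
    ((eventually_log_sq_le_mul (4 * (A + 1) ^ 2) (b := 1 / 2) (by norm_num)).and
    (eventually_ge_atTop (2 * (4 * t ^ 2 + 2 * M + D))))).and
    ((eventually_ge_atTop (max y₁ σ₂)).and (eventually_ge_atTop (Real.exp 1))))
  set T₁ := max T₀ 1 with hT₁
  refine ⟨α * t, max (max l₂ (Real.exp 1)) (max (T₁ ^ 2) σ₂), y₂, by positivity,
    fun y l ζ V hy hl hcnt hζ1 hV1 hVC hVH hVζ hVR => ?_⟩
  have hll : l₂ ≤ l := (le_max_left _ _).trans ((le_max_left _ _).trans hl)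
  have hle : Real.exp 1 ≤ l := (le_max_right _ _).trans ((le_max_left _ _).trans hl)
  have hlT : T₁ ^ 2 ≤ l := (le_max_left _ _).trans ((le_max_right _ _).trans hl)
  have hlσ : σ₂ ≤ l := (le_max_right _ _).trans ((le_max_right _ _).trans hl)
  obtain ⟨⟨l1, l2⟩, l3, l4⟩ := hl₂ l hll
  obtain ⟨⟨⟨y1, y2⟩, y3, y4⟩, y5, y6⟩ := hy₂ y hy
  have l5 : l₁ ≤ l := (le_max_left _ _).trans l4
  have l6 : M + 1 ≤ l := (le_max_right _ _).trans l4
  have y7 : y₁ ≤ y := (le_max_left _ _).trans y5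
  have y8 : σ₂ ≤ y := (le_max_right _ _).trans y5
  have hl1 : 1 ≤ l := (Real.one_le_exp zero_le_one).trans hle
  have hl0 : 0 < l := by linarith
  have hy1 : 1 ≤ y := (Real.one_le_exp zero_le_one).trans y6
  have hy0 : 0 < y := by linarith
  have hζ0 : 0 < ζ := by linarith
  have hV0 : 0 < V := by linarith
  set J := growth A y with hJ
  have hJ1 : 1 ≤ J := one_le_growth hA y6
  set G := Real.log J with hG
  have hG0 : 0 ≤ G := Real.log_nonneg hJ1
  have hGJ : Real.exp G = J := Real.exp_log (by linarith)
  have hGy : G ≤ (A + 1) * Real.log y := log_growth_le hA y6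
  have hGy' : A * Real.log y ≤ G := mul_log_le_log_growth A y6
  have hlogy : 0 ≤ Real.log y := Real.log_nonneg hy1
  have hcnt' := hcount y l y7 hcnt
  have hΘ : α * t / α = t := by field_simp
  set T := G + t with hT
  have hGl : G ≤ a / α * l ^ 2 := by
    have h1 : (α * G + α * t) * l ^ (A - 1) ≤ mainTerm α A l := by linarith
    rw [mainTerm_eq_growth, ← ha] at h1
    have h2 : growth A l ≤ l ^ (A - 1) * l ^ 2 := by
      refine (growth_le_rpow A hle).trans_eq ?_
      rw [← Real.rpow_natCast l 2, ← Real.rpow_add hl0]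
      congr 1
      push_cast
      ring
    have hp : 0 < l ^ (A - 1) := by positivity
    have h3 : l ^ (A - 1) * (α * G) ≤ l ^ (A - 1) * (a * l ^ 2) := by
      have h4 : 0 ≤ α * t * l ^ (A - 1) := by positivity
      have h5 : a * growth A l ≤ a * (l ^ (A - 1) * l ^ 2) := by gcongr
      linarith
    have h4 := le_of_mul_le_mul_left h3 hp
    rw [div_mul_eq_mul_div, le_div_iff₀ hα]
    linarith
  have hcases : ζ ≤ l / 2 ∨ (T / 3 ≤ l + M - ζ ∧ (T ^ 2 ≤ l → T - 1 ≤ l + M - ζ)) := by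
    rcases le_or_gt ζ (l / 2) with h | h
    · exact Or.inl h
    · have := hup (α * t) G V ζ l (by positivity) hG0 l5 h.le hVζ hVR
      rw [hΘ] at this
      exact Or.inr this
  have hT0 : 0 ≤ T := by positivity
  have hζ2 : ζ < 2 * l := by
    rcases hcases with h | h
    · linarith
    · linarith [h.1]
  have hVl : V ≤ K₂ * (2 ^ (A + 1) * l ^ (A + 1)) := by
    refine (hVH _ hζ2).trans ((hgrow (2 * l) (by linarith)).2.trans ?_)
    rw [← Real.mul_rpow (by norm_num) hl0.le]
    gcongr
    exact growth_le_rpow A (by linarith)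
  have concl : ζ + Real.log ζ + D ≤ y := by
    have hlogζ : Real.log ζ ≤ ζ := (Real.log_le_sub_one_of_pos hζ0).trans (by linarith)
    rcases hcases with h | ⟨h1, h2⟩
    · have : Real.log ζ ≤ Real.log l := Real.log_le_log hζ0 (by linarith)
      linarith
    · rcases le_or_gt (T ^ 2) l with h | h
      · have h3 := h2 h
        have h4 : C₁ + M + 1 + D ≤ t := by
          rw [ht]
          linarith [le_abs_self C₁, abs_nonneg (Real.log (D * K₂))]
        have h5 : Real.log ζ ≤ Real.log y := Real.log_le_log hζ0 (by linarith)
        linarith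
      · have h3 : T ≤ (A + 1) * Real.log y + t := by linarith
        have h4 : T ^ 2 ≤ 2 * ((A + 1) ^ 2 * Real.log y ^ 2) + 2 * t ^ 2 := by
          have := pow_le_pow_left₀ hT0 h3 2
          have := sq_nonneg ((A + 1) * Real.log y - t)
          linarith
        linarith
  have hVy : V ≤ harmonicSum q (Real.exp y) := by
    have := Real.log_nonneg hζ1
    exact hVH y (by linarith)
  refine ⟨concl, hVy, ?_⟩
  set H := harmonicSum q (Real.exp y) with hH
  have hH0 : 0 < H := by linarith
  have hHJ : H ≤ K₂ * J := (hgrow y y8).2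
  have hlogH : Real.log (H / V) ≤ |Real.log K₂| + G := by
    have h1 : H / V ≤ K₂ * J := (div_le_self hH0.le hV1).trans hHJ
    have h2 := Real.log_le_log (by positivity) h1
    rw [Real.log_mul hK₂.ne' (by linarith)] at h2
    linarith [le_abs_self (Real.log K₂)]
  have hlogH0 : 0 ≤ Real.log (H / V) := Real.log_nonneg (by rwa [one_le_div₀ hV0])
  have hbd : V * (1 + Real.log (H / V)) ≤
      K₂ * (2 ^ (A + 1) * l ^ (A + 1)) * (1 + |Real.log K₂| + G) := by
    apply mul_le_mul hVl (by linarith) (by linarith) (by positivity)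
  have hS0 : 0 ≤ V * (1 + Real.log (H / V)) := by positivity
  have hSH : V * (1 + Real.log (H / V)) ≤ K₂ * J := (mul_one_add_log_div_le hV0 hH0).trans hHJ
  generalize V * (1 + Real.log (H / V)) = S at *
  rcases hcases with h | ⟨h1, h2⟩
  · calc D * (Real.exp ζ * S)
        ≤ D * (Real.exp (l / 2) * (K₂ * (2 ^ (A + 1) * l ^ (A + 1)) *
          (1 + |Real.log K₂| + a / α * l ^ 2))) := by
          gcongr
          refine hbd.trans ?_
          gcongr
      _ ≤ D * (Real.exp (l / 2) * (K₂ * (2 ^ (A + 1) * l ^ (A + 1)) *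
          ((1 + |Real.log K₂| + a / α) * l ^ 2))) := by
          gcongr
          have : 1 ≤ l ^ 2 := one_le_pow₀ hl1
          have h3 : (1 + |Real.log K₂|) * 1 ≤ (1 + |Real.log K₂|) * l ^ 2 := by gcongr
          linarith
      _ = Real.exp (l / 2) * (E₁ * l ^ (A + 3)) := by
          have : l ^ (A + 3) = l ^ (A + 1) * l ^ 2 := by
            rw [← Real.rpow_natCast l 2, ← Real.rpow_add hl0]
            congr 1
            push_cast
            ring
          rw [this, hE₁]
          ring
      _ ≤ Real.exp (l / 2) * Real.exp (1 / 2 * l) := by gcongr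
      _ = Real.exp l := by rw [← Real.exp_add]; ring_nf
  · rcases le_or_gt (T ^ 2) l with h | h
    · have h3 := h2 h
      calc D * (Real.exp ζ * S)
          ≤ D * (Real.exp (l + M - (T - 1)) * (K₂ * Real.exp G)) := by
            rw [hGJ]
            gcongr
            linarith
        _ = Real.exp (l + M - (T - 1) + G + Real.log (D * K₂)) := by
            rw [Real.exp_add _ (Real.log (D * K₂)), Real.exp_log (x := D * K₂) (by positivity),
              Real.exp_add _ G]
            ring
        _ ≤ Real.exp l := by
            apply Real.exp_le_exp.2
            linarith [abs_nonneg C₁, le_abs_self (Real.log (D * K₂))]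
    · have hT1 : T₁ ≤ T := by
        have h0 : 0 ≤ T₁ := zero_le_one.trans (le_max_right _ _)
        exact le_of_lt ((sq_lt_sq₀ h0 hT0).1 (hlT.trans_lt h))
      have hT2 : 1 ≤ T := (le_max_right _ _).trans hT1
      have hT3 := hT₀ T ((le_max_left _ _).trans hT1)
      have hTpos : 0 < T := by linarith
      calc D * (Real.exp ζ * S)
          ≤ D * (Real.exp (l + M - T / 3) * (K₂ * (2 ^ (A + 1) * (T ^ 2) ^ (A + 1)) *
            ((2 + |Real.log K₂|) * T))) := by
            have h4 : 1 + |Real.log K₂| + G ≤ (2 + |Real.log K₂|) * T := by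
              have : (1 + |Real.log K₂|) * 1 ≤ (1 + |Real.log K₂|) * T := by gcongr
              linarith
            gcongr
            · linarith
            · refine hbd.trans ?_
              gcongr
        _ = Real.exp (l - T / 3) * (E₂ * T ^ (2 * (A + 1) + 1)) := by
            have : T ^ (2 * (A + 1) + 1) = (T ^ 2) ^ (A + 1) * T := by
              rw [Real.rpow_add_one hTpos.ne', Real.rpow_mul hT0, Real.rpow_two]
            rw [this, hE₂, show l + M - T / 3 = l - T / 3 + M by ring, Real.exp_add]
            ring
        _ ≤ Real.exp (l - T / 3) * Real.exp (1 / 3 * T) := by gcongr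
        _ = Real.exp l := by rw [← Real.exp_add]; ring_nf

lemma le_log_of_le_rangeBound (hq : IsRegularSequence q α β A B) {l₀ : ℝ} (hl₀ : 1 ≤ l₀) :
    ∃ c : ℝ, ∀ Θ L Q : ℝ, 0 ≤ Θ → 1 ≤ L → Real.exp 1 ≤ Real.log Q →
      c ≤ rangeBound q α β A Θ L Q → l₀ ≤ Real.log L := by
  have hα := hq.alpha_pos
  have hA := hq.A_nonneg
  refine ⟨mainTerm α A l₀ + harmonicConst q α β A + 1, fun Θ L Q hΘ hL hQ h => ?_⟩
  have hlog : 0 ≤ Real.log L := Real.log_nonneg hL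
  rw [rangeBound_eq q α β A Θ L ((Real.exp_pos 1).trans_le hQ)] at h
  have h1 : 0 ≤ (α * Real.log (growth A (Real.log Q)) + Θ) * Real.log L ^ (A - 1) := by
    have := Real.log_nonneg (one_le_growth hA hQ)
    positivity
  by_contra hlt
  push Not at hlt
  have h2 : mainTerm α A (Real.log L) ≤ mainTerm α A l₀ := by
    unfold mainTerm
    split_ifs with hA0
    · rcases hlog.eq_or_lt with h0 | h0
      · rw [← h0, Real.log_zero, mul_zero]
        have := Real.log_nonneg hl₀
        positivity
      · have := Real.log_le_log h0 hlt.le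
        gcongr
    · gcongr
  linarith

end IsRegularSequence

/-! ### The exponential moments near the saddle point -/

lemma eventually_errSize_le (A B : ℝ) : ∃ K σ₀ : ℝ, 0 < K ∧ ∀ σ ζ : ℝ, σ₀ ≤ ζ → |σ - ζ| ≤ ζ / 2 →
    errSize A B σ ≤ K * errSize A B ζ := by
  set K₁ := ((1 / 2 : ℝ) ^ (A - 2) + (3 / 2) ^ (A - 2)) with hK₁
  set K₂ := ((1 / 2 : ℝ) ^ (A - B) + (3 / 2) ^ (A - B)) with hK₂
  refine ⟨K₁ * 2 + K₂, 2, by positivity, fun σ ζ hζ h => ?_⟩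
  have hζ0 : 0 < ζ := by linarith
  have hlog : 0 ≤ Real.log ζ := Real.log_nonneg (by linarith)
  rw [abs_le] at h
  have h1 : 1 / 2 * ζ ≤ σ := by linarith
  have h2 : σ ≤ 3 / 2 * ζ := by linarith
  have hσ0 : 0 < σ := by linarith
  have e1 : σ ^ (A - 2) ≤ K₁ * ζ ^ (A - 2) := rpow_le_of_comparable (by norm_num) hζ0 h1 h2
  have e2 : σ ^ (A - B) ≤ K₂ * ζ ^ (A - B) := rpow_le_of_comparable (by norm_num) hζ0 h1 h2
  have e3 : Real.log σ ≤ 2 * Real.log ζ := by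
    have : Real.log σ ≤ Real.log (ζ * ζ) := Real.log_le_log hσ0 (by nlinarith)
    rw [Real.log_mul hζ0.ne' hζ0.ne'] at this
    linarith
  unfold errSize
  have p1 : 0 ≤ ζ ^ (A - 2) := by positivity
  have p2 : 0 ≤ ζ ^ (A - B) := by positivity
  have p3 : 0 ≤ K₁ := by positivity
  have p4 : 0 ≤ K₂ := by positivity
  calc σ ^ (A - 2) * Real.log σ + σ ^ (A - B)
      ≤ K₁ * ζ ^ (A - 2) * (2 * Real.log ζ) + K₂ * ζ ^ (A - B) := by
        have p5 : 0 ≤ σ ^ (A - 2) := by positivity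
        calc _ ≤ σ ^ (A - 2) * (2 * Real.log ζ) + K₂ * ζ ^ (A - B) := by gcongr
          _ ≤ _ := by gcongr
    _ ≤ _ := by
        have q1 : 0 ≤ K₁ * 2 * ζ ^ (A - B) := by positivity
        have q2 : 0 ≤ K₂ * (ζ ^ (A - 2) * Real.log ζ) := by positivity
        linarith

lemma tendsto_errTerm {B : ℝ} (hB : 1 < B) :
    Tendsto (fun ζ => errTerm B (Real.exp ζ)) atTop (𝓝 0) := by
  have h1 : Tendsto (fun ζ : ℝ => Real.log ζ / ζ) atTop (𝓝 0) :=
    Real.isLittleO_log_id_atTop.tendsto_div_nhds_zero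
  have h2 : Tendsto (fun ζ : ℝ => 1 / ζ ^ (B - 1)) atTop (𝓝 0) :=
    (tendsto_rpow_atTop (by linarith)).const_div_atTop 1
  have h3 := h1.add h2
  rw [add_zero] at h3
  refine h3.congr fun ζ => ?_
  rw [errTerm, Real.log_exp]

lemma inv_le_errTerm (B : ℝ) {ζ : ℝ} (hζ : Real.exp 1 ≤ ζ) : ζ⁻¹ ≤ errTerm B (Real.exp ζ) := by
  have h0 : 0 < ζ := (Real.exp_pos 1).trans_le hζ
  rw [errTerm, Real.log_exp]
  have h1 : 1 ≤ Real.log ζ := by rwa [Real.le_log_iff_exp_le h0]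
  have h2 : 0 ≤ 1 / ζ ^ (B - 1) := by positivity
  have h3 : ζ⁻¹ ≤ Real.log ζ / ζ := by
    rw [inv_eq_one_div]
    gcongr
  linarith

namespace IsRegularSequence

variable {q : ℕ → ℝ} {α β A B : ℝ}

lemma abs_harmonicSum_sub_le (hq : IsRegularSequence q α β A B) {K : ℝ} (hK : 0 ≤ K) (a : ℝ) :
    ∃ K' σ₀ : ℝ, 0 ≤ K' ∧ ∀ ζ V w : ℝ, σ₀ ≤ ζ →
      |V - (mainTerm α A ζ - α * Real.log β * ζ ^ (A - 1) + harmonicConst q α β A)| ≤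
        K * (ζ ^ (A - 2) + ζ ^ (A - B)) → |w| ≤ a →
      |harmonicSum q (Real.exp (ζ + w)) - (V + α * w * ζ ^ (A - 1))| ≤ K' * errSize A B ζ := by
  obtain ⟨K₁, σ₁, hK₁, hσ₁, h⟩ := hq.harmonicSum_local
  refine ⟨K₁ * (1 + a ^ 2) + K, max (max σ₁ (Real.exp 1)) (2 * a), by positivity,
    fun ζ V w hζ hV hw => ?_⟩
  have h1 : σ₁ ≤ ζ := (le_max_left _ _).trans ((le_max_left _ _).trans hζ)
  have h2 : Real.exp 1 ≤ ζ := (le_max_right _ _).trans ((le_max_left _ _).trans hζ)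
  have h3 : 2 * a ≤ ζ := (le_max_right _ _).trans hζ
  have hζ0 : 0 < ζ := (Real.exp_pos 1).trans_le h2
  have e1 := h ζ w h1 (by linarith)
  have hw2 : w ^ 2 ≤ a ^ 2 := sq_le_sq' (by linarith [(abs_le.1 hw).1]) (abs_le.1 hw).2
  have e2 := rpow_add_rpow_le_errSize A B h2
  have p1 : 0 ≤ ζ ^ (A - 2) := by positivity
  have p2 : 0 ≤ ζ ^ (A - B) := by positivity
  have e3 : K₁ * ((1 + w ^ 2) * ζ ^ (A - 2) + ζ ^ (A - B)) ≤
      K₁ * (1 + a ^ 2) * errSize A B ζ := by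
    rw [mul_assoc]
    gcongr
    calc (1 + w ^ 2) * ζ ^ (A - 2) + ζ ^ (A - B)
        ≤ (1 + a ^ 2) * ζ ^ (A - 2) + (1 + a ^ 2) * ζ ^ (A - B) := by
          gcongr
          exact le_mul_of_one_le_left p2 (by linarith [sq_nonneg a])
      _ = (1 + a ^ 2) * (ζ ^ (A - 2) + ζ ^ (A - B)) := by ring
      _ ≤ _ := by gcongr
  have e4 : K * (ζ ^ (A - 2) + ζ ^ (A - B)) ≤ K * errSize A B ζ := by gcongr
  rw [abs_le] at e1 hV ⊢
  constructor <;> linarith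

lemma eventually_harmonicSum_le_two_mul (hq : IsRegularSequence q α β A B) {K : ℝ} (hK : 0 ≤ K)
    (a : ℝ) : ∃ σ₀ : ℝ, ∀ ζ V : ℝ, σ₀ ≤ ζ →
      |V - (mainTerm α A ζ - α * Real.log β * ζ ^ (A - 1) + harmonicConst q α β A)| ≤
        K * (ζ ^ (A - 2) + ζ ^ (A - B)) →
      4 * (α * ζ ^ (A - 1)) ≤ V ∧ ∀ w, |w| ≤ a → harmonicSum q (Real.exp (ζ + w)) ≤ 2 * V := by
  obtain ⟨K', σ₁, hK', h⟩ := hq.abs_harmonicSum_sub_le hK |a|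
  have hα := hq.alpha_pos
  obtain ⟨σ₂, h₂⟩ := eventually_atTop.1
    (((hq.eventually_mul_rpow_le_harmonicSum (4 * α + 2 * K' + α * |a|)).and
    ((tendsto_errTerm hq.one_lt_B).eventually (ge_mem_nhds zero_lt_one))).and
    (eventually_ge_atTop 1))
  refine ⟨max σ₁ σ₂, fun ζ V hζ hV => ?_⟩
  obtain ⟨⟨h3, h4⟩, h5⟩ := h₂ ζ ((le_max_right _ _).trans hζ)
  have h1 : σ₁ ≤ ζ := (le_max_left _ _).trans hζ
  have hζ0 : 0 < ζ := by linarith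
  have p : 0 < ζ ^ (A - 1) := by positivity
  have he : errSize A B ζ ≤ ζ ^ (A - 1) := by
    rw [errSize_eq A B hζ0]
    exact mul_le_of_le_one_right p.le h4
  have he' : K' * errSize A B ζ ≤ K' * ζ ^ (A - 1) := by gcongr
  have e0 := h ζ V 0 h1 hV (by rw [abs_zero]; positivity)
  rw [add_zero, mul_zero, zero_mul, add_zero, abs_le] at e0
  have e1 : (4 * α + K' + α * |a|) * ζ ^ (A - 1) ≤ V := by linarith
  have q1 : 0 ≤ K' * ζ ^ (A - 1) := by positivity
  have q2 : 0 ≤ α * |a| * ζ ^ (A - 1) := by positivity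
  have q3 : 0 ≤ α * ζ ^ (A - 1) := by positivity
  refine ⟨by linarith, fun w hw => ?_⟩
  have hw' : |w| ≤ |a| := hw.trans (le_abs_self a)
  have e2 := (abs_le.1 (h ζ V w h1 hV hw')).2
  have e3 : α * w * ζ ^ (A - 1) ≤ α * |a| * ζ ^ (A - 1) := by
    gcongr
    exact (le_abs_self w).trans hw'
  linarith

theorem abs_cgf_weightedSum_sub_saddle_le (hq : IsRegularSequence q α β A B) {κ c : ℝ}
    (hκ : 0 < κ) (hc : 0 < c) (C : ℝ) {K a : ℝ} (hK : 0 ≤ K)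
    (ha : 4 + tailConst κ c ≤ a) :
    ∃ K' σ₀ : ℝ, 0 < K' ∧ ∀ {Ω : Type*} [MeasurableSpace Ω] {P : Measure Ω}
      [IsProbabilityMeasure P] {Y : ℕ → Ω → ℝ} {ν : Measure ℝ}, CRVH P κ c C Y ν →
      ∀ y ζ V τ : ℝ, σ₀ ≤ ζ →
      |V - (mainTerm α A ζ - α * Real.log β * ζ ^ (A - 1) + harmonicConst q α β A)| ≤
        K * (ζ ^ (A - 2) + ζ ^ (A - B)) → ζ + Real.log ζ + (a + 1) ≤ y → 0 ≤ τ → τ ≤ 2 →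
      |cgf (weightedSum q Y (Real.exp y)) P (Real.exp (ζ - eta ν - 1) * Real.exp τ) -
        Real.exp (ζ - eta ν - 1) * Real.exp τ * (V + α * ζ ^ (A - 1) * (τ - 1))| ≤
        K' * errTerm B (Real.exp ζ) * (Real.exp (ζ - eta ν - 1) * (α * ζ ^ (A - 1))) := by
  obtain ⟨K₁, σ₁, hK₁, h₁⟩ := hq.abs_cgf_weightedSum_sub_le hκ hc C
  obtain ⟨K₂, σ₂, hK₂, h₂⟩ := hq.abs_harmonicSum_sub_le hK a
  obtain ⟨K₃, hK₃, h₃⟩ := abs_rpow_add_sub_le (A - 1)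
  obtain ⟨K₄, σ₄, hK₄, h₄⟩ := eventually_errSize_le A B
  have hα := hq.alpha_pos
  have ht0 : 0 < tailConst κ c := by
    rw [tailConst]
    positivity
  have ha0 : 0 < a := by linarith
  set K₅ := K₂ + α * a * (K₃ * a) + K₁ * K₄ with hK₅
  have hK₅0 : 0 ≤ K₅ := by positivity
  refine ⟨Real.exp 2 * (K₅ / α) + 1, max (max (σ₁ + a) σ₂) (max σ₄ (max (2 * a) (Real.exp 1))),
    by positivity, fun {Ω} _ {P} _ {Y ν} hY y ζ V τ hζ hV hy hτ0 hτ2 => ?_⟩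
  have z1 : σ₁ + a ≤ ζ := (le_max_left _ _).trans ((le_max_left _ _).trans hζ)
  have z2 : σ₂ ≤ ζ := (le_max_right _ _).trans ((le_max_left _ _).trans hζ)
  have z4 : σ₄ ≤ ζ := (le_max_left _ _).trans ((le_max_right _ _).trans hζ)
  have z5 : 2 * a ≤ ζ :=
    (le_max_left _ _).trans ((le_max_right _ _).trans ((le_max_right _ _).trans hζ))
  have z6 : Real.exp 1 ≤ ζ :=
    (le_max_right _ _).trans ((le_max_right _ _).trans ((le_max_right _ _).trans hζ))
  have hζ0 : 0 < ζ := (Real.exp_pos 1).trans_le z6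
  have hprof := hY.isProfile hκ hc
  have hη : |eta ν| ≤ 3 + tailConst κ c := by
    have := hY.isProbabilityMeasure_law
    rw [eta_eq_neg_integral hprof, abs_neg]
    exact hprof.abs_integral_id_le
  set η := eta ν with hηdef
  set w := -η - 1 + τ with hw
  set σ := ζ + w with hσ
  have hwa : |w| ≤ a := by
    rw [abs_le] at hη ⊢
    constructor <;> linarith
  have hwabs := abs_le.1 hwa
  have hs : Real.exp (ζ - η - 1) * Real.exp τ = Real.exp σ := by
    rw [← Real.exp_add, hσ, hw]
    congr 1
    ring
  rw [hs]
  have hσ0 : 0 < σ := by linarith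
  have hlogσ : Real.log σ ≤ Real.log ζ + 1 := by
    have h1 : σ ≤ ζ * Real.exp 1 := by
      have := Real.add_one_le_exp (1 : ℝ)
      have : ζ * (1 + 1) ≤ ζ * Real.exp 1 := by gcongr
      linarith
    have h2 := Real.log_le_log hσ0 h1
    rwa [Real.log_mul hζ0.ne' (Real.exp_pos 1).ne', Real.log_exp] at h2
  have e1 := h₁ hY y σ (by linarith) (by linarith)
  have e2 := h₂ ζ V w z2 hV hwa
  have e3 := h₃ ζ w hζ0 (by linarith)
  rw [← hσ] at e2 e3
  have e4 := h₄ σ ζ z4 (by rw [hσ, add_sub_cancel_left]; linarith)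
  have hE := errSize_eq A B hζ0
  have e5 : ζ ^ (A - 1 - 1) ≤ errSize A B ζ := by
    have := rpow_add_rpow_le_errSize A B z6
    have : 0 ≤ ζ ^ (A - B) := by positivity
    rw [show A - 1 - 1 = A - 2 by ring]
    linarith
  have e6 : |α * η * σ ^ (A - 1) - α * η * ζ ^ (A - 1)| ≤ α * a * (K₃ * a) * errSize A B ζ := by
    rw [← mul_sub, abs_mul, abs_mul, abs_of_pos hα, mul_assoc (α * a)]
    have : K₃ * (|w| * ζ ^ (A - 1 - 1)) ≤ K₃ * a * errSize A B ζ := by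
      rw [mul_assoc]
      gcongr
    have hηa : |η| ≤ a := by linarith
    gcongr
    exact e3.trans this
  have e7 : |harmonicSum q (Real.exp σ) + α * η * σ ^ (A - 1) -
      (V + α * ζ ^ (A - 1) * (τ - 1))| ≤ (K₂ + α * a * (K₃ * a)) * errSize A B ζ := by
    have : α * ζ ^ (A - 1) * (τ - 1) = α * w * ζ ^ (A - 1) + α * η * ζ ^ (A - 1) := by
      rw [hw]; ring
    rw [this]
    rw [abs_le] at e2 e6 ⊢
    constructor <;> linarith
  have hexp := Real.exp_pos σ
  have e8 : |Real.exp σ * (harmonicSum q (Real.exp σ) + α * η * σ ^ (A - 1)) -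
      Real.exp σ * (V + α * ζ ^ (A - 1) * (τ - 1))| ≤
      Real.exp σ * ((K₂ + α * a * (K₃ * a)) * errSize A B ζ) := by
    rw [← mul_sub, abs_mul, abs_of_pos hexp]
    gcongr
  have e9 : K₁ * (Real.exp σ * errSize A B σ) ≤ Real.exp σ * (K₁ * K₄ * errSize A B ζ) := by
    calc K₁ * (Real.exp σ * errSize A B σ) ≤ K₁ * (Real.exp σ * (K₄ * errSize A B ζ)) := by gcongr
      _ = _ := by ring
  have e10 : |cgf (weightedSum q Y (Real.exp y)) P (Real.exp σ) -
      Real.exp σ * (V + α * ζ ^ (A - 1) * (τ - 1))| ≤ Real.exp σ * (K₅ * errSize A B ζ) := by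
    have : Real.exp σ * (K₅ * errSize A B ζ) =
        Real.exp σ * ((K₂ + α * a * (K₃ * a)) * errSize A B ζ) +
        Real.exp σ * (K₁ * K₄ * errSize A B ζ) := by
      rw [hK₅]; ring
    rw [this]
    rw [abs_le] at e1 e8 ⊢
    constructor <;> linarith
  refine e10.trans ?_
  have herr : 0 ≤ errTerm B (Real.exp ζ) := le_trans (by positivity) (inv_le_errTerm B z6)
  have hτexp : Real.exp τ ≤ Real.exp 2 := Real.exp_le_exp.2 hτ2
  rw [hE, ← hs]
  calc Real.exp (ζ - η - 1) * Real.exp τ * (K₅ * (ζ ^ (A - 1) * errTerm B (Real.exp ζ)))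
      ≤ Real.exp (ζ - η - 1) * Real.exp 2 * (K₅ * (ζ ^ (A - 1) * errTerm B (Real.exp ζ))) := by
        gcongr
    _ = Real.exp 2 * (K₅ / α) * errTerm B (Real.exp ζ) *
          (Real.exp (ζ - η - 1) * (α * ζ ^ (A - 1))) := by
        field_simp
    _ ≤ _ := by
        gcongr
        linarith

end IsRegularSequence

/-! ### From the moments of `X` to those of `Y` -/

section

variable {Ω Ω' : Type*} [MeasurableSpace Ω] [MeasurableSpace Ω'] {P : Measure Ω} {P' : Measure Ω'}
  [IsProbabilityMeasure P'] {q : ℕ → ℝ} {α β A B C C' L Q κ c : ℝ} {X : ℕ → Ω → ℝ}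
  {Y : ℕ → Ω' → ℝ} {ν : Measure ℝ}

omit [IsProbabilityMeasure P'] in
lemma AIH.measurable_weightedSum (h : AIH P P' q C L Q X Y) (hq : IsRegularSequence q α β A B) :
    Measurable (weightedSum q X Q) := by
  have : weightedSum q X Q = fun ω => ∑ n ∈ hq.idx Q, X n ω / q n := by
    ext ω
    exact hq.weightedSum_eq X Q ω
  rw [this]
  exact Finset.measurable_fun_sum _ fun n hn => (h.measurable_X n (hq.mem_idx.1 hn)).div_const _

lemma AIH.integral_expTrunc_bounds (h : AIH P P' q C L Q X Y) (hY : CRVH P' κ c C' Y ν)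
    (hq : IsRegularSequence q α β A B) {k : ℕ} (hk : Even k) (hkL : (k : ℝ) ≤ L) {s l M : ℝ}
    (hs : 0 ≤ s) (hl : 1 ≤ l) (h1 : cgf (weightedSum q Y Q) P' (Real.exp 1 * s) ≤ M)
    (h2 : cgf (weightedSum q Y Q) P' (-(Real.exp 1 * s)) ≤ M) (hM : M + 3 ≤ k)
    (herr : |C| * Real.exp (-L) * (l ^ k * Real.exp (s * harmonicSum q Q / l)) ≤ 1 / 8) :
    (1 / 2 * Real.exp (cgf (weightedSum q Y Q) P' s) ≤
        ∫ ω, expTrunc k (s * weightedSum q X Q ω) ∂P ∧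
      ∫ ω, expTrunc k (s * weightedSum q X Q ω) ∂P ≤
        2 * Real.exp (cgf (weightedSum q Y Q) P' s)) ∧
    ∫ ω, (s * weightedSum q X Q ω) ^ k / k.factorial ∂P ≤ 1 := by
  set W := weightedSum q Y Q with hW
  have hint : ∀ t, Integrable (fun ω => Real.exp (t * W ω)) P' :=
    fun t => (hq.integrable_exp_weightedSum hY Q t).1
  have hmgf : ∀ t, ∫ ω, Real.exp (t * W ω) ∂P' = Real.exp (cgf W P' t) :=
    fun t => (exp_cgf (hint t)).symm
  have hpowint : ∀ j ≤ k, Integrable (fun ω => W ω ^ j) P' := fun j hj =>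
    (h.moment_weightedSum hq ((Nat.cast_le.2 hj).trans hkL)).2.1
  obtain ⟨d1, d2⟩ := h.abs_expTrunc_sub_le hq hkL hs hl
  rw [abs_le] at d1 d2
  have hek : (Real.exp 1 ^ k)⁻¹ = Real.exp (-k) := by
    rw [← Real.exp_nat_mul, mul_one, Real.exp_neg]
  have hsmall : ∀ t, cgf W P' t ≤ M → Real.exp (-k) * Real.exp (cgf W P' t) ≤ 1 / 16 := by
    intro t ht
    rw [← Real.exp_add]
    have h3 : Real.exp (-(k : ℝ) + cgf W P' t) ≤ Real.exp (-3) := Real.exp_le_exp.2 (by linarith)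
    refine h3.trans ?_
    rw [Real.exp_neg, inv_le_comm₀ (Real.exp_pos _) (by norm_num)]
    have h4 : Real.exp 3 = Real.exp 1 ^ 3 := by rw [← Real.exp_nat_mul]; norm_num
    have h5 : (2.7 : ℝ) ^ 3 ≤ Real.exp 1 ^ 3 := by
      have := Real.exp_one_gt_d9
      gcongr
      linarith
    rw [h4]
    norm_num at h5 ⊢
    linarith
  have s1 := hsmall _ h1
  have s2 := hsmall _ h2
  have ipow : Integrable (fun ω => (s * W ω) ^ k / (k.factorial : ℝ)) P' := by
    have : (fun ω => (s * W ω) ^ k / (k.factorial : ℝ)) =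
        fun ω => s ^ k / k.factorial * W ω ^ k := by
      ext ω
      rw [mul_pow]
      ring
    rw [this]
    exact (hpowint k le_rfl).const_mul _
  have powY : ∫ ω, (s * W ω) ^ k / k.factorial ∂P' ≤ 1 / 8 := by
    calc _ ≤ ∫ ω, Real.exp (-k) * (Real.exp (Real.exp 1 * s * W ω) +
          Real.exp (-(Real.exp 1 * s) * W ω)) ∂P' := by
          refine integral_mono ipow (((hint _).add (hint _)).const_mul _) fun ω => ?_
          have := pow_div_factorial_le_exp hk (s * W ω) (Real.exp_pos 1)
          rw [hek, ← mul_assoc, ← neg_mul] at this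
          exact this
      _ = Real.exp (-k) * Real.exp (cgf W P' (Real.exp 1 * s)) +
          Real.exp (-k) * Real.exp (cgf W P' (-(Real.exp 1 * s))) := by
          rw [integral_const_mul, integral_add (hint _) (hint _), hmgf, hmgf, mul_add]
      _ ≤ _ := by linarith
  have upY : ∫ ω, expTrunc k (s * W ω) ∂P' ≤ Real.exp (cgf W P' s) + 1 / 8 := by
    calc _ ≤ ∫ ω, (Real.exp (s * W ω) + (s * W ω) ^ k / k.factorial) ∂P' :=
          integral_mono (integrable_expTrunc hpowint s) ((hint s).add ipow)
            fun ω => expTrunc_le hk _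
      _ ≤ _ := by
        rw [integral_add (hint s) ipow, hmgf]
        linarith
  have lowY : Real.exp (cgf W P' s) ≤ ∫ ω, expTrunc k (s * W ω) ∂P' + 1 / 8 := by
    calc _ = ∫ ω, Real.exp (s * W ω) ∂P' := (hmgf s).symm
      _ ≤ ∫ ω, (expTrunc k (s * W ω) +
          Real.exp (-k) * Real.exp (Real.exp 1 * s * W ω)) ∂P' := by
          refine integral_mono (hint s)
            ((integrable_expTrunc hpowint s).add ((hint _).const_mul _)) fun ω => ?_
          have := exp_le_expTrunc_add hk (s * W ω) (Real.one_le_exp zero_le_one)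
          rw [hek, ← mul_assoc] at this
          exact this
      _ ≤ _ := by
        rw [integral_add (integrable_expTrunc hpowint s) ((hint _).const_mul _),
          integral_const_mul, hmgf]
        linarith
  have hg : 1 ≤ Real.exp (cgf W P' s) := Real.one_le_exp (hq.one_le_mgf_weightedSum hY Q s)
  refine ⟨⟨?_, ?_⟩, ?_⟩ <;> linarith

end

end LargeDev

end

open LargeDev in
theorem theorem7p3 (q : ℕ → ℝ) (α β A B : ℝ) (hq : LargeDev.IsRegularSequence q α β A B)
    (κ c₀ C₁ C₂ : ℝ) (hκ : 0 < κ) (hc₀ : 0 < c₀) :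
    ∃ c : ℝ, 1 < c ∧ ∃ Θ : ℝ, 0 < Θ ∧ ∃ K : ℝ, 0 < K ∧ ∃ Q₀ : ℝ, ∀ Q : ℝ, Q₀ ≤ Q →
      ∀ L : ℝ, Real.log Q ^ (2 * A ^ 2) ≤ L → L ≤ (LargeDev.count q Q : ℝ) →
      ∀ (Ω : Type*) [MeasurableSpace Ω] (P : MeasureTheory.Measure Ω)
        [MeasureTheory.IsProbabilityMeasure P]
        (Ω' : Type*) [MeasurableSpace Ω'] (P' : MeasureTheory.Measure Ω')
        [MeasureTheory.IsProbabilityMeasure P']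
        (X : ℕ → Ω → ℝ) (Y : ℕ → Ω' → ℝ) (ν : MeasureTheory.Measure ℝ),
        LargeDev.AIH P P' q C₁ L Q X Y → LargeDev.CRVH P' κ c₀ C₂ Y ν →
        ∀ V : ℝ, c ≤ V → V ≤ LargeDev.rangeBound q α β A Θ L Q →
          ∃ θ : ℝ, |θ| ≤ K * Real.sqrt (LargeDev.errTerm B (LargeDev.zOf q V)) ∧
            LargeDev.tailProb P q X Q V =
              Real.exp (-(α * Real.exp (-LargeDev.eta ν - 1) * LargeDev.zOf q V *
                Real.log (LargeDev.zOf q V) ^ (A - 1) * (1 + θ))) := by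
  have hα := hq.alpha_pos
  have hA := hq.A_nonneg
  obtain ⟨K, c₁, hK, hz⟩ := hq.zOf_spec 1
  have ht0 : 0 < tailConst κ c₀ := by
    rw [tailConst]
    positivity
  obtain ⟨a, ha⟩ : ∃ a, a = 4 + tailConst κ c₀ := ⟨_, rfl⟩
  have ha0 : 0 < a := by linarith
  obtain ⟨D₂, σ₂, hD₂, hcgf⟩ := hq.cgf_weightedSum_le
  obtain ⟨σ₃, h2V⟩ := hq.eventually_harmonicSum_le_two_mul hK (a + 2)
  obtain ⟨M, σ₄, hM, hsad⟩ := hq.abs_cgf_weightedSum_sub_saddle_le hκ hc₀ C₂ hK ha.ge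
  obtain ⟨D₃, hD₃⟩ : ∃ D, D = 2 * D₂ * Real.exp (a + 1) := ⟨_, rfl⟩
  obtain ⟨D₄, hD₄⟩ : ∃ D, D = D₃ + 4 * Real.exp a + 3 := ⟨_, rfl⟩
  obtain ⟨D, hD⟩ : ∃ D, D = 3 * D₄ + Real.exp a + 1 + (a + 1) := ⟨_, rfl⟩
  have hD₃0 : 0 < D₃ := by rw [hD₃]; positivity
  have hD₄3 : 3 ≤ D₄ := by rw [hD₄]; linarith [Real.exp_pos a]
  have hD0 : 0 < D := by rw [hD]; positivity
  obtain ⟨Θ, l₀, y₀, hΘ, hrange⟩ := hq.range_spec K hD0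
  obtain ⟨c₂, hc₂⟩ := hq.le_log_of_le_rangeBound (le_max_right l₀ 1)
  obtain ⟨σ₅, hσ₅⟩ := Filter.eventually_atTop.1
    (((((tendsto_errTerm hq.one_lt_B).const_mul M).eventually
      (ge_mem_nhds (show M * 0 < 1 / 8 by norm_num))).and
    (eventually_mul_rpow_le_exp (10 * Real.exp a / (α * M)) (2 - A) zero_lt_one)).and
    ((eventually_mul_rpow_le_exp (8 * |C₁|) 0 zero_lt_one).and
    (Filter.eventually_ge_atTop (Real.exp 1))))
  obtain ⟨σ₀, hσ₀⟩ : ∃ σ, σ = max (max (σ₂ + a) σ₃) (max σ₄ σ₅) := ⟨_, rfl⟩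
  refine ⟨max (max c₁ c₂) (max (max (harmonicSum q (Real.exp σ₀) + 1) (harmonicConst q α β A)) 2),
    lt_of_lt_of_le one_lt_two ((le_max_right _ _).trans (le_max_right _ _)), Θ, hΘ,
    6 * Real.sqrt (8 * M), by positivity, Real.exp (max y₀ (Real.exp 1)), ?_⟩
  intro Q hQ L hL1 hL2 Ω _ P _ Ω' _ P' _ X Y ν hX hY V hcV hVR
  have v1 : c₁ ≤ V := (le_max_left _ _).trans ((le_max_left _ _).trans hcV)
  have v2 : c₂ ≤ V := (le_max_right _ _).trans ((le_max_left _ _).trans hcV)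
  have v3 : harmonicSum q (Real.exp σ₀) + 1 ≤ V :=
    (le_max_left _ _).trans ((le_max_left _ _).trans ((le_max_right _ _).trans hcV))
  have v4 : harmonicConst q α β A ≤ V :=
    (le_max_right _ _).trans ((le_max_left _ _).trans ((le_max_right _ _).trans hcV))
  have v5 : 2 ≤ V := (le_max_right _ _).trans ((le_max_right _ _).trans hcV)
  have hQ0 : 0 < Q := (Real.exp_pos _).trans_le hQ
  have hy : max y₀ (Real.exp 1) ≤ Real.log Q := (Real.le_log_iff_exp_le hQ0).2 hQ
  have hQy : Real.exp (Real.log Q) = Q := Real.exp_log hQ0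
  have hye : Real.exp 1 ≤ Real.log Q := (le_max_right _ _).trans hy
  have hL : 1 ≤ L :=
    (Real.one_le_rpow ((Real.one_le_exp zero_le_one).trans hye) (by positivity)).trans hL1
  have hLl : Real.exp (Real.log L) = L := Real.exp_log (by linarith)
  obtain ⟨ζ, hζ1, hζZ, hVH, hVζ⟩ := hz V v1
  have hζσ : σ₀ ≤ ζ := by
    by_contra hlt
    push Not at hlt
    linarith [hVH σ₀ hlt]
  have hl : max l₀ 1 ≤ Real.log L := hc₂ Θ L Q hΘ.le hL hye (v2.trans hVR)
  rw [rangeBound_eq q α β A Θ L ((Real.exp_pos 1).trans_le hye)] at hVR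
  obtain ⟨r1, r2, r3⟩ := hrange (Real.log Q) (Real.log L) ζ V ((le_max_left _ _).trans hy)
    ((le_max_left _ _).trans hl) (by rw [hLl, hQy]; exact hL2) hζ1 (by linarith) v4 hVH hVζ hVR
  rw [hQy] at r2 r3
  rw [hLl] at r3
  have z2 : σ₂ + a ≤ ζ := by
    refine le_trans ?_ hζσ
    rw [hσ₀]
    exact (le_max_left _ _).trans (le_max_left _ _)
  have z3 : σ₃ ≤ ζ := by
    refine le_trans ?_ hζσ
    rw [hσ₀]
    exact (le_max_right _ _).trans (le_max_left _ _)
  have z4 : σ₄ ≤ ζ := by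
    refine le_trans ?_ hζσ
    rw [hσ₀]
    exact (le_max_left _ _).trans (le_max_right _ _)
  have z5 : σ₅ ≤ ζ := by
    refine le_trans ?_ hζσ
    rw [hσ₀]
    exact (le_max_right _ _).trans (le_max_right _ _)
  obtain ⟨⟨w1, w2⟩, w3, w4⟩ := hσ₅ ζ z5
  rw [Real.rpow_zero, mul_one, one_mul] at w3
  rw [one_mul] at w2
  obtain ⟨h4V, h2V⟩ := h2V ζ V z3 hVζ
  have hζ0 : 0 < ζ := by linarith
  have hV0 : 0 < V := by linarith
  have hη : |eta ν| ≤ a - 1 := by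
    have := hY.isProbabilityMeasure_law
    rw [eta_eq_neg_integral (hY.isProfile hκ hc₀), abs_neg]
    exact (hY.isProfile hκ hc₀).abs_integral_id_le.trans (by linarith)
  have hηabs := abs_le.1 hη
  have hsad' := fun τ => hsad hY (Real.log Q) ζ V τ z4 hVζ (by rw [hD] at r1; linarith [Real.exp_pos a])
  rw [hQy] at hsad'
  obtain ⟨E, hE⟩ : ∃ E, E = errTerm B (Real.exp ζ) := ⟨_, rfl⟩
  have hE0 : ζ⁻¹ ≤ E := hE ▸ inv_le_errTerm B w4
  have hEpos : 0 < E := lt_of_lt_of_le (by positivity) hE0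
  rw [hζZ, Real.log_exp, tailProb]
  rw [← hE] at hsad' w1 ⊢
  obtain ⟨N, hN⟩ : ∃ N, N = α * ζ ^ (A - 1) := ⟨_, rfl⟩
  rw [← hN] at hsad' h4V
  have hN0 : 0 < N := by rw [hN]; positivity
  obtain ⟨s₀, hs₀⟩ : ∃ s, s = Real.exp (ζ - eta ν - 1) := ⟨_, rfl⟩
  rw [← hs₀] at hsad'
  have hs₀0 : 0 < s₀ := by rw [hs₀]; positivity
  obtain ⟨U, hU⟩ : ∃ U, U = Real.exp ζ * V := ⟨_, rfl⟩
  have hζexp : ζ + 1 ≤ Real.exp ζ := Real.add_one_le_exp ζ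
  have hUζ : Real.exp ζ ≤ U := by
    rw [hU]
    exact le_mul_of_one_le_right (Real.exp_pos _).le (by linarith)
  have hU1 : 1 ≤ U := by linarith
  have hsU : ∀ τ ≤ 2, s₀ * Real.exp τ * V ≤ Real.exp a * U := by
    intro τ hτ
    rw [hU, ← mul_assoc, hs₀, ← Real.exp_add, ← Real.exp_add]
    exact mul_le_mul_of_nonneg_right (Real.exp_le_exp.2 (by linarith)) hV0.le
  have hcgfY : ∀ τ, 0 ≤ τ → τ ≤ 2 →
      ProbabilityTheory.cgf (weightedSum q Y Q) P' (Real.exp 1 * (s₀ * Real.exp τ)) ≤ D₃ * U ∧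
      ProbabilityTheory.cgf (weightedSum q Y Q) P' (-(Real.exp 1 * (s₀ * Real.exp τ))) ≤
        D₃ * U := by
    intro τ hτ0 hτ2
    have e1 : Real.exp 1 * (s₀ * Real.exp τ) = Real.exp (ζ + (τ - eta ν)) := by
      rw [hs₀, ← Real.exp_add, ← Real.exp_add]
      congr 1
      ring
    have e2 : D₂ * (Real.exp (ζ + (τ - eta ν)) * harmonicSum q (Real.exp (ζ + (τ - eta ν)))) ≤
        D₃ * U := by
      have e3 := h2V (τ - eta ν) (by rw [abs_le]; constructor <;> linarith)
      calc _ ≤ D₂ * (Real.exp (ζ + (a + 1)) * (2 * V)) := by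
            have e4 := hq.harmonicSum_nonneg (Real.exp (ζ + (τ - eta ν)))
            have e5 : ζ + (τ - eta ν) ≤ ζ + (a + 1) := by linarith
            gcongr
        _ = D₃ * U := by
            rw [Real.exp_add, hD₃, hU]
            ring
    have e4 := hcgf hY Q (ζ + (τ - eta ν)) (by linarith)
    rw [e1]
    exact ⟨e4.1.trans e2, e4.2.trans e2⟩
  obtain ⟨m, hm⟩ : ∃ m, m = ⌈D₄ * U⌉₊ := ⟨_, rfl⟩
  have hD₄U : 3 ≤ D₄ * U := by
    have := mul_le_mul hD₄3 hU1 zero_le_one (by linarith)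
    linarith
  have hm1 : D₄ * U ≤ m := hm ▸ Nat.le_ceil _
  have hm2 : (m : ℝ) ≤ D₄ * U + 1 := hm ▸ (Nat.ceil_lt_add_one (by linarith)).le
  have hkeven : Even (2 * m) := even_two_mul m
  have hk1 : D₃ * U + 3 ≤ ((2 * m : ℕ) : ℝ) := by
    push_cast
    have : D₄ * U = D₃ * U + 4 * (Real.exp a * U) + 3 * U := by rw [hD₄]; ring
    have : 0 ≤ Real.exp a * U := by positivity
    linarith
  have hk2 : 2 * (s₀ * Real.exp 2 * (V + 2 * N)) + 1 ≤ ((2 * m : ℕ) : ℝ) := by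
    push_cast
    have e1 : D₄ * U = D₃ * U + 4 * (Real.exp a * U) + 3 * U := by rw [hD₄]; ring
    have e2 := hsU 2 le_rfl
    have e3 : s₀ * Real.exp 2 * (V + 2 * N) ≤ s₀ * Real.exp 2 * (2 * V) := by
      gcongr
      linarith
    have : 0 ≤ D₃ * U := by positivity
    linarith
  have hk3 : ((2 * m : ℕ) : ℝ) ≤ 3 * D₄ * U := by
    push_cast
    linarith
  have hl1 : 1 ≤ harmonicSum q Q / V := by rwa [one_le_div₀ hV0]
  have hlog := Real.log_nonneg hl1
  have hr3 : (3 * D₄ * U + Real.exp a * U + U) * (1 + Real.log (harmonicSum q Q / V)) ≤ L := by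
    refine le_trans ?_ r3
    rw [← mul_assoc (Real.exp ζ), ← hU, ← mul_assoc D]
    gcongr
    have e1 : D * U = 3 * D₄ * U + Real.exp a * U + U + (a + 1) * U := by rw [hD]; ring
    have e2 : 0 ≤ (a + 1) * U := by positivity
    linarith
  have hkL : ((2 * m : ℕ) : ℝ) ≤ L := by
    refine hk3.trans (le_trans ?_ hr3)
    have e1 : 0 ≤ Real.exp a * U := by positivity
    have e2 : 0 ≤ 3 * D₄ * U := by linarith
    refine le_trans (b := 3 * D₄ * U + Real.exp a * U + U) (by linarith) ?_
    exact le_mul_of_one_le_right (by linarith) (by linarith)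
  have herr : ∀ τ ≤ 2, |C₁| * Real.exp (-L) * ((harmonicSum q Q / V) ^ (2 * m) *
      Real.exp (s₀ * Real.exp τ * harmonicSum q Q / (harmonicSum q Q / V))) ≤ 1 / 8 := by
    intro τ hτ
    have hH0 : 0 < harmonicSum q Q := by linarith
    have e1 : s₀ * Real.exp τ * harmonicSum q Q / (harmonicSum q Q / V) = s₀ * Real.exp τ * V := by
      field_simp
    have e2 : (harmonicSum q Q / V) ^ (2 * m) =
        Real.exp ((2 * m : ℕ) * Real.log (harmonicSum q Q / V)) := by
      rw [Real.exp_nat_mul, Real.exp_log (by linarith)]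
    have e3 : ((2 * m : ℕ) : ℝ) * Real.log (harmonicSum q Q / V) ≤
        3 * D₄ * U * Real.log (harmonicSum q Q / V) := by gcongr
    have e4 : 0 ≤ (Real.exp a * U + U) * Real.log (harmonicSum q Q / V) := by positivity
    have e5 : 0 ≤ 3 * D₄ * U := by linarith
    rw [e1, e2, mul_assoc, ← Real.exp_add, ← Real.exp_add]
    calc _ ≤ |C₁| * Real.exp (-ζ) := by
          gcongr
          linarith [hsU τ hτ]
      _ ≤ 1 / 8 := by
          rw [Real.exp_neg, ← div_eq_mul_inv, div_le_iff₀ (Real.exp_pos _)]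
          linarith
  have hbd := fun τ (h0 : 0 ≤ τ) (h2 : τ ≤ 2) =>
    hX.integral_expTrunc_bounds hY hq hkeven hkL (s := s₀ * Real.exp τ) (by positivity) hl1
      (hcgfY τ h0 h2).1 (hcgfY τ h0 h2).2 hk1 (herr τ h2)
  have hδ : 10 ≤ s₀ * N * (M * E) := by
    have e1 : 10 * Real.exp a * ζ ^ (2 - A) ≤ Real.exp ζ * (α * M) := by
      rwa [div_mul_eq_mul_div, div_le_iff₀ (by positivity)] at w2
    have e2 : Real.exp (ζ - a) ≤ s₀ := by
      rw [hs₀]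
      apply Real.exp_le_exp.2
      linarith
    have e3 : ζ ^ (2 - A) * (ζ ^ (A - 1) * ζ⁻¹) = 1 := by
      rw [← Real.rpow_neg_one ζ, ← Real.rpow_add hζ0, ← Real.rpow_add hζ0,
        show 2 - A + (A - 1 + -1) = 0 by ring, Real.rpow_zero]
    have e4 : 10 * Real.exp a ≤ Real.exp ζ * (α * M) * (ζ ^ (A - 1) * ζ⁻¹) := by
      calc 10 * Real.exp a = 10 * Real.exp a * ζ ^ (2 - A) * (ζ ^ (A - 1) * ζ⁻¹) := by
            rw [mul_assoc _ (ζ ^ (2 - A)), e3, mul_one]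
        _ ≤ _ := by gcongr
    calc (10 : ℝ) ≤ Real.exp ζ * (α * M) * (ζ ^ (A - 1) * ζ⁻¹) / Real.exp a := by
          rwa [le_div_iff₀ (Real.exp_pos a)]
      _ = Real.exp (ζ - a) * (α * ζ ^ (A - 1)) * (M * ζ⁻¹) := by
          rw [Real.exp_sub]
          ring
      _ ≤ _ := by
          rw [hN]
          gcongr
  have hsq : Real.sqrt (8 * (M * E)) ^ 2 = 8 * (M * E) := Real.sq_sqrt (by positivity)
  obtain ⟨θ, hθ1, hθ2⟩ := exists_measureReal_eq_exp (hX.measurable_weightedSum hq) hkeven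
    (fun j hj => (hX.moment_weightedSum hq ((Nat.cast_le.2 hj).trans hkL)).1)
    (g := fun τ => ProbabilityTheory.cgf (weightedSum q Y Q) P' (s₀ * Real.exp τ))
    (ε := Real.sqrt (8 * (M * E))) (δ := M * E) hN0 hs₀0 h4V (by positivity)
    (Real.sqrt_le_one.2 (by linarith)) (by positivity) hsq.ge hδ hk2
    (fun τ h0 h2 => (hbd τ h0 h2).1) (fun τ h0 h2 => (hbd τ h0 h2).2) hsad'
  refine ⟨θ, hθ1.trans_eq ?_, hθ2.trans ?_⟩
  · rw [← mul_assoc 8 M E, Real.sqrt_mul (by positivity)]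
    ring
  · congr 2
    rw [hs₀, hN, show ζ - eta ν - 1 = (-eta ν - 1) + ζ by ring, Real.exp_add]
    ring
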